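/- **Setting.** Let $(X_i)_{i\ge1}$ be an i.i.d. process with values in a measurable space $\mathcal X$, let $X'=(X'_i)$ be an independent copy of it, and let $\tilde X$ be a further copy of $X_1$ independent of both. Let $(K_n)$ be a nondecreasing sequence of integers with $2\le K_n\le n$ for all large $n$, and let $N_n=\{\,n-\lfloor n/K_n\rfloor,\ n-\lceil n/K_n\rceil\,\}$ be the set of training-set sizes of a balanced $K_n$-fold split of $n$ observations. *Training.* Let $\Psi:\mathcal X\times\mathbb R^d\to\mathbb R$ be measurable, with $\Psi(x,\cdot)$ strictly convex and twice differentiable for every $x$ and $\mathbb E|\Psi(X_1,\theta)|<\infty$ for every $\theta$. For $l\ge0$ let $\hat\theta_l:\mathcal X^l\to\mathbb R^d$ be measurable, such that for every $l\ge1$, almost surely, $\hat\theta_l(X_1,\dots,X_l)$ minimises $\theta\mapsto\frac1l\sum_{i\le l}\Psi(X_i,\theta)$. Let $\theta^*$ be a minimiser of $\theta\mapsto\mathbb E[\Psi(X_1,\theta)]$. Assume that $\mathbb E\|\partial_\theta\Psi(X_1,\theta^*)\|^2<\infty$, that $\partial^2_\theta\Psi(X_1,\theta^*)$ is integrable, that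 the function $\theta\mapsto\mathbb E[\Psi(X_1,\theta)]$ is twice differentiable at $\theta^*$ with Hessian $$H:=\mathbb E\bigl[\partial^2_\theta\Psi(X_1,\theta^*)\bigr]=\partial^2_\theta\,\mathbb E\bigl[\Psi(X_1,\theta)\bigr]\big|_{\theta=\theta^*},$$ and that $H$ is invertible. *Evaluation.* Let $\mathcal L:\mathcal X\times\mathbb R^d\to\mathbb R$ be measurable, with $\mathbb E[\mathcal L(X_1,\theta)^2]<\infty$ for every $\theta$, with $\mathcal L(X_1,\cdot)$ almost surely continuous at $\theta^*$, and with differentiable risk $R(\theta)=\mathbb E[\mathcal L(X_1,\theta)]$. *Stability.* For a sequence $x$ in $\mathcal X$ and $y\in\mathcal X$ write $\mathcal L_l(y,x)=\mathcal L(y,\hat\theta_l(x_1,\dots,x_l))$, and let $X^{1},X^{2},X^{1,2}$ be $X$ with the entries of index $1$, $2$, or both, replaced by those of $X'$. Put $$\beta_1^l=\mathcal L_l(\tilde X,X)-\mathcal L_l(\tilde X,X^{1}),\qquad \beta_2^l=\beta_1^l-\bigl(\mathcal L_l(\tilde X,X^{2})-\mathcal L_l(\tilde X,X^{1,2})\bigr).$$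 Assume, as $n\to\infty$: - $(H_0)$ each $\hat\theta_l$ is invariant under permutations of its $l$ arguments; - $(H_1)$ $\max_{l\in N_n}\|\mathcal L_l(\tilde X,X)\|_{L_4}=O(1)$; - $(H_2)$ $\sqrt n\max_{l\in N_n}\|\beta_1^l\|_{L_4}=o(1)$ and $n\max_{l\in N_n}\|\beta_2^l\|_{L_4}=o(1)$; - $(H_3)$ $n\max_{l\in N_n}\|\mathbb E[\beta_1^l\mid X]\|_{L_4}=O(1)$ and $n^{3/2}\max_{l\in N_n}\|\mathbb E[\beta_2^l\mid X]\|_{L_4}=o(1)$. Write $\bar{\mathcal L}_l(x)=\mathbb E\bigl[\mathcal L(x,\hat\theta_l(X_1,\dots,X_l))\bigr]$. The *covariance term* of the cross-validated risk is the real number $\rho$, when it exists, for which $$\max_{l_1,l_2\in N_n}\Bigl|\,l_1\operatorname{Cov}\bigl(\bar{\mathcal L}_{l_2}(X_1),\ \mathbb E[\beta_1^{l_1}\mid X_1]\bigr)-\rho\,\Bigr|\longrightarrow0\qquad(n\to\infty).$$ **Proposition.** The covariance term $\rho$ exists, is unique, and $$\rho=-\operatorname{Cov}\Bigl(\partial_\theta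 R(\theta^*)^{\top}H^{-1}\,\partial_\theta\Psi(X_1,\theta^*),\ \mathcal L(X_1,\theta^*)\Bigr).$$ In particular, if $\Psi=\mathcal L$ then $\rho=0$. -/

import Mathlib

open MeasureTheory ProbabilityTheory Filter Topology
open scoped ENNReal NNReal

namespace CrossVal

noncomputable section

/-- The sizes of the training sets in a balanced `K n`-fold split of `n` observations: the folds
have size `⌊n / K n⌋` or `⌈n / K n⌉`, so there are at most two training sizes. -/
def trainSizes (K : ℕ → ℕ) (n : ℕ) : Finset ℕ :=
  {n - n / K n, n - n ⌈/⌉ K n}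

/-- First difference `∇ᵢ`: the effect on `f` of replacing the `i`-th entry of `x` by that
of `x'`. -/
def nabla {S : Type*} (f : (ℕ → S) → ℝ) (x x' : ℕ → S) (i : ℕ) : ℝ :=
  f x - f (Function.update x i (x' i))

/-- Second difference `∇ᵢⱼ`. -/
def nabla₂ {S : Type*} (f : (ℕ → S) → ℝ) (x x' : ℕ → S) (i j : ℕ) : ℝ :=
  nabla f x x' i - nabla f (Function.update x j (x' j)) x' i

section

variable {Ω S Y : Type*} [MeasurableSpace Ω] [MeasurableSpace S]

/-- The observations `X`, the process `X'` used for replacements and the fresh observation `Xt`,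
as a single family of random variables. -/
def allSamples (X X' : ℕ → Ω → S) (Xt : Ω → S) : ℕ ⊕ ℕ ⊕ Unit → Ω → S :=
  Sum.elim X (Sum.elim X' fun _ => Xt)

/-- `X` is an i.i.d. process, `X'` is an independent copy of `X`, and `Xt` is one more
independent copy of an observation. -/
structure IsIIDWithCopies (P : Measure Ω) (X X' : ℕ → Ω → S) (Xt : Ω → S) : Prop where
  measurable : ∀ s, Measurable (allSamples X X' Xt s)
  indep : iIndepFun (allSamples X X' Xt) P
  identDistrib : ∀ s, IdentDistrib (allSamples X X' Xt s) (X 0) P P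

/-- The loss at the fresh observation `y` of the estimator trained on the first `l` entries. -/
def testLoss (L : S → Y → ℝ) (f : (l : ℕ) → (Fin l → S) → Y) (l : ℕ) (y : S)
    (x : ℕ → S) : ℝ :=
  L y (f l fun i => x i)

/-- First order stability `β₁`: the first observation (index `0`) is replaced. -/
def beta₁ (X X' : ℕ → Ω → S) (Xt : Ω → S) (L : S → Y → ℝ)
    (f : (l : ℕ) → (Fin l → S) → Y) (l : ℕ) (ω : Ω) : ℝ :=
  nabla (testLoss L f l (Xt ω)) (fun i => X i ω) (fun i => X' i ω) 0

/-- Second order stability `β₂`: the first two observations (indices `0`, `1`) are replaced. -/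
def beta₂ (X X' : ℕ → Ω → S) (Xt : Ω → S) (L : S → Y → ℝ)
    (f : (l : ℕ) → (Fin l → S) → Y) (l : ℕ) (ω : Ω) : ℝ :=
  nabla₂ (testLoss L f l (Xt ω)) (fun i => X i ω) (fun i => X' i ω) 0 1

/-- The σ-algebra generated by the whole process `X`. -/
abbrev sigmaProcess (X : ℕ → Ω → S) : MeasurableSpace Ω :=
  MeasurableSpace.comap (fun ω i => X i ω) MeasurableSpace.pi

/-- The σ-algebra generated by the first observation. -/
abbrev sigmaFirst (X : ℕ → Ω → S) : MeasurableSpace Ω :=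
  MeasurableSpace.comap (X 0) inferInstance

/-- The stability conditions `H₀`-`H₃`, with `L₄` norms. -/
structure StabilityConditions (P : Measure Ω) (X X' : ℕ → Ω → S) (Xt : Ω → S)
    (L : S → Y → ℝ) (f : (l : ℕ) → (Fin l → S) → Y) (K : ℕ → ℕ) : Prop where
  H₀ : ∀ (l : ℕ) (π : Equiv.Perm (Fin l)) (x : Fin l → S), f l (x ∘ π) = f l x
  H₁ : ∃ C : ℝ≥0, ∀ᶠ n in atTop,
    ((trainSizes K n).sup fun l =>
      eLpNorm (fun ω => testLoss L f l (Xt ω) fun i => X i ω) 4 P) ≤ C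
  H₂_first : Tendsto (fun n : ℕ => ENNReal.ofReal (√(n : ℝ)) *
    (trainSizes K n).sup fun l => eLpNorm (beta₁ X X' Xt L f l) 4 P) atTop (𝓝 0)
  H₂_second : Tendsto (fun n : ℕ => (n : ℝ≥0∞) *
    (trainSizes K n).sup fun l => eLpNorm (beta₂ X X' Xt L f l) 4 P) atTop (𝓝 0)
  H₃_first : ∃ C : ℝ≥0, ∀ᶠ n : ℕ in atTop, (n : ℝ≥0∞) *
    ((trainSizes K n).sup fun l =>
      eLpNorm (P[beta₁ X X' Xt L f l | sigmaProcess X]) 4 P) ≤ C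
  H₃_second : Tendsto (fun n : ℕ => ENNReal.ofReal ((n : ℝ) ^ (3 / 2 : ℝ)) *
    (trainSizes K n).sup fun l =>
      eLpNorm (P[beta₂ X X' Xt L f l | sigmaProcess X]) 4 P) atTop (𝓝 0)

/-- The average loss `L̄ₗ(x) = E L(x, fₗ(X₁, …, Xₗ))` at the point `x`. -/
def avgLoss (P : Measure Ω) (X : ℕ → Ω → S) (L : S → Y → ℝ)
    (f : (l : ℕ) → (Fin l → S) → Y) (l : ℕ) (x : S) : ℝ :=
  ∫ ω, testLoss L f l x (fun i => X i ω) ∂P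

/-- `ρ` is the covariance term of the cross-validated risk: the limit of
`l₁ Cov(L̄_{l₂}(X₁), E[β₁^{l₁} | X₁])`, uniformly over the training sizes `l₁`, `l₂`. -/
def IsCovarianceTerm (P : Measure Ω) (X X' : ℕ → Ω → S) (Xt : Ω → S)
    (L : S → Y → ℝ) (f : (l : ℕ) → (Fin l → S) → Y) (K : ℕ → ℕ) (ρ : ℝ) : Prop :=
  ∃ ε : ℕ → ℝ, Tendsto ε atTop (𝓝 0) ∧
    ∀ n, ∀ l₁ ∈ trainSizes K n, ∀ l₂ ∈ trainSizes K n,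
      |(l₁ : ℝ) * covariance (fun ω => avgLoss P X L f l₂ (X 0 ω))
        (P[beta₁ X X' Xt L f l₁ | sigmaFirst X]) P - ρ| ≤ ε n

/-- The expectation `E L(X₁, θ)`: the risk for a test loss, the population objective for a
training loss. -/
def risk (P : Measure Ω) (X : ℕ → Ω → S) (L : S → Y → ℝ) (θ : Y) : ℝ :=
  ∫ ω, L (X 0 ω) θ ∂P

/-- For every `l ≥ 1`, almost surely `θhat l` is a minimiser of the empirical objective
`l⁻¹ ∑ᵢ Ψ(Xᵢ, θ)` on the first `l` observations. -/
def IsMEstimator (P : Measure Ω) (X : ℕ → Ω → S) (Ψ : S → Y → ℝ)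
    (θhat : (l : ℕ) → (Fin l → S) → Y) : Prop :=
  ∀ l : ℕ, 1 ≤ l → ∀ᵐ ω ∂P,
    IsMinOn (fun θ => (l : ℝ)⁻¹ * ∑ i : Fin l, Ψ (X i ω) θ) Set.univ
      (θhat l fun i => X i ω)

end

/-- The Hessian of a function on `ℝᵈ`, as a linear map. -/
def hessian {d : ℕ} (f : EuclideanSpace ℝ (Fin d) → ℝ) (θ : EuclideanSpace ℝ (Fin d)) :
    EuclideanSpace ℝ (Fin d) →L[ℝ] EuclideanSpace ℝ (Fin d) :=
  fderiv ℝ (gradient f) θ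

/-- The expected Hessian `E ∂²Ψ(X₁, θ)`. -/
def expectedHessian {Ω S : Type*} [MeasurableSpace Ω] {d : ℕ} (P : Measure Ω)
    (X : ℕ → Ω → S) (Ψ : S → EuclideanSpace ℝ (Fin d) → ℝ) (θ : EuclideanSpace ℝ (Fin d)) :
    EuclideanSpace ℝ (Fin d) →L[ℝ] EuclideanSpace ℝ (Fin d) :=
  ∫ ω, hessian (Ψ (X 0 ω)) θ ∂P

end

end CrossVal

/-! Let F be the risk R(θ̂_l) of the trained estimator, seen as a symmetric function of the training
sample. Integrating out the test point and the replacement shows that E[β₁ | X] is F minus its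
average over the first coordinate (`condExp_beta₁`). That average is independent of X₁, and all
coordinates play the same role, so l · Cov(φ(X₁), E[β₁ | X₁]) = Cov(∑_{i ≤ l} φ(X_i), F) for every
square integrable φ(X₁) (`mul_covariance_condExp_beta₁`). It remains to see how F correlates with
sums over the sample.

Recentred at θ* and rescaled by √l, the empirical objective is a convex function plus the linear
term given by the normalised score. The convex function converges pointwise in probability to the
quadratic form of H/2. For convex functions finitely many points control a compact set, so the
minimisers converge too: √l (θ̂_l − θ*) = −H⁻¹ l^{-1/2} ∑ ∂Ψ(X_i, θ*) + o_P(1)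
(`tendstoInMeasure_mEstimator`). The delta method turns this into √l (F − R(θ*)) = −l^{-1/2} ∑
g(X_i) + o_P(1) with g = ∂R(θ*)ᵀ H⁻¹ ∂Ψ(·, θ*).

Convergence in probability does not pass to covariances without moment bounds. The Efron-Stein
inequality and the first part of H₃ bound l · Var F (`variance_trainedRisk_le`). H₁ passes to the
limit by Fatou, so L(X₁, θ*) lies in L⁴ and its centred normalised sums are bounded in L⁴. Together
these give Cov(∑ φ(X_i), F) → −Cov(g, φ) for φ = L(·, θ*) (`tendsto_covariance_sum`).

Finally, the average loss converges to L(·, θ*) in L² (`tendsto_avgLoss`), and by Cauchy-Schwarz and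
the bound on l · Var F the replacement costs nothing in the limit. When Ψ = L, θ* is a critical
point of R, so g = 0. -/

namespace CrossVal

/-! ### Convex functions, Hessians at a minimum, stability of minimisers -/

section ConvexAnalysis

variable {E : Type*} [NormedAddCommGroup E] [InnerProductSpace ℝ E] [FiniteDimensional ℝ E]

/-- Near a point, a convex function is controlled by its values at finitely many points. -/
lemma exists_finset_convex_bound (x : E) {U : Set E} (hU : U ∈ 𝓝 x) :
    ∃ (V : Finset E) (r : ℝ), 0 < r ∧ (V : Set E) ⊆ U ∧ Metric.ball x r ⊆ U ∧
      ∀ f : E → ℝ, ConvexOn ℝ Set.univ f → ∀ B, (∀ v ∈ V, f v ≤ B) →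
        ∀ s ∈ Metric.ball x r, f s ≤ B ∧ 2 * f x - B ≤ f s := by
  -- A simplex inside U with x in its interior: on it a convex function is at most its largest
  -- vertex value.
  obtain ⟨b, hb1, hb2⟩ := exists_mem_interior_convexHull_affineBasis hU
  obtain ⟨r, hr, hball⟩ := Metric.isOpen_iff.1 isOpen_interior x hb1
  refine ⟨(Set.finite_range b).toFinset, r, hr, ?_, ?_, ?_⟩
  · simpa using (subset_convexHull ℝ _).trans hb2
  · exact hball.trans (interior_subset.trans hb2)
  · intro f hf B hB
    have key : ∀ s ∈ Metric.ball x r, f s ≤ B := by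
      intro s hs
      obtain ⟨y, hy, hle⟩ := hf.exists_ge_of_mem_convexHull (Set.subset_univ _)
        (interior_subset (hball hs))
      exact hle.trans (hB y (by simpa using hy))
    intro s hs
    refine ⟨key s hs, ?_⟩
    -- For the lower bound, x is the midpoint of s and its reflection 2x − s, where the upper bound
    -- holds.
    have hs' : (2 : ℝ) • x - s ∈ Metric.ball x r := by
      rw [Metric.mem_ball, dist_eq_norm] at hs ⊢
      rwa [show (2 : ℝ) • x - s - x = -(s - x) by rw [two_smul]; abel, norm_neg]
    have h1 := key _ hs'
    have h2 := hf.2 (Set.mem_univ s) (Set.mem_univ ((2 : ℝ) • x - s))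
      (by norm_num : (0 : ℝ) ≤ 1 / 2) (by norm_num : (0 : ℝ) ≤ 1 / 2) (by norm_num)
    have h3 : (1 / 2 : ℝ) • s + (1 / 2 : ℝ) • ((2 : ℝ) • x - s) = x := by
      rw [smul_sub, smul_smul]; norm_num
    rw [h3] at h2
    simp only [smul_eq_mul] at h2
    linarith

/-- Convex functions close to a continuous function on a suitable finite set are uniformly close
to it on a compact set. -/
lemma exists_finset_convex_uniform {Q : E → ℝ} (hQ : Continuous Q) {C : Set E} (hC : IsCompact C)
    {ε : ℝ} (hε : 0 < ε) :
    ∃ T : Finset E, ∀ G : E → ℝ, ConvexOn ℝ Set.univ G → (∀ v ∈ T, |G v - Q v| ≤ ε) →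
      ∀ s ∈ C, |G s - Q s| ≤ 5 * ε := by
  classical
  refine hC.induction_on (p := fun N => ∃ T : Finset E, ∀ G : E → ℝ, ConvexOn ℝ Set.univ G →
    (∀ v ∈ T, |G v - Q v| ≤ ε) → ∀ s ∈ N, |G s - Q s| ≤ 5 * ε) ⟨∅, by simp⟩ ?_ ?_ ?_
  · rintro s t hst ⟨T, hT⟩
    exact ⟨T, fun G hG h x hx => hT G hG h x (hst hx)⟩
  · rintro s t ⟨T, hT⟩ ⟨T', hT'⟩
    refine ⟨T ∪ T', fun G hG h x hx => ?_⟩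
    rcases hx with hx | hx
    · exact hT G hG (fun v hv => h v (Finset.mem_union_left _ hv)) x hx
    · exact hT' G hG (fun v hv => h v (Finset.mem_union_right _ hv)) x hx
  · intro x _
    have hU : {y | |Q y - Q x| ≤ ε} ∈ 𝓝 x := by
      have : Tendsto Q (𝓝 x) (𝓝 (Q x)) := hQ.tendsto x
      filter_upwards [this (Metric.closedBall_mem_nhds _ hε)] with y hy
      simpa [Real.dist_eq] using hy
    obtain ⟨V, r, hr, hV, hball, hbd⟩ := exists_finset_convex_bound x hU
    refine ⟨Metric.ball x r, mem_nhdsWithin_of_mem_nhds (Metric.ball_mem_nhds x hr),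
      insert x V, fun G hG h s hs => ?_⟩
    -- At the vertices G ≤ Q + ε ≤ Q x + 2ε. Reflection gives G s ≥ 2 (Q x − ε) − (Q x + 2ε) = Q x −
    -- 4ε, and Q varies by at most ε on the ball, hence the factor 5.
    have h1 := hbd G hG (Q x + 2 * ε) (fun v hv => by
      have h2 := abs_le.1 (h v (Finset.mem_insert_of_mem hv))
      have h3 := abs_le.1 (show |Q v - Q x| ≤ ε from hV hv)
      linarith [h2.2, h3.2]) s hs
    have h2 := abs_le.1 (h x (Finset.mem_insert_self x V))
    have h3 := abs_le.1 (show |Q s - Q x| ≤ ε from hball hs)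
    rw [abs_le]
    constructor <;> linarith [h1.1, h1.2, h2.1, h2.2, h3.1, h3.2]

omit [FiniteDimensional ℝ E] in
/-- Second order expansion along a ray. -/
lemma tendsto_second_order_ray [CompleteSpace E] {f : E → ℝ} {g : E → E}
    (hg : ∀ y, HasGradientAt f (g y) y) {A : E →L[ℝ] E} {θ : E} (hA : HasFDerivAt g A θ) (t : E) :
    Tendsto (fun s : ℝ => (f (θ + s • t) - f θ - s * inner ℝ (g θ) t) / s ^ 2) (𝓝[>] 0)
      (𝓝 (inner ℝ (A t) t / 2)) := by
  have hline : ∀ s : ℝ, HasDerivAt (fun s : ℝ => θ + s • t) t s := fun s => by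
    simpa using ((hasDerivAt_id s).smul_const t).const_add θ
  have hf : ∀ s : ℝ, HasDerivAt (fun s : ℝ => f (θ + s • t) - f θ - s * inner ℝ (g θ) t)
      (inner ℝ (g (θ + s • t)) t - inner ℝ (g θ) t) s := fun s => by
    have h1 := (hg (θ + s • t)).hasFDerivAt.comp_hasDerivAt s (hline s)
    have h2 := (h1.sub_const (f θ)).sub ((hasDerivAt_id s).mul_const (inner ℝ (g θ) t))
    refine (h2.congr_deriv ?_)
    simp
  have hgd : HasDerivAt (fun s : ℝ => g (θ + s • t)) (A t) 0 := by
    have hA' : HasFDerivAt g A (θ + (0 : ℝ) • t) := by simpa using hA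
    exact hA'.comp_hasDerivAt (0 : ℝ) (hline 0)
  have hslope := hgd.tendsto_slope.mono_left (nhdsGT_le_nhdsNE (0 : ℝ))
  have hcont : Continuous (fun s : ℝ => f (θ + s • t) - f θ - s * inner ℝ (g θ) t) :=
    continuous_iff_continuousAt.2 fun s => (hf s).continuousAt
  -- One use of l'Hôpital leaves half the difference quotient of g at θ, so g need only be
  -- differentiable at that single point.
  refine HasDerivAt.lhopital_zero_nhdsGT (f' := fun s => inner ℝ (g (θ + s • t)) t - inner ℝ (g θ) t)
    (g' := fun s => 2 * s) (Eventually.of_forall fun s => hf s)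
    (Eventually.of_forall fun s => by simpa using hasDerivAt_pow 2 s) ?_ ?_ ?_ ?_
  · filter_upwards [self_mem_nhdsWithin] with s hs
    have : (0 : ℝ) < s := hs
    positivity
  · have := hcont.tendsto 0
    simp only [zero_smul, add_zero, sub_self, zero_mul] at this
    exact this.mono_left nhdsWithin_le_nhds
  · have : Continuous fun s : ℝ => s ^ 2 := by fun_prop
    have := this.tendsto 0
    simp only [ne_eq, OfNat.ofNat_ne_zero, not_false_eq_true, zero_pow] at this
    exact this.mono_left nhdsWithin_le_nhds
  · have h := (Filter.Tendsto.inner (𝕜 := ℝ) hslope (tendsto_const_nhds (x := t))).div_const 2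
    refine h.congr fun s => ?_
    simp only [slope, vsub_eq_sub, sub_zero, zero_smul, add_zero, inner_smul_left, inner_sub_left]
    simp
    ring

omit [FiniteDimensional ℝ E] in
lemma inner_hessian_symm [CompleteSpace E] {M : E → ℝ} {g : E → E}
    (hg : ∀ y, HasGradientAt M (g y) y) {H : E →L[ℝ] E} {θ : E} (hH : HasFDerivAt g H θ) (x y : E) :
    inner ℝ (H x) y = inner ℝ (H y) x := by
  have h := second_derivative_symmetric (𝕜 := ℝ) (f := M)
    (f' := fun y => InnerProductSpace.toDual ℝ E (g y))
    (f'' := ((InnerProductSpace.toDual ℝ E).toContinuousLinearEquiv.toContinuousLinearMap).comp H)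
    (fun y => (hg y).hasFDerivAt)
    (((InnerProductSpace.toDual ℝ E).toContinuousLinearEquiv.toContinuousLinearMap).hasFDerivAt.comp
      θ hH) x y
  simpa using h

-- The expansion along rays at a minimum gives ⟨Hu, u⟩ ≥ 0. If ⟨Ht, t⟩ = 0 with Ht ≠ 0, moving from
-- t in the direction −Ht makes the form negative at first order, so injectivity of H upgrades
-- semidefinite to definite.
omit [FiniteDimensional ℝ E] in
lemma inner_hessian_pos [CompleteSpace E] {M : E → ℝ} {g : E → E}
    (hg : ∀ y, HasGradientAt M (g y) y) {H : E →L[ℝ] E} {θ : E} (hH : HasFDerivAt g H θ)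
    (hmin : IsMinOn M Set.univ θ) (hinj : Function.Injective H) {t : E} (ht : t ≠ 0) :
    0 < inner ℝ (H t) t := by
  have hsymm := inner_hessian_symm hg hH
  have hg0 : g θ = 0 := by
    have h1 : IsLocalMin M θ := hmin.isLocalMin Filter.univ_mem
    have h2 := h1.hasFDerivAt_eq_zero (hg θ).hasFDerivAt
    simpa using h2
  have hnn : ∀ u, 0 ≤ inner ℝ (H u) u := by
    intro u
    have h := tendsto_second_order_ray hg hH u
    have : 0 ≤ inner ℝ (H u) u / 2 := by
      refine ge_of_tendsto h (Eventually.of_forall fun s => ?_)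
      have : M θ ≤ M (θ + s • u) := hmin (Set.mem_univ _)
      rw [hg0, inner_zero_left, mul_zero, sub_zero]
      exact div_nonneg (by linarith) (by positivity)
    linarith
  refine lt_of_le_of_ne (hnn t) fun h0 => ?_
  have hHt : H t ≠ 0 := fun h => ht (hinj (by simpa using h))
  set u := H t with hu
  have hexp : ∀ s : ℝ, 0 ≤ 2 * s * inner ℝ u u + s ^ 2 * inner ℝ (H u) u := by
    intro s
    have h := hnn (t + s • u)
    simp only [map_add, map_smul, inner_add_left, inner_add_right, inner_smul_left,
      inner_smul_right, conj_trivial] at h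
    rw [hsymm u t, ← hu, ← h0] at h
    nlinarith
  have hpos : 0 < inner ℝ u u := real_inner_self_pos.2 hHt
  have hq := hnn u
  set a := inner ℝ u u
  set q := inner ℝ (H u) u
  -- Near the minimiser −a/q of the parabola; the added 1 covers q = 0.
  have := hexp (-(a / (q + 1)))
  have hq1 : 0 < q + 1 := by linarith
  have h1 : 2 * -(a / (q + 1)) * a + (-(a / (q + 1))) ^ 2 * q
      = -(a ^ 2 * (q + 2)) / (q + 1) ^ 2 := by field_simp; ring
  rw [h1] at this
  have h2 : 0 < a ^ 2 * (q + 2) / (q + 1) ^ 2 := by positivity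
  rw [neg_div] at this
  linarith

/-- Minimisers of a convex perturbation of a quadratic form are close to the minimiser of the
quadratic form. -/
lemma exists_finset_argmin_close {H Hi : E →L[ℝ] E} (hsymm : ∀ x y, inner ℝ (H x) y = inner ℝ (H y) x)
    (hpos : ∀ t, t ≠ 0 → 0 < inner ℝ (H t) t) (hHi : ∀ u, H (Hi u) = u) (B : ℝ) {ε : ℝ}
    (hε : 0 < ε) :
    ∃ (T : Finset E) (δ : ℝ), 0 < δ ∧ ∀ G : E → ℝ, ConvexOn ℝ Set.univ G →
      (∀ v ∈ T, |G v - inner ℝ (H v) v / 2| ≤ δ) → ∀ U, ‖Hi U‖ ≤ B →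
        ∀ τ, IsMinOn (fun t => G t + inner ℝ U t) Set.univ τ → ‖τ + Hi U‖ < ε := by
  -- The least value of the quadratic form on the sphere of radius ε. The sphere is empty in the
  -- trivial space, where any m works.
  obtain ⟨m, hm, hmQ⟩ : ∃ m : ℝ, 0 < m ∧ ∀ t : E, ‖t‖ = ε → m ≤ inner ℝ (H t) t / 2 := by
    rcases (Metric.sphere (0 : E) ε).eq_empty_or_nonempty with h | h
    · refine ⟨1, one_pos, fun t ht => ?_⟩
      have : t ∈ Metric.sphere (0 : E) ε := by simpa using ht
      rw [h] at this
      exact this.elim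
    · have hc : ContinuousOn (fun t => inner ℝ (H t) t / 2) (Metric.sphere (0 : E) ε) := by
        fun_prop
      obtain ⟨t0, ht0, hmin⟩ := (isCompact_sphere (0 : E) ε).exists_isMinOn h hc
      have ht0' : t0 ≠ 0 := by
        rintro rfl
        simp at ht0
        linarith
      exact ⟨_, half_pos (hpos t0 ht0'), fun t ht => hmin (by simpa using ht)⟩
  -- The ball of radius B + ε contains −Hi U and every point at distance ε from it. Accuracy m/11 on
  -- T gives 5m/11 on the ball, and the two errors 10m/11 stay below the gap m.
  obtain ⟨T, hT⟩ := exists_finset_convex_uniform (Q := fun v => inner ℝ (H v) v / 2)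
    (by fun_prop) (isCompact_closedBall (0 : E) (B + ε)) (ε := m / 11) (by positivity)
  refine ⟨T, m / 11, by positivity, fun G hG hGT U hU τ hτ => ?_⟩
  by_contra hlt
  push Not at hlt
  set c := -Hi U with hc
  have hHc : H c = -U := by rw [hc, map_neg, hHi]
  have hcn : ‖c‖ ≤ B := by rwa [hc, norm_neg]
  have hn : ‖τ - c‖ = ‖τ + Hi U‖ := by rw [hc, sub_neg_eq_add]
  -- If the minimiser τ were farther than ε from c = −Hi U, convexity would put a point s of the
  -- segment, at distance exactly ε from c, at a level no higher than c.
  set a := ε / ‖τ - c‖ with ha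
  have hτc : 0 < ‖τ - c‖ := by rw [hn]; linarith
  have ha0 : 0 < a := by positivity
  have ha1 : a ≤ 1 := by rw [ha, div_le_one hτc, hn]; exact hlt
  set s := c + a • (τ - c) with hs
  have hsc : ‖s - c‖ = ε := by
    rw [hs, add_sub_cancel_left, norm_smul, Real.norm_of_nonneg ha0.le, ha]
    field_simp
  have hG' := hG.2 (Set.mem_univ c) (Set.mem_univ τ) (sub_nonneg.2 ha1) ha0.le (by ring)
  have hs' : (1 - a) • c + a • τ = s := by rw [hs, sub_smul, smul_sub, one_smul]; abel
  rw [hs'] at hG'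
  have hmin : G τ + inner ℝ U τ ≤ G c + inner ℝ U c := hτ (Set.mem_univ c)
  have hUs : inner ℝ U s = (1 - a) * inner ℝ U c + a * inner ℝ U τ := by
    rw [← hs', inner_add_right, inner_smul_right, inner_smul_right]
  simp only [smul_eq_mul] at hG'
  have hle : G s + inner ℝ U s ≤ G c + inner ℝ U c := by
    rw [hUs]
    nlinarith
  have h1 := hT G hG hGT c (by simp; linarith)
  have h2 := hT G hG hGT s (by
    have : ‖s‖ ≤ ‖c‖ + ‖s - c‖ := by
      simpa using norm_add_le c (s - c)
    simp
    linarith)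
  have h3 := hmQ (s - c) hsc
  -- Completing the square: c is the critical point of the quadratic objective, whose excess at s is
  -- the form at s − c.
  have h4 : inner ℝ (H (s - c)) (s - c) / 2
      = inner ℝ (H s) s / 2 + inner ℝ U s - (inner ℝ (H c) c / 2 + inner ℝ U c) := by
    simp only [map_sub, inner_sub_left, inner_sub_right]
    rw [hsymm s c, hHc, inner_neg_left, inner_neg_left]
    ring
  rw [abs_le] at h1 h2
  linarith [h1.1, h1.2, h2.1, h2.2]

end ConvexAnalysis

/-- Scheffé's lemma. -/
lemma tendsto_integral_abs_sub_of_tendsto {α : Type*} [MeasurableSpace α] {μ : Measure α}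
    {f : ℕ → α → ℝ} {g : α → ℝ} (hf : ∀ n, Integrable (f n) μ) (hg : Integrable g μ)
    (hf0 : ∀ n, ∀ᵐ a ∂μ, 0 ≤ f n a)
    (hlim : ∀ᵐ a ∂μ, Tendsto (fun n => f n a) atTop (𝓝 (g a)))
    (hint : Tendsto (fun n => ∫ a, f n a ∂μ) atTop (𝓝 (∫ a, g a ∂μ))) :
    Tendsto (fun n => ∫ a, |f n a - g a| ∂μ) atTop (𝓝 0) := by
  have hg0 : ∀ᵐ a ∂μ, 0 ≤ g a := by
    filter_upwards [hlim, ae_all_iff.2 hf0] with a ha h0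
    exact ge_of_tendsto' ha h0
  -- Since f n ≥ 0, the positive part of g − f n is dominated by g. The rest follows from |f − g| =
  -- (f − g) + 2 (g − f)⁺ and convergence of the integrals.
  have hpos : Tendsto (fun n => ∫ a, max (g a - f n a) 0 ∂μ) atTop (𝓝 0) := by
    have h := tendsto_integral_of_dominated_convergence (μ := μ)
      (F := fun n a => max (g a - f n a) 0) (f := fun _ => (0 : ℝ)) (fun a => |g a|)
      (fun n => ((hg.sub (hf n)).pos_part).aestronglyMeasurable) hg.abs ?_ ?_
    · simpa using h
    · intro n
      filter_upwards [hf0 n, hg0] with a h1 h2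
      rw [Real.norm_of_nonneg (le_max_right _ _), abs_of_nonneg h2]
      exact max_le (by linarith) h2
    · filter_upwards [hlim] with a ha
      have : Tendsto (fun n => max (g a - f n a) 0) atTop (𝓝 (max (g a - g a) 0)) :=
        (tendsto_const_nhds.sub ha).max tendsto_const_nhds
      simpa using this
  have h2 : ∀ n, ∫ a, |f n a - g a| ∂μ
      = (∫ a, f n a ∂μ - ∫ a, g a ∂μ) + 2 * ∫ a, max (g a - f n a) 0 ∂μ := by
    intro n
    have hp : Integrable (fun a => max (g a - f n a) 0) μ := (hg.sub (hf n)).pos_part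
    rw [← integral_sub (hf n) hg, ← integral_const_mul,
      ← integral_add (f := fun a => f n a - g a) ((hf n).sub hg) (hp.const_mul 2)]
    refine integral_congr_ae (Eventually.of_forall fun a => ?_)
    simp only
    rcases le_total (f n a) (g a) with h | h
    · rw [abs_of_nonpos (by linarith), max_eq_left (by linarith)]; ring
    · rw [abs_of_nonneg (by linarith), max_eq_right (by linarith)]; ring
  simp only [h2]
  have := (hint.sub_const (∫ a, g a ∂μ)).add (hpos.const_mul 2)
  simpa using this

/-! ### Gradient of an expected convex loss -/

section RiskDifferentiability

variable {E : Type*} [NormedAddCommGroup E] [InnerProductSpace ℝ E] [FiniteDimensional ℝ E]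
  [CompleteSpace E] {α : Type*} [MeasurableSpace α] {μ : Measure α}

/-- Differentiation under the expectation for convex losses. -/
lemma hasGradientAt_integral_of_convexOn {F : α → E → ℝ} (hconv : ∀ a, ConvexOn ℝ Set.univ (F a))
    (hdiff : ∀ a, Differentiable ℝ (F a)) (hint : ∀ θ, Integrable (fun a => F a θ) μ) (θ : E)
    (hm : AEStronglyMeasurable (fun a => gradient (F a) θ) μ) :
    Integrable (fun a => gradient (F a) θ) μ ∧
      HasGradientAt (fun θ => ∫ a, F a θ ∂μ) (∫ a, gradient (F a) θ ∂μ) θ := by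
  obtain ⟨V, r, hr, -, -, hbd⟩ := exists_finset_convex_bound θ (Filter.univ_mem (f := 𝓝 θ))
  -- A convex function bounded by M on the ball of radius r is Lipschitz with constant 2M/(r/2) on
  -- the ball of radius r/2. Here M is built from values at finitely many points, so it is
  -- integrable.
  set bound : α → ℝ := fun a => 2 * (∑ v ∈ V, |F a v| + 2 * |F a θ|) / (r / 2) with hbound
  have h := hasFDerivAt_integral_of_dominated_loc_of_lip (𝕜 := ℝ) (μ := μ)
    (F := fun θ a => F a θ) (x₀ := θ) (bound := bound) (s := Metric.ball θ (r - r / 2))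
    (F' := fun a => InnerProductSpace.toDual ℝ E (gradient (F a) θ))
    (Metric.ball_mem_nhds _ (by linarith)) (Eventually.of_forall fun x => (hint x).1) (hint θ)
    ((InnerProductSpace.toDual ℝ E).continuous.comp_aestronglyMeasurable hm) ?_ ?_ ?_
  · obtain ⟨h1, h2⟩ := h
    have hI : Integrable (fun a => gradient (F a) θ) μ := by
      exact ((InnerProductSpace.toDual ℝ E).symm.toContinuousLinearEquiv.toContinuousLinearMap
        ).integrable_comp h1 |>.congr (Eventually.of_forall fun a => by simp [gradient])
    refine ⟨hI, ?_⟩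
    rw [hasGradientAt_iff_hasFDerivAt]
    have h3 := ((InnerProductSpace.toDual ℝ E).toContinuousLinearEquiv.toContinuousLinearMap
        ).integral_comp_comm hI
    simp only [ContinuousLinearEquiv.coe_coe, LinearIsometryEquiv.coe_toContinuousLinearEquiv] at h3
    rw [← h3]
    exact h2
  · refine Eventually.of_forall fun a => ?_
    have hB : ∀ v ∈ V, F a v ≤ ∑ v ∈ V, |F a v| := fun v hv =>
      (le_abs_self _).trans (Finset.single_le_sum (f := fun v => |F a v|)
        (fun i _ => abs_nonneg _) hv)
    have hl := ((hconv a).subset (Set.subset_univ (Metric.ball θ r))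
      (convex_ball θ r)).lipschitzOnWith_of_abs_le (ε := r / 2)
      (M := ∑ v ∈ V, |F a v| + 2 * |F a θ|) (by linarith) (fun s hs => by
        have h1 := hbd (F a) (hconv a) _ hB s hs
        rw [abs_le]
        have := neg_abs_le (F a θ)
        have := abs_nonneg (F a θ)
        constructor <;> linarith [h1.1, h1.2])
    have h0 : 0 ≤ bound a := by positivity
    have : Real.nnabs (bound a) = (bound a).toNNReal := by
      ext; simp [h0]
    rw [this]
    exact hl
  · exact (((integrable_finsetSum _ fun v _ => (hint v).abs).add
      ((hint θ).abs.const_mul 2)).const_mul 2).div_const _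
  · exact Eventually.of_forall fun a => ((hdiff a) θ).hasGradientAt.hasFDerivAt

end RiskDifferentiability

/-! ### Second moments of normalised sums -/

section NormalizedSums

variable {Ω S : Type*} [MeasurableSpace Ω] [MeasurableSpace S] {P : Measure Ω}
  [IsProbabilityMeasure P] {X : ℕ → Ω → S}

/-- The normalised sum `n^{-1/2} ∑_{i < n} φ(Xᵢ)`. -/
noncomputable def normSum {E : Type*} [AddCommGroup E] [Module ℝ E] (X : ℕ → Ω → S) (φ : S → E)
    (n : ℕ) (ω : Ω) : E :=
  (√(n : ℝ))⁻¹ • ∑ i ∈ Finset.range n, φ (X i ω)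

omit [IsProbabilityMeasure P] in
lemma memLp_comp_of_identDistrib {E : Type*} [NormedAddCommGroup E]
    (hid : ∀ i, IdentDistrib (X i) (X 0) P P) {φ : S → E} {p : ℝ≥0∞}
    (hφm : StronglyMeasurable φ) (hφ : MemLp (fun ω => φ (X 0 ω)) p P) (i : ℕ) :
    MemLp (fun ω => φ (X i ω)) p P := by
  have hi := (hid i).aemeasurable_fst
  have h0 := (hid i).aemeasurable_snd
  have h1 : MemLp φ p (P.map (X 0)) := (memLp_map_measure_iff hφm.aestronglyMeasurable h0).2 hφ
  rw [← (hid i).map_eq] at h1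
  exact (memLp_map_measure_iff hφm.aestronglyMeasurable hi).1 h1

omit [IsProbabilityMeasure P] in
lemma integral_comp_of_identDistrib {E : Type*} [NormedAddCommGroup E] [NormedSpace ℝ E]
    (hid : ∀ i, IdentDistrib (X i) (X 0) P P) {φ : S → E} (hφm : StronglyMeasurable φ) (i : ℕ) :
    ∫ ω, φ (X i ω) ∂P = ∫ ω, φ (X 0 ω) ∂P := by
  rw [← integral_map (hid i).aemeasurable_fst hφm.aestronglyMeasurable,
    ← integral_map (hid i).aemeasurable_snd hφm.aestronglyMeasurable, (hid i).map_eq]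

omit [IsProbabilityMeasure P] in
lemma memLp_normSum {E : Type*} [NormedAddCommGroup E] [NormedSpace ℝ E]
    (hid : ∀ i, IdentDistrib (X i) (X 0) P P) {φ : S → E} {p : ℝ≥0∞} (hφm : StronglyMeasurable φ)
    (hφ : MemLp (fun ω => φ (X 0 ω)) p P) (n : ℕ) : MemLp (normSum X φ n) p P :=
  (memLp_finsetSum _ fun i _ => memLp_comp_of_identDistrib hid hφm hφ i).const_smul _

omit [IsProbabilityMeasure P] in
lemma integral_normSum {E : Type*} [NormedAddCommGroup E] [NormedSpace ℝ E]
    (hid : ∀ i, IdentDistrib (X i) (X 0) P P) {φ : S → E} (hφm : StronglyMeasurable φ)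
    (hφ : Integrable (fun ω => φ (X 0 ω)) P) (h0 : ∫ ω, φ (X 0 ω) ∂P = 0) (n : ℕ) :
    ∫ ω, normSum X φ n ω ∂P = 0 := by
  simp only [normSum]
  rw [integral_smul, integral_finsetSum]
  · simp [integral_comp_of_identDistrib hid hφm, h0]
  · intro i _
    exact memLp_one_iff_integrable.1
      (memLp_comp_of_identDistrib hid hφm (memLp_one_iff_integrable.2 hφ) i)

/-- Independence kills the off-diagonal terms; the n equal diagonal ones cancel the factor n⁻¹. -/
lemma covariance_normSum (hid : ∀ i, IdentDistrib (X i) (X 0) P P) (hind : iIndepFun X P)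
    {φ ψ : S → ℝ} (hφm : Measurable φ) (hψm : Measurable ψ)
    (hφ : MemLp (fun ω => φ (X 0 ω)) 2 P) (hψ : MemLp (fun ω => ψ (X 0 ω)) 2 P) {n : ℕ}
    (hn : 1 ≤ n) :
    covariance (normSum X φ n) (normSum X ψ n) P
      = covariance (fun ω => φ (X 0 ω)) (fun ω => ψ (X 0 ω)) P := by
  have hn' : (0 : ℝ) < n := by exact_mod_cast hn
  have h1 : covariance (normSum X φ n) (normSum X ψ n) P = (√(n : ℝ))⁻¹ * ((√(n : ℝ))⁻¹ *
      covariance (fun ω => ∑ i ∈ Finset.range n, φ (X i ω))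
        (fun ω => ∑ i ∈ Finset.range n, ψ (X i ω)) P) := by
    rw [← covariance_const_mul_right, ← covariance_const_mul_left]
    rfl
  have hφi := memLp_comp_of_identDistrib hid hφm.stronglyMeasurable hφ
  have hψi := memLp_comp_of_identDistrib hid hψm.stronglyMeasurable hψ
  set c := covariance (fun ω => φ (X 0 ω)) (fun ω => ψ (X 0 ω)) P with hc
  have hval : ∀ i j, covariance (fun ω => φ (X i ω)) (fun ω => ψ (X j ω)) P
      = if i = j then c else 0 := by
    intro i j
    split_ifs with h
    · subst h
      have hi := (hid i).aemeasurable_fst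
      have h0 := (hid i).aemeasurable_snd
      have e1 := covariance_map_fun (μ := P) (X := φ) (Y := ψ) hφm.aestronglyMeasurable
        hψm.aestronglyMeasurable hi
      have e2 := covariance_map_fun (μ := P) (X := φ) (Y := ψ) hφm.aestronglyMeasurable
        hψm.aestronglyMeasurable h0
      rw [hc, ← e1, ← e2, (hid i).map_eq]
    · exact ((hind.indepFun h).comp hφm hψm).covariance_eq_zero (hφi i) (hψi j)
  rw [h1, covariance_fun_sum_fun_sum' (fun i _ => hφi i) (fun i _ => hψi i)]
  simp only [hval]
  rw [Finset.sum_congr rfl (g := fun _ => c)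
    (fun i hi => by rw [Finset.sum_ite_eq]; simp only [hi, if_true])]
  rw [Finset.sum_const, Finset.card_range, nsmul_eq_mul]
  have hs : √(n : ℝ) * √(n : ℝ) = n := Real.mul_self_sqrt hn'.le
  have hs0 : √(n : ℝ) ≠ 0 := (Real.sqrt_pos.2 hn').ne'
  field_simp
  rw [pow_two, hs]

lemma integral_normSum_mul_normSum (hid : ∀ i, IdentDistrib (X i) (X 0) P P)
    (hind : iIndepFun X P) {φ ψ : S → ℝ} (hφm : Measurable φ) (hψm : Measurable ψ)
    (hφ : MemLp (fun ω => φ (X 0 ω)) 2 P) (hψ : MemLp (fun ω => ψ (X 0 ω)) 2 P)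
    (hφ0 : ∫ ω, φ (X 0 ω) ∂P = 0) {n : ℕ} (hn : 1 ≤ n) :
    ∫ ω, normSum X φ n ω * normSum X ψ n ω ∂P
      = covariance (fun ω => φ (X 0 ω)) (fun ω => ψ (X 0 ω)) P := by
  rw [← covariance_normSum hid hind hφm hψm hφ hψ hn,
    covariance_eq_sub (memLp_normSum hid hφm.stronglyMeasurable hφ n)
      (memLp_normSum hid hψm.stronglyMeasurable hψ n),
    integral_normSum hid hφm.stronglyMeasurable (hφ.integrable one_le_two) hφ0]
  simp

end NormalizedSums

/-! ### Tightness of vector-valued normalised sums -/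

section VectorSums

variable {Ω S : Type*} [MeasurableSpace Ω] [MeasurableSpace S] {P : Measure Ω}
  [IsProbabilityMeasure P] {X : ℕ → Ω → S}
  {E : Type*} [NormedAddCommGroup E] [InnerProductSpace ℝ E] [FiniteDimensional ℝ E]

omit [IsProbabilityMeasure P] [InnerProductSpace ℝ E] [FiniteDimensional ℝ E] in
lemma prob_norm_ge_le {f : Ω → E} (hf : MemLp f 2 P) {B : ℝ} (hB : 0 < B) :
    P {ω | B ≤ ‖f ω‖} ≤ ENNReal.ofReal ((∫ ω, ‖f ω‖ ^ 2 ∂P) / B ^ 2) := by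
  have hint : Integrable (fun ω => ‖f ω‖ ^ 2) P := by
    simpa using hf.integrable_norm_pow (by norm_num)
  have h := mul_meas_ge_le_lintegral₀ (μ := P) (f := fun ω => ENNReal.ofReal (‖f ω‖ ^ 2))
    hint.aestronglyMeasurable.aemeasurable.ennreal_ofReal (ENNReal.ofReal (B ^ 2))
  rw [← ofReal_integral_eq_lintegral_ofReal hint (Eventually.of_forall fun ω => by positivity)] at h
  have hset : {ω | B ≤ ‖f ω‖} ⊆ {ω | ENNReal.ofReal (B ^ 2) ≤ ENNReal.ofReal (‖f ω‖ ^ 2)} := by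
    intro ω hω
    exact ENNReal.ofReal_le_ofReal (pow_le_pow_left₀ hB.le hω 2)
  have hB2 : 0 < B ^ 2 := by positivity
  rw [ENNReal.ofReal_div_of_pos hB2, ENNReal.le_div_iff_mul_le
    (Or.inl (by simpa using hB.ne')) (Or.inl ENNReal.ofReal_ne_top), mul_comm]
  exact (mul_le_mul_right (measure_mono hset) _).trans h

/-- Parseval in an orthonormal basis reduces this to the scalar covariance identity, coordinate by
coordinate. -/
lemma integral_norm_normSum_sq (hid : ∀ i, IdentDistrib (X i) (X 0) P P) (hind : iIndepFun X P)
    {φ : S → E} (hφm : StronglyMeasurable φ) (hφ : MemLp (fun ω => φ (X 0 ω)) 2 P)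
    (hφ0 : ∫ ω, φ (X 0 ω) ∂P = 0) {n : ℕ} (hn : 1 ≤ n) :
    ∫ ω, ‖normSum X φ n ω‖ ^ 2 ∂P = ∫ ω, ‖φ (X 0 ω)‖ ^ 2 ∂P := by
  have : CompleteSpace E := FiniteDimensional.complete ℝ E
  set b := stdOrthonormalBasis ℝ E
  have hcoord : ∀ j ω, inner ℝ (b j) (normSum X φ n ω)
      = normSum X (fun x => inner ℝ (b j) (φ x)) n ω := by
    intro j ω
    simp only [normSum, inner_smul_right, inner_sum, smul_eq_mul]
  have hm : ∀ j, Measurable fun x => inner ℝ (b j) (φ x) := fun j =>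
    (stronglyMeasurable_const.inner hφm).measurable
  have hL : ∀ j, MemLp (fun ω => inner ℝ (b j) (φ (X 0 ω))) 2 P := fun j => hφ.const_inner _
  have h0 : ∀ j, ∫ ω, inner ℝ (b j) (φ (X 0 ω)) ∂P = 0 := fun j => by
    rw [integral_inner (hφ.integrable one_le_two), hφ0, inner_zero_right]
  have hsq : ∀ (y : E), ‖y‖ ^ 2 = ∑ j, inner ℝ (b j) y * inner ℝ (b j) y := by
    intro y
    rw [← b.sum_sq_norm_inner_right y]
    simp [pow_two]
  simp only [hsq]
  rw [integral_finsetSum, integral_finsetSum]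
  · refine Finset.sum_congr rfl fun j _ => ?_
    simp only [hcoord]
    rw [integral_normSum_mul_normSum hid hind (hm j) (hm j) (hL j) (hL j) (h0 j) hn,
      covariance_eq_sub (hL j) (hL j), h0 j]
    simp
  · exact fun j _ => (hL j).integrable_mul (hL j)
  · intro j _
    have := memLp_normSum hid (hm j).stronglyMeasurable (hL j) n
    simp only [hcoord]
    exact this.integrable_mul this

/-- Normalised sums of centred square integrable variables are bounded in probability. -/
lemma exists_prob_normSum_le (hid : ∀ i, IdentDistrib (X i) (X 0) P P) (hind : iIndepFun X P)
    {φ : S → E} (hφm : StronglyMeasurable φ) (hφ : MemLp (fun ω => φ (X 0 ω)) 2 P)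
    (hφ0 : ∫ ω, φ (X 0 ω) ∂P = 0) {η : ℝ} (hη : 0 < η) :
    ∃ B : ℝ, 0 < B ∧ ∀ n, 1 ≤ n → P {ω | B ≤ ‖normSum X φ n ω‖} ≤ ENNReal.ofReal η := by
  set C := ∫ ω, ‖φ (X 0 ω)‖ ^ 2 ∂P with hC
  have hC0 : 0 ≤ C := integral_nonneg fun ω => by positivity
  -- Chebyshev gives C/B² = ηC/(C + 1) ≤ η; the added 1 keeps B positive when C = 0.
  refine ⟨√((C + 1) / η), Real.sqrt_pos.2 (by positivity), fun n hn => ?_⟩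
  refine (prob_norm_ge_le (memLp_normSum hid hφm hφ n) (Real.sqrt_pos.2 (by positivity))).trans ?_
  rw [integral_norm_normSum_sq hid hind hφm hφ hφ0 hn, Real.sq_sqrt (by positivity)]
  refine ENNReal.ofReal_le_ofReal ?_
  rw [div_div_eq_mul_div, div_le_iff₀ (by positivity)]
  nlinarith

end VectorSums

/-! ### First order remainders of convex losses -/

section MEstimation

variable {Ω S : Type*} [MeasurableSpace Ω] [MeasurableSpace S] {P : Measure Ω}
  {X : ℕ → Ω → S}
  {E : Type*} [NormedAddCommGroup E] [InnerProductSpace ℝ E] [FiniteDimensional ℝ E]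
  [CompleteSpace E] [MeasurableSpace E] [BorelSpace E]

omit [FiniteDimensional ℝ E] [MeasurableSpace E] [BorelSpace E] in
lemma hasDerivAt_ray {f : E → ℝ} (hf : Differentiable ℝ f) (θ h : E) :
    HasDerivAt (fun s : ℝ => f (θ + s • h)) (inner ℝ (gradient f θ) h) 0 := by
  have hl : HasDerivAt (fun s : ℝ => θ + s • h) h 0 := by
    simpa using ((hasDerivAt_id (0 : ℝ)).smul_const h).const_add θ
  have hF : HasFDerivAt f (InnerProductSpace.toDual ℝ E (gradient f θ)) (θ + (0 : ℝ) • h) := by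
    simpa using (hf θ).hasGradientAt.hasFDerivAt
  exact (hF.comp_hasDerivAt (0 : ℝ) hl).congr_deriv (by simp)

/-- Directional derivatives are limits of difference quotients along 1/(n + 1), hence measurable,
and they are the coordinates of the gradient. -/
lemma measurable_gradient_section {Ψ : S → E → ℝ} (hm : Measurable (Function.uncurry Ψ))
    (hdiff : ∀ x, Differentiable ℝ (Ψ x)) (θ : E) : Measurable fun x => gradient (Ψ x) θ := by
  have hdir : ∀ v : E, Measurable fun x => inner ℝ (gradient (Ψ x) θ) v := by
    intro v
    refine measurable_of_tendsto_metrizable (f := fun (n : ℕ) x =>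
      ((n : ℝ) + 1) * (Ψ x (θ + ((n : ℝ) + 1)⁻¹ • v) - Ψ x θ)) (fun n => ?_) ?_
    · have h1 : ∀ y : E, Measurable fun x => Ψ x y := fun y =>
        hm.comp (measurable_id.prodMk measurable_const)
      exact ((h1 _).sub (h1 _)).const_mul _
    · rw [tendsto_pi_nhds]
      intro x
      have h2 := (hasDerivAt_ray (hdiff x) θ v).tendsto_slope_zero_right
      have h3 : Tendsto (fun n : ℕ => ((n : ℝ) + 1)⁻¹) atTop (𝓝[>] 0) := by
        refine tendsto_nhdsWithin_iff.2 ⟨by simpa using tendsto_one_div_add_atTop_nhds_zero_nat (𝕜 := ℝ),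
          Eventually.of_forall fun n => ?_⟩
        show (0 : ℝ) < _
        positivity
      refine (h2.comp h3).congr fun n => ?_
      simp
  have hsum : (fun x => gradient (Ψ x) θ) = fun x => ∑ i, inner ℝ (gradient (Ψ x) θ)
      (stdOrthonormalBasis ℝ E i) • (stdOrthonormalBasis ℝ E i) := by
    ext1 x
    conv_lhs => rw [← (stdOrthonormalBasis ℝ E).sum_repr' (gradient (Ψ x) θ)]
    exact Finset.sum_congr rfl fun i _ => by rw [real_inner_comm]
  rw [hsum]
  exact Finset.measurable_sum _ fun i _ => (hdir _).smul_const _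

/-- The remainder of the first order expansion of `f` at `θ`. -/
noncomputable def linRemainder (f : E → ℝ) (θ h : E) : ℝ :=
  f (θ + h) - f θ - inner ℝ (gradient f θ) h

-- The ray expansion at s = n^{-1/2}, where 1/s² = n.
omit [FiniteDimensional ℝ E] [MeasurableSpace E] [BorelSpace E] in
lemma tendsto_linRemainder {f : E → ℝ} (hf : Differentiable ℝ f) {A : E →L[ℝ] E} {θ : E}
    (hA : HasFDerivAt (gradient f) A θ) (t : E) :
    Tendsto (fun n : ℕ => (n : ℝ) * linRemainder f θ ((√(n : ℝ))⁻¹ • t)) atTop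
      (𝓝 (inner ℝ (A t) t / 2)) := by
  have h := tendsto_second_order_ray (fun y => (hf y).hasGradientAt) hA t
  have h3 : Tendsto (fun n : ℕ => (√(n : ℝ))⁻¹) atTop (𝓝[>] 0) := by
    refine tendsto_nhdsWithin_iff.2 ⟨?_, ?_⟩
    · exact tendsto_inv_atTop_zero.comp (Real.tendsto_sqrt_atTop.comp tendsto_natCast_atTop_atTop)
    · filter_upwards [eventually_ge_atTop 1] with n hn
      have : (0 : ℝ) < n := by exact_mod_cast hn
      exact inv_pos.2 (Real.sqrt_pos.2 this)
  refine (h.comp h3).congr fun n => ?_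
  simp only [Function.comp, linRemainder, inner_smul_right, inv_pow, Real.sq_sqrt n.cast_nonneg]
  rw [div_inv_eq_mul, mul_comm]

-- A convex function lies above its tangent: its slopes over (0, 1) are at most the slope over the
-- full step h.
omit [FiniteDimensional ℝ E] [MeasurableSpace E] [BorelSpace E] in
lemma linRemainder_nonneg {f : E → ℝ} (hf : Differentiable ℝ f) (hc : ConvexOn ℝ Set.univ f)
    (θ h : E) : 0 ≤ linRemainder f θ h := by
  have hlim := (hasDerivAt_ray hf θ h).tendsto_slope_zero_right
  refine sub_nonneg.2 (le_of_tendsto hlim ?_)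
  filter_upwards [Ioo_mem_nhdsGT (zero_lt_one (α := ℝ))] with s hs
  have h1 := hc.2 (Set.mem_univ θ) (Set.mem_univ (θ + h)) (sub_nonneg.2 hs.2.le) hs.1.le (by ring)
  have h2 : (1 - s) • θ + s • (θ + h) = θ + s • h := by
    rw [sub_smul, smul_add, one_smul]; abel
  rw [h2] at h1
  simp only [smul_eq_mul] at h1
  simp only [zero_add, zero_smul, add_zero, smul_eq_mul]
  rw [inv_mul_le_iff₀ hs.1]
  linarith

omit [FiniteDimensional ℝ E] [MeasurableSpace E] [BorelSpace E] in
lemma convexOn_linRemainder {f : E → ℝ} (hc : ConvexOn ℝ Set.univ f) (θ : E) (c : ℝ) :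
    ConvexOn ℝ Set.univ fun t => linRemainder f θ (c • t) := by
  refine ⟨convex_univ, fun x _ y _ a b ha hb hab => ?_⟩
  have h1 := hc.2 (Set.mem_univ (θ + c • x)) (Set.mem_univ (θ + c • y)) ha hb hab
  have h2 : a • (θ + c • x) + b • (θ + c • y) = θ + c • (a • x + b • y) := by
    rw [smul_add, smul_add, smul_add, smul_comm c a, smul_comm c b,
      add_add_add_comm, ← add_smul, hab, one_smul]
  rw [h2] at h1
  simp only [linRemainder, smul_eq_mul, inner_smul_right, inner_add_right] at h1 ⊢
  have h3 : f θ = a * f θ + b * f θ := by rw [← add_mul, hab, one_mul]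
  linarith

end MEstimation

/-! ### Asymptotic linearity of convex M-estimators -/

section MEstimationLimit

variable {Ω S : Type*} [MeasurableSpace Ω] [MeasurableSpace S] {P : Measure Ω}
  [IsProbabilityMeasure P] {X : ℕ → Ω → S}
  {E : Type*} [NormedAddCommGroup E] [InnerProductSpace ℝ E] [FiniteDimensional ℝ E]
  [CompleteSpace E] [MeasurableSpace E] [BorelSpace E]

omit [IsProbabilityMeasure P] in
/-- Averages of i.i.d. variables whose laws converge in `L¹` obey the law of large numbers. -/
lemma tendstoInMeasure_average_of_tendsto_L1 (hid : ∀ i, IdentDistrib (X i) (X 0) P P)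
    (hind : iIndepFun X P) {f : ℕ → S → ℝ} {g : S → ℝ} (hfm : ∀ n, Measurable (f n))
    (hgm : Measurable g) (hf : ∀ n, Integrable (fun ω => f n (X 0 ω)) P)
    (hg : Integrable (fun ω => g (X 0 ω)) P)
    (hlim : Tendsto (fun n => ∫ ω, |f n (X 0 ω) - g (X 0 ω)| ∂P) atTop (𝓝 0)) :
    TendstoInMeasure P (fun (n : ℕ) ω => (n : ℝ)⁻¹ * ∑ i ∈ Finset.range n, f n (X i ω)) atTop
      (fun _ => ∫ ω, g (X 0 ω) ∂P) := by
  have hgi : ∀ i, MemLp (fun ω => g (X i ω)) 1 P :=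
    memLp_comp_of_identDistrib hid hgm.stronglyMeasurable (memLp_one_iff_integrable.2 hg)
  have hfi : ∀ n i, MemLp (fun ω => f n (X i ω)) 1 P := fun n =>
    memLp_comp_of_identDistrib hid (hfm n).stronglyMeasurable (memLp_one_iff_integrable.2 (hf n))
  -- The functions change with n, so no single law of large numbers applies; the average of f n − g
  -- has L¹ norm at most that of one term, and the strong law in L¹ is used for the fixed g alone.
  have hA : Tendsto (fun n : ℕ => eLpNorm (fun ω => (n : ℝ)⁻¹ *
      ∑ i ∈ Finset.range n, (f n (X i ω) - g (X i ω))) 1 P) atTop (𝓝 0) := by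
    have hle : ∀ n : ℕ, eLpNorm (fun ω => (n : ℝ)⁻¹ *
        ∑ i ∈ Finset.range n, (f n (X i ω) - g (X i ω))) 1 P
          ≤ ENNReal.ofReal (∫ ω, |f n (X 0 ω) - g (X 0 ω)| ∂P) := by
      intro n
      have hI : ∀ i, Integrable (fun ω => f n (X i ω) - g (X i ω)) P := fun i =>
        memLp_one_iff_integrable.1 ((hfi n i).sub (hgi i))
      rw [eLpNorm_one_eq_lintegral_enorm, ← ofReal_integral_norm_eq_lintegral_enorm
        ((integrable_finsetSum _ fun i _ => hI i).const_mul _)]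
      refine ENNReal.ofReal_le_ofReal ?_
      calc ∫ ω, ‖(n : ℝ)⁻¹ * ∑ i ∈ Finset.range n, (f n (X i ω) - g (X i ω))‖ ∂P
          ≤ ∫ ω, (n : ℝ)⁻¹ * ∑ i ∈ Finset.range n, |f n (X i ω) - g (X i ω)| ∂P := by
            refine integral_mono_of_nonneg (Eventually.of_forall fun ω => norm_nonneg _)
              ((integrable_finsetSum _ fun i _ => (hI i).abs).const_mul _)
              (Eventually.of_forall fun ω => ?_)
            simp only [norm_mul, norm_inv, Real.norm_natCast]
            exact mul_le_mul_of_nonneg_left (norm_sum_le _ _) (by positivity)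
        _ = (n : ℝ)⁻¹ * (n * ∫ ω, |f n (X 0 ω) - g (X 0 ω)| ∂P) := by
            rw [integral_const_mul, integral_finsetSum _ fun i _ => (hI i).abs]
            rw [Finset.sum_congr rfl fun i _ => integral_comp_of_identDistrib hid
              (φ := fun x => |f n x - g x|) (((hfm n).sub hgm).abs.stronglyMeasurable) i]
            simp
        _ ≤ ∫ ω, |f n (X 0 ω) - g (X 0 ω)| ∂P := by
            rw [← mul_assoc]
            refine mul_le_of_le_one_left (integral_nonneg fun ω => abs_nonneg _) ?_
            rcases eq_or_ne (n : ℝ) 0 with h | h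
            · simp [h]
            · rw [inv_mul_cancel₀ h]
    refine tendsto_of_tendsto_of_tendsto_of_le_of_le tendsto_const_nhds ?_ (fun _ => zero_le) hle
    simpa using ENNReal.tendsto_ofReal hlim
  have hB := strong_law_Lp (le_refl 1) ENNReal.one_ne_top (fun i ω => g (X i ω)) (hgi 0)
    (fun i j hij => (hind.indepFun hij).comp hgm hgm) (fun i => (hid i).comp hgm)
  refine tendstoInMeasure_of_tendsto_eLpNorm one_ne_zero (fun n => ?_)
    aestronglyMeasurable_const ?_
  · exact ((memLp_finsetSum _ fun i _ => hfi n i).const_mul _).1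
  · refine tendsto_of_tendsto_of_tendsto_of_le_of_le tendsto_const_nhds
      (by have h := hA.add hB; rwa [add_zero] at h) (fun _ => zero_le) fun n => ?_
    have hA1 : AEStronglyMeasurable (fun ω => (n : ℝ)⁻¹ *
        ∑ i ∈ Finset.range n, (f n (X i ω) - g (X i ω))) P :=
      ((memLp_finsetSum _ fun i _ => (hfi n i).sub (hgi i)).const_mul _).1
    have hB1 : AEStronglyMeasurable (fun ω => (n : ℝ)⁻¹ • ∑ i ∈ Finset.range n, g (X i ω)
        - ∫ ω, g (X 0 ω) ∂P) P := by
      have h1 := ((memLp_finsetSum (Finset.range n) fun i _ => hgi i).const_smul (n : ℝ)⁻¹).1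
      exact h1.sub aestronglyMeasurable_const
    refine le_trans (le_of_eq ?_) (eLpNorm_add_le hA1 hB1 le_rfl)
    congr 1
    ext ω
    simp only [Pi.sub_apply, Pi.add_apply, Finset.sum_sub_distrib, smul_eq_mul]
    ring

variable {Ψ : S → E → ℝ} {θ : E} {H Hi : E →L[ℝ] E}

omit [IsProbabilityMeasure P] in
/-- The recentred and rescaled empirical objective converges pointwise, in probability, to the
quadratic form of the Hessian. -/
lemma tendstoInMeasure_sum_linRemainder (hid : ∀ i, IdentDistrib (X i) (X 0) P P)
    (hind : iIndepFun X P) (hΨm : Measurable (Function.uncurry Ψ))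
    (hΨconv : ∀ x, ConvexOn ℝ Set.univ (Ψ x)) (hΨdiff : ∀ x, Differentiable ℝ (Ψ x))
    (hΨdiff2 : ∀ x, Differentiable ℝ (gradient (Ψ x)))
    (hΨint : ∀ θ, Integrable (fun ω => Ψ (X 0 ω) θ) P)
    (hHint : Integrable (fun ω => fderiv ℝ (gradient (Ψ (X 0 ω))) θ) P)
    (hHeq : ∫ ω, fderiv ℝ (gradient (Ψ (X 0 ω))) θ ∂P = H)
    (hH : HasFDerivAt (gradient fun θ => ∫ ω, Ψ (X 0 ω) θ ∂P) H θ)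
    (hX0 : AEMeasurable (X 0) P) (t : E) :
    TendstoInMeasure P (fun (n : ℕ) ω => ∑ i ∈ Finset.range n,
      linRemainder (Ψ (X i ω)) θ ((√(n : ℝ))⁻¹ • t)) atTop (fun _ => inner ℝ (H t) t / 2) := by
  have hgm : ∀ θ, Measurable fun x => gradient (Ψ x) θ := measurable_gradient_section hΨm hΨdiff
  have hM : ∀ θ, Integrable (fun ω => gradient (Ψ (X 0 ω)) θ) P ∧
      HasGradientAt (fun θ => ∫ ω, Ψ (X 0 ω) θ ∂P) (∫ ω, gradient (Ψ (X 0 ω)) θ ∂P) θ := fun θ =>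
    hasGradientAt_integral_of_convexOn (fun ω => hΨconv (X 0 ω)) (fun ω => hΨdiff (X 0 ω)) hΨint θ
      ((hgm θ).comp_aemeasurable hX0).aestronglyMeasurable
  have hMd : Differentiable ℝ fun θ => ∫ ω, Ψ (X 0 ω) θ ∂P := fun θ =>
    (hM θ).2.differentiableAt
  -- The factor n turns the sum of remainders into an average of i.i.d. terms.
  set f : ℕ → S → ℝ := fun n x => n * linRemainder (Ψ x) θ ((√(n : ℝ))⁻¹ • t) with hf
  set g : S → ℝ := fun x => inner ℝ (fderiv ℝ (gradient (Ψ x)) θ t) t / 2 with hg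
  have hΨθ : ∀ y : E, Measurable fun x => Ψ x y := fun y =>
    hΨm.comp (measurable_id.prodMk measurable_const)
  have hfm : ∀ n, Measurable (f n) := fun n =>
    (((hΨθ _).sub (hΨθ _)).sub ((hgm θ).inner measurable_const)).const_mul _
  have hlim : ∀ x, Tendsto (fun n => f n x) atTop (𝓝 (g x)) := fun x =>
    tendsto_linRemainder (hΨdiff x) ((hΨdiff2 x) θ).hasFDerivAt t
  have hgmeas : Measurable g := measurable_of_tendsto_metrizable hfm (tendsto_pi_nhds.2 hlim)
  have hfI : ∀ n, Integrable (fun ω => f n (X 0 ω)) P := fun n =>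
    (((hΨint _).sub (hΨint _)).sub ((hM θ).1.inner_const _)).const_mul _
  have hHt : Integrable (fun ω => fderiv ℝ (gradient (Ψ (X 0 ω))) θ t) P :=
    (ContinuousLinearMap.apply ℝ E t).integrable_comp hHint
  have hgI : Integrable (fun ω => g (X 0 ω)) P := (hHt.inner_const t).div_const 2
  have hgint : ∫ ω, g (X 0 ω) ∂P = inner ℝ (H t) t / 2 := by
    simp only [hg]
    rw [integral_div, ← hHeq]
    congr 1
    have h1 := (ContinuousLinearMap.apply ℝ E t).integral_comp_comm hHint
    simp only [ContinuousLinearMap.apply_apply] at h1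
    rw [← h1, real_inner_comm, ← integral_inner hHt]
    exact integral_congr_ae (Eventually.of_forall fun ω => real_inner_comm _ _)
  have hfint : ∀ n, ∫ ω, f n (X 0 ω) ∂P
      = n * linRemainder (fun θ => ∫ ω, Ψ (X 0 ω) θ ∂P) θ ((√(n : ℝ))⁻¹ • t) := by
    intro n
    simp only [hf, linRemainder]
    rw [integral_const_mul, integral_sub
      (f := fun ω => Ψ (X 0 ω) (θ + (√(n : ℝ))⁻¹ • t) - Ψ (X 0 ω) θ)
      ((hΨint _).sub (hΨint _)) ((hM θ).1.inner_const _),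
      integral_sub (hΨint _) (hΨint _), (hM θ).2.gradient]
    congr 2
    rw [real_inner_comm, ← integral_inner (hM θ).1]
    exact integral_congr_ae (Eventually.of_forall fun ω => real_inner_comm _ _)
  -- Scheffé applies because the remainders are nonnegative and the limit of their means, the form
  -- of the Hessian of the risk, equals the mean of their pointwise limits, the form of the expected
  -- Hessian.
  have hL1 := tendsto_integral_abs_sub_of_tendsto hfI hgI
    (fun n => Eventually.of_forall fun ω => mul_nonneg n.cast_nonneg
      (linRemainder_nonneg (hΨdiff _) (hΨconv _) _ _))
    (Eventually.of_forall fun ω => hlim (X 0 ω)) (by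
      simp only [hfint, hgint]
      exact tendsto_linRemainder hMd hH t)
  have h := tendstoInMeasure_average_of_tendsto_L1 hid hind hfm hgmeas hfI hgI hL1
  rw [hgint] at h
  refine h.congr' ?_ (ae_eq_refl _)
  filter_upwards [eventually_ge_atTop 1] with n hn
  refine Eventually.of_forall fun ω => ?_
  have hn' : (n : ℝ) ≠ 0 := by
    have : n ≠ 0 := by omega
    exact_mod_cast this
  simp only [hf]
  rw [← Finset.mul_sum, ← mul_assoc, inv_mul_cancel₀ hn', one_mul]

/-- Asymptotic linearity of convex M-estimators. -/
theorem tendstoInMeasure_mEstimator (hid : ∀ i, IdentDistrib (X i) (X 0) P P)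
    (hind : iIndepFun X P) (hΨm : Measurable (Function.uncurry Ψ))
    (hΨconv : ∀ x, ConvexOn ℝ Set.univ (Ψ x)) (hΨdiff : ∀ x, Differentiable ℝ (Ψ x))
    (hΨdiff2 : ∀ x, Differentiable ℝ (gradient (Ψ x)))
    (hΨint : ∀ θ, Integrable (fun ω => Ψ (X 0 ω) θ) P)
    {θhat : (l : ℕ) → (Fin l → S) → E} (hθhat : IsMEstimator P X Ψ θhat)
    (hθ : IsMinOn (fun θ => ∫ ω, Ψ (X 0 ω) θ ∂P) Set.univ θ)
    (hscore : MemLp (fun ω => gradient (Ψ (X 0 ω)) θ) 2 P)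
    (hHint : Integrable (fun ω => fderiv ℝ (gradient (Ψ (X 0 ω))) θ) P)
    (hHeq : ∫ ω, fderiv ℝ (gradient (Ψ (X 0 ω))) θ ∂P = H)
    (hH : HasFDerivAt (gradient fun θ => ∫ ω, Ψ (X 0 ω) θ ∂P) H θ)
    (hHi : ∀ u, H (Hi u) = u) (hHi' : ∀ u, Hi (H u) = u) (hX0 : AEMeasurable (X 0) P) :
    gradient (fun θ => ∫ ω, Ψ (X 0 ω) θ ∂P) θ = 0 ∧
    ∫ ω, gradient (Ψ (X 0 ω)) θ ∂P = 0 ∧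
    TendstoInMeasure P (fun (l : ℕ) ω => √(l : ℝ) • ((θhat l fun i => X i ω) - θ)
      + Hi (normSum X (fun x => gradient (Ψ x) θ) l ω)) atTop (fun _ => 0) := by
  have hgm : ∀ θ, Measurable fun x => gradient (Ψ x) θ := measurable_gradient_section hΨm hΨdiff
  have hM : ∀ θ, Integrable (fun ω => gradient (Ψ (X 0 ω)) θ) P ∧
      HasGradientAt (fun θ => ∫ ω, Ψ (X 0 ω) θ ∂P) (∫ ω, gradient (Ψ (X 0 ω)) θ ∂P) θ := fun θ =>
    hasGradientAt_integral_of_convexOn (fun ω => hΨconv (X 0 ω)) (fun ω => hΨdiff (X 0 ω)) hΨint θ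
      ((hgm θ).comp_aemeasurable hX0).aestronglyMeasurable
  have hMd : ∀ θ, HasGradientAt (fun θ => ∫ ω, Ψ (X 0 ω) θ ∂P)
      (gradient (fun θ => ∫ ω, Ψ (X 0 ω) θ ∂P) θ) θ := fun θ =>
    (hM θ).2.differentiableAt.hasGradientAt
  have hgrad0 : gradient (fun θ => ∫ ω, Ψ (X 0 ω) θ ∂P) θ = 0 := by
    have h2 := (hθ.isLocalMin Filter.univ_mem).hasFDerivAt_eq_zero (hMd θ).hasFDerivAt
    exact (map_eq_zero_iff _ (InnerProductSpace.toDual ℝ E).injective).1 h2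
  have hE0 : ∫ ω, gradient (Ψ (X 0 ω)) θ ∂P = 0 := by rw [← (hM θ).2.gradient, hgrad0]
  refine ⟨hgrad0, hE0, ?_⟩
  have hsymm := inner_hessian_symm hMd hH
  have hinj : Function.Injective H := Function.LeftInverse.injective hHi'
  have hpos := fun t (ht : t ≠ 0) => inner_hessian_pos hMd hH hθ hinj ht
  set U := normSum X (fun x => gradient (Ψ x) θ) with hU
  rw [tendstoInMeasure_iff_norm]
  intro ε hε
  simp only [sub_zero]
  rw [ENNReal.tendsto_nhds_zero]
  intro η hη
  obtain ⟨η', hη', hη'η⟩ : ∃ η' : ℝ, 0 < η' ∧ ENNReal.ofReal η' ≤ η / 2 := by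
    rcases eq_or_ne η ⊤ with h | h
    · exact ⟨1, one_pos, by simp [h, ENNReal.top_div_of_ne_top]⟩
    · refine ⟨(η / 2).toReal, ENNReal.toReal_pos (by simpa using hη.ne') ?_, ENNReal.ofReal_toReal_le⟩
      exact ENNReal.div_ne_top h (by norm_num)
  -- The score sum is random, so closeness of minimisers is needed uniformly over ‖U‖ < B; B is
  -- fixed first, then the finite set T and the tolerance δ.
  obtain ⟨B, hB0, hB⟩ := exists_prob_normSum_le hid hind (hgm θ).stronglyMeasurable hscore hE0 hη'
  obtain ⟨T, δ, hδ, hT⟩ := exists_finset_argmin_close hsymm hpos hHi (‖Hi‖ * B) hε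
  have hsum : Tendsto (fun n : ℕ => ∑ v ∈ T, P {ω | δ ≤ ‖∑ i ∈ Finset.range n,
      linRemainder (Ψ (X i ω)) θ ((√(n : ℝ))⁻¹ • v) - inner ℝ (H v) v / 2‖}) atTop (𝓝 0) := by
    have := tendsto_finsetSum T fun v _ => tendstoInMeasure_iff_norm.1
      (tendstoInMeasure_sum_linRemainder hid hind hΨm hΨconv hΨdiff hΨdiff2 hΨint hHint hHeq hH
        hX0 v) δ hδ
    simpa using this
  have hη2 : 0 < η / 2 := ENNReal.half_pos hη.ne'
  filter_upwards [eventually_ge_atTop 1, (ENNReal.tendsto_nhds_zero.1 hsum) _ hη2] with n hn hsn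
  have hn0 : (0 : ℝ) < n := by exact_mod_cast hn
  have hs0 : 0 < √(n : ℝ) := Real.sqrt_pos.2 hn0
  have hsub : ∀ᵐ ω ∂P, ω ∈ {ω | ε ≤ ‖√(n : ℝ) • ((θhat n fun i => X i ω) - θ) + Hi (U n ω)‖} →
      ω ∈ {ω | B ≤ ‖U n ω‖} ∪ ⋃ v ∈ T, {ω | δ ≤ ‖∑ i ∈ Finset.range n,
      linRemainder (Ψ (X i ω)) θ ((√(n : ℝ))⁻¹ • v) - inner ℝ (H v) v / 2‖} := by
    filter_upwards [hθhat n hn] with ω hω hε'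
    by_contra hcon
    simp only [Set.mem_union, Set.mem_iUnion, not_or, not_exists, Set.mem_ofPred_eq, not_le] at hcon
    obtain ⟨hUB, hv⟩ := hcon
    refine absurd hε' (not_le.2 ?_)
    refine hT (fun t => ∑ i ∈ Finset.range n, linRemainder (Ψ (X i ω)) θ ((√(n : ℝ))⁻¹ • t)) ?_
      (fun v hvT => (hv v hvT).le) (U n ω) ?_ _ ?_
    · have := fun s : Finset ℕ => Finset.sum_induction
        (fun i t => linRemainder (Ψ (X i ω)) θ ((√(n : ℝ))⁻¹ • t))
        (fun f : E → ℝ => ConvexOn ℝ Set.univ f) (s := s) (fun _ _ => ConvexOn.add)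
        (convexOn_const 0 convex_univ) (fun i _ => convexOn_linRemainder (hΨconv _) θ _)
      convert! this (Finset.range n) using 1
      ext t
      simp
    · exact (Hi.le_opNorm _).trans (mul_le_mul_of_nonneg_left hUB.le (norm_nonneg _))
    -- Adding back the linear term gives, up to a constant, the empirical sum at θ + t/√n, so its
    -- minimiser in t is √n (θ̂ − θ).
    · have hA : ∀ t, ∑ i ∈ Finset.range n, linRemainder (Ψ (X i ω)) θ ((√(n : ℝ))⁻¹ • t)
          + inner ℝ (U n ω) t = ∑ i ∈ Finset.range n, Ψ (X i ω) (θ + (√(n : ℝ))⁻¹ • t)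
            - ∑ i ∈ Finset.range n, Ψ (X i ω) θ := by
        intro t
        simp only [hU, normSum, linRemainder, inner_smul_left, sum_inner, inner_smul_right,
          Finset.sum_sub_distrib, ← Finset.mul_sum]
        simp
      intro t _
      simp only [Set.mem_ofPred_eq, hA]
      have hmin : (n : ℝ)⁻¹ * ∑ i : Fin n, Ψ (X i ω) (θhat n fun i => X i ω)
          ≤ (n : ℝ)⁻¹ * ∑ i : Fin n, Ψ (X i ω) (θ + (√(n : ℝ))⁻¹ • t) := hω (Set.mem_univ _)
      rw [mul_le_mul_iff_right₀ (inv_pos.2 hn0),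
        ← Finset.sum_range fun i => Ψ (X i ω) (θhat n fun i => X i ω),
        ← Finset.sum_range fun i => Ψ (X i ω) (θ + (√(n : ℝ))⁻¹ • t)] at hmin
      rw [smul_smul, inv_mul_cancel₀ hs0.ne', one_smul, add_sub_cancel]
      linarith
  calc P {ω | ε ≤ ‖√(n : ℝ) • ((θhat n fun i => X i ω) - θ) + Hi (U n ω)‖}
      ≤ P ({ω | B ≤ ‖U n ω‖} ∪ ⋃ v ∈ T, {ω | δ ≤ ‖∑ i ∈ Finset.range n,
      linRemainder (Ψ (X i ω)) θ ((√(n : ℝ))⁻¹ • v) - inner ℝ (H v) v / 2‖}) :=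
        measure_mono_ae hsub
    _ ≤ η / 2 + η / 2 := (measure_union_le _ _).trans (add_le_add ((hB n hn).trans hη'η)
        ((measure_biUnion_finset_le _ _).trans hsn))
    _ = η := ENNReal.add_halves η

end MEstimationLimit

/-! ### Conditioning and covariance -/

section IndependentConditioning

variable {Ω A B : Type*} {mΩ : MeasurableSpace Ω} [MeasurableSpace A] [MeasurableSpace B]
  {P : Measure Ω} [IsProbabilityMeasure P]

/-- Conditioning a function of two independent variables on the first one amounts to integrating
out the second one. -/
lemma condExp_comap_of_indepFun {U : Ω → A} {V : Ω → B} (hU : Measurable U) (hV : Measurable V)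
    (hUV : IndepFun U V P) {f : A × B → ℝ} (hf : Measurable f)
    (hint : Integrable (fun ω => f (U ω, V ω)) P) :
    P[fun ω => f (U ω, V ω) | MeasurableSpace.comap U inferInstance]
      =ᵐ[P] fun ω => ∫ v, f (U ω, v) ∂(P.map V) := by
  have : IsProbabilityMeasure (P.map U) := Measure.isProbabilityMeasure_map hU.aemeasurable
  have : IsProbabilityMeasure (P.map V) := Measure.isProbabilityMeasure_map hV.aemeasurable
  have hlaw : P.map (fun ω => (U ω, V ω)) = (P.map U).prod (P.map V) :=
    (indepFun_iff_map_prod_eq_prod_map_map hU.aemeasurable hV.aemeasurable).1 hUV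
  have hUVm : Measurable fun ω => (U ω, V ω) := hU.prodMk hV
  have hf' : Integrable f ((P.map U).prod (P.map V)) := by
    rw [← hlaw]
    exact (integrable_map_measure hf.aestronglyMeasurable hUVm.aemeasurable).2 hint
  have hg : StronglyMeasurable fun u => ∫ v, f (u, v) ∂(P.map V) :=
    hf.stronglyMeasurable.integral_prod_right'
  have hgint : Integrable (fun u => ∫ v, f (u, v) ∂(P.map V)) (P.map U) := hf'.integral_prod_left
  have hm : MeasurableSpace.comap U inferInstance ≤ mΩ := hU.comap_le
  refine (ae_eq_condExp_of_forall_setIntegral_eq hm hint ?_ ?_ ?_).symm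
  · intro s _ _
    exact ((integrable_map_measure hg.aestronglyMeasurable hU.aemeasurable).1 hgint).integrableOn
  · rintro s ⟨t, ht, rfl⟩ _
    have e1 : ∫ ω in U ⁻¹' t, (∫ v, f (U ω, v) ∂(P.map V)) ∂P
        = ∫ u in t, (∫ v, f (u, v) ∂(P.map V)) ∂(P.map U) :=
      (setIntegral_map ht hg.aestronglyMeasurable hU.aemeasurable).symm
    have e2 : ∫ ω in U ⁻¹' t, f (U ω, V ω) ∂P
        = ∫ p in t ×ˢ Set.univ, f p ∂((P.map U).prod (P.map V)) := by
      rw [← hlaw, setIntegral_map (ht.prod MeasurableSet.univ) hf.aestronglyMeasurable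
        hUVm.aemeasurable]
      congr 2
      ext ω
      simp
    rw [e1, e2, setIntegral_prod _ hf'.integrableOn]
    simp
  · refine StronglyMeasurable.aestronglyMeasurable ?_
    exact hg.comp_measurable (comap_measurable U)

/-- Replacing a variable by its conditional expectation does not change its covariance with a
measurable variable. -/
lemma covariance_condExp_right {m : MeasurableSpace Ω} (hm : m ≤ mΩ) {f g : Ω → ℝ}
    (hfm : StronglyMeasurable[m] f) (hf : MemLp f 2 P) (hg : MemLp g 2 P) :
    covariance f (P[g | m]) P = covariance f g P := by
  rw [covariance_eq_sub hf (hg.condExp one_le_two), covariance_eq_sub hf hg, integral_condExp hm]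
  congr 1
  have hfg : Integrable (f * g) P := hf.integrable_mul hg
  rw [← integral_congr_ae (condExp_mul_of_stronglyMeasurable_left hfm hfg
    (hg.integrable one_le_two)), integral_condExp hm]

end IndependentConditioning

lemma covariance_comp_measurePreserving {A B : Type*} [MeasurableSpace A] [MeasurableSpace B]
    {μ : Measure A} {ν : Measure B} {T : A → B} (hT : MeasurePreserving T μ ν) {f g : B → ℝ}
    (hf : Measurable f) (hg : Measurable g) :
    covariance (fun a => f (T a)) (fun a => g (T a)) μ = covariance f g ν := by
  rw [← hT.map_eq, covariance_map_fun hf.aestronglyMeasurable hg.aestronglyMeasurable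
    hT.measurable.aemeasurable]

lemma covariance_congr_right {Ω : Type*} [MeasurableSpace Ω] {P : Measure Ω} {f g g' : Ω → ℝ}
    (h : g =ᵐ[P] g') : covariance f g P = covariance f g' P := by
  rw [covariance, covariance, integral_congr_ae h]
  refine integral_congr_ae ?_
  filter_upwards [h] with ω hω
  rw [hω]

/-! ### Partial averages on product spaces -/

section ProductSpaces

variable {A B : Type*} [MeasurableSpace A] [MeasurableSpace B] {μ : Measure A} {ν : Measure B}
  [IsProbabilityMeasure μ] [IsProbabilityMeasure ν]

lemma condExp_comap_snd {G : A × B → ℝ} (hG : Measurable G) (hGi : Integrable G (μ.prod ν)) :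
    (μ.prod ν)[G | MeasurableSpace.comap Prod.snd inferInstance]
      =ᵐ[μ.prod ν] fun p => ∫ a, G (a, p.2) ∂μ := by
  have hind : IndepFun (Prod.snd : A × B → B) (Prod.fst : A × B → A) (μ.prod ν) :=
    (indepFun_prod (X := id) (Y := id) measurable_id measurable_id).symm
  have h := condExp_comap_of_indepFun measurable_snd measurable_fst hind
    (f := fun p : B × A => G (p.2, p.1)) (hG.comp measurable_swap) hGi
  simpa [Measure.map_fst_prod] using h

/-- The partial average is a conditional expectation given the second coordinate, which preserves
L². -/
lemma memLp_integral_fst {G : A × B → ℝ} (hG : Measurable G) (hG2 : MemLp G 2 (μ.prod ν)) :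
    MemLp (fun b => ∫ a, G (a, b) ∂μ) 2 ν := by
  have h1 : MemLp (fun p : A × B => ∫ a, G (a, p.2) ∂μ) 2 (μ.prod ν) :=
    (memLp_congr_ae (condExp_comap_snd hG (hG2.integrable one_le_two))).1 (hG2.condExp one_le_two)
  have hsm : StronglyMeasurable fun b => ∫ a, G (a, b) ∂μ :=
    hG.stronglyMeasurable.integral_prod_left'
  have h2 := (memLp_map_measure_iff (μ := μ.prod ν) (f := Prod.snd)
    (g := fun b => ∫ a, G (a, b) ∂μ) (p := 2) hsm.aestronglyMeasurable
    measurable_snd.aemeasurable).2 h1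
  simpa [Measure.map_snd_prod] using h2

lemma integral_comp_snd {f : B → ℝ} : ∫ p, f p.2 ∂(μ.prod ν) = ∫ b, f b ∂ν := by
  simp [integral_fun_snd]

/-- Decomposition of the variance on a product space. -/
lemma variance_prod_eq {G : A × B → ℝ} (hG : Measurable G) (hG2 : MemLp G 2 (μ.prod ν)) :
    Var[G; μ.prod ν] = ∫ p, (G p - ∫ a, G (a, p.2) ∂μ) ^ 2 ∂(μ.prod ν)
      + Var[fun b => ∫ a, G (a, b) ∂μ; ν] := by
  have hm : MeasurableSpace.comap (Prod.snd : A × B → B) inferInstance ≤ Prod.instMeasurableSpace :=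
    measurable_snd.comap_le
  have hce := condExp_comap_snd hG (hG2.integrable one_le_two)
  have hg2 := memLp_integral_fst hG hG2
  -- The law of total variance for the σ-algebra of the second coordinate.
  rw [← integral_condVar_add_variance_condExp hm hG2, condVar, integral_condExp hm]
  congr 1
  · refine integral_congr_ae ?_
    filter_upwards [hce] with p hp
    simp only [Pi.pow_apply, Pi.sub_apply, hp]
  · rw [variance_congr hce, variance_eq_sub (hg2.comp_snd μ), variance_eq_sub hg2]
    simp only [Pi.pow_apply, integral_comp_snd (μ := μ) (f := fun b => (∫ a, G (a, b) ∂μ) ^ 2),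
      integral_comp_snd (μ := μ) (f := fun b => ∫ a, G (a, b) ∂μ)]

/-- Jensen's inequality for partial averages. -/
lemma integral_sq_integral_fst_le {G : A × B → ℝ} (hG : Measurable G)
    (hG2 : MemLp G 2 (μ.prod ν)) :
    ∫ b, (∫ a, G (a, b) ∂μ) ^ 2 ∂ν ≤ ∫ p, G p ^ 2 ∂(μ.prod ν) := by
  have h := variance_prod_eq hG hG2
  rw [variance_eq_sub hG2, variance_eq_sub (memLp_integral_fst hG hG2)] at h
  have h1 : ∫ b, ∫ a, G (a, b) ∂μ ∂ν = ∫ p, G p ∂(μ.prod ν) :=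
    (integral_prod_symm _ (hG2.integrable one_le_two)).symm
  have h2 : 0 ≤ ∫ p, (G p - ∫ a, G (a, p.2) ∂μ) ^ 2 ∂(μ.prod ν) :=
    integral_nonneg fun p => sq_nonneg _
  rw [h1] at h
  simp only [Pi.pow_apply] at h
  linarith

end ProductSpaces

/-! ### The Efron-Stein inequality for symmetric functions -/

section SymmetricFunctions

variable {S : Type*} [MeasurableSpace S] (μ : Measure S) [IsProbabilityMeasure μ]

/-- The law of `n` independent observations. -/
noncomputable abbrev iidLaw (n : ℕ) : Measure (Fin n → S) := Measure.pi fun _ => μ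

/-- The average over the first coordinate. -/
noncomputable def avgFirst {n : ℕ} (F : (Fin (n + 1) → S) → ℝ) (z : Fin n → S) : ℝ :=
  ∫ y, F (Fin.cons y z : Fin (n + 1) → S) ∂μ

lemma measurePreserving_cons (n : ℕ) :
    MeasurePreserving (fun p : S × (Fin n → S) => (Fin.cons p.1 p.2 : Fin (n + 1) → S))
      (μ.prod (iidLaw μ n)) (iidLaw μ (n + 1)) := by
  have h := (measurePreserving_piFinSuccAbove (fun _ : Fin (n + 1) => μ) 0).symm
  convert! h using 1
  ext1 p
  simp [MeasurableEquiv.piFinSuccAbove, Fin.insertNthEquiv]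

lemma measurePreserving_comp_perm {n : ℕ} (σ : Equiv.Perm (Fin n)) :
    MeasurePreserving (fun z : Fin n → S => z ∘ σ) (iidLaw μ n) (iidLaw μ n) := by
  have h := measurePreserving_piCongrLeft (fun _ : Fin n => μ) σ.symm
  convert! h using 1
  ext z i
  have := MeasurableEquiv.piCongrLeft_apply_apply (β := fun _ : Fin n => S) σ.symm z (σ i)
  simpa using this.symm

variable {μ}

lemma measurable_cons {n : ℕ} :
    Measurable fun p : S × (Fin n → S) => (Fin.cons p.1 p.2 : Fin (n + 1) → S) := by
  refine measurable_pi_iff.2 fun i => ?_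
  refine Fin.cases ?_ (fun j => ?_) i
  · simpa using measurable_fst
  · simp only [Fin.cons_succ]
    exact (measurable_pi_apply j).comp measurable_snd

lemma memLp_comp_cons {n : ℕ} {F : (Fin (n + 1) → S) → ℝ} {p : ℝ≥0∞}
    (hF2 : MemLp F p (iidLaw μ (n + 1))) :
    MemLp (fun p : S × (Fin n → S) => F (Fin.cons p.1 p.2)) p (μ.prod (iidLaw μ n)) :=
  hF2.comp_measurePreserving (measurePreserving_cons μ n)

lemma integral_comp_cons {n : ℕ} {F : (Fin (n + 1) → S) → ℝ} (hF : Measurable F) :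
    ∫ p, F (Fin.cons p.1 p.2) ∂(μ.prod (iidLaw μ n)) = ∫ z, F z ∂(iidLaw μ (n + 1)) := by
  rw [← (measurePreserving_cons μ n).map_eq, integral_map (measurable_cons).aemeasurable
    hF.aestronglyMeasurable]

lemma measurable_avgFirst {n : ℕ} {F : (Fin (n + 1) → S) → ℝ} (hF : Measurable F) :
    Measurable (avgFirst μ F) :=
  ((hF.comp measurable_cons).stronglyMeasurable.integral_prod_left').measurable

lemma memLp_avgFirst {n : ℕ} {F : (Fin (n + 1) → S) → ℝ} (hF : Measurable F)
    (hF2 : MemLp F 2 (iidLaw μ (n + 1))) : MemLp (avgFirst μ F) 2 (iidLaw μ n) :=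
  memLp_integral_fst (hF.comp measurable_cons) (memLp_comp_cons hF2)

lemma integral_sq_avgFirst_le {n : ℕ} {F : (Fin (n + 1) → S) → ℝ} (hF : Measurable F)
    (hF2 : MemLp F 2 (iidLaw μ (n + 1))) :
    ∫ z, avgFirst μ F z ^ 2 ∂(iidLaw μ n) ≤ ∫ z, F z ^ 2 ∂(iidLaw μ (n + 1)) := by
  rw [← integral_comp_cons (hF.pow_const 2)]
  exact integral_sq_integral_fst_le (hF.comp measurable_cons) (memLp_comp_cons hF2)

lemma measurable_fin_tail {n : ℕ} : Measurable (Fin.tail : (Fin (n + 1) → S) → Fin n → S) :=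
  measurable_pi_iff.2 fun i => measurable_pi_apply (Fin.succ i)

lemma measurePreserving_tail (n : ℕ) :
    MeasurePreserving (Fin.tail : (Fin (n + 1) → S) → Fin n → S) (iidLaw μ (n + 1))
      (iidLaw μ n) := by
  refine ⟨measurable_fin_tail, ?_⟩
  rw [← (measurePreserving_cons μ n).map_eq, Measure.map_map measurable_fin_tail measurable_cons]
  have : (Fin.tail ∘ fun p : S × (Fin n → S) => (Fin.cons p.1 p.2 : Fin (n + 1) → S)) = Prod.snd := by
    ext p
    simp
  rw [this, Measure.map_snd_prod]
  simp

lemma variance_eq_add_variance_avgFirst {n : ℕ} {F : (Fin (n + 1) → S) → ℝ} (hF : Measurable F)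
    (hF2 : MemLp F 2 (iidLaw μ (n + 1))) :
    Var[F; iidLaw μ (n + 1)]
      = ∫ z, (F z - avgFirst μ F (Fin.tail z)) ^ 2 ∂(iidLaw μ (n + 1))
        + Var[avgFirst μ F; iidLaw μ n] := by
  have h := variance_prod_eq (hF.comp measurable_cons) (memLp_comp_cons hF2)
  have h1 : Var[F; iidLaw μ (n + 1)]
      = Var[fun p : S × (Fin n → S) => F (Fin.cons p.1 p.2); μ.prod (iidLaw μ n)] := by
    rw [variance_eq_sub hF2, variance_eq_sub (memLp_comp_cons hF2), ← integral_comp_cons hF]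
    simp only [Pi.pow_apply]
    rw [← integral_comp_cons (hF.pow_const 2)]
  rw [h1, ← integral_comp_cons
    (F := fun z => (F z - avgFirst μ F (Fin.tail z)) ^ 2) ((hF.sub ((measurable_avgFirst hF).comp measurable_fin_tail)).pow_const 2)]
  exact h

-- The permutation extends by fixing the new first coordinate. This keeps the induction of
-- `variance_le_of_symmetric` within symmetric functions.
omit [IsProbabilityMeasure μ] in
lemma avgFirst_comp_perm {n : ℕ} {F : (Fin (n + 1) → S) → ℝ}
    (hsymm : ∀ (σ : Equiv.Perm (Fin (n + 1))) z, F (z ∘ σ) = F z) (σ : Equiv.Perm (Fin n))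
    (z : Fin n → S) : avgFirst μ F (z ∘ σ) = avgFirst μ F z := by
  refine integral_congr_ae (Eventually.of_forall fun y => ?_)
  simp only
  rw [← hsymm (Equiv.Perm.decomposeFin.symm (0, σ)) (Fin.cons y z)]
  congr 1
  ext i
  refine Fin.cases ?_ (fun j => ?_) i <;> simp

/-- This is the integrability that allows the averages over the first two coordinates to be
interchanged. -/
lemma ae_avgFirst_comm {n : ℕ} {F : (Fin (n + 2) → S) → ℝ}
    (hF2 : Integrable F (iidLaw μ (n + 2))) :
    ∀ᵐ w ∂(iidLaw μ n), Integrable (fun p : S × S => F (Fin.cons p.1 (Fin.cons p.2 w)))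
      (μ.prod μ) := by
  have h1 : MeasurePreserving (fun p : S × (S × (Fin n → S)) =>
      (p.1, (Fin.cons p.2.1 p.2.2 : Fin (n + 1) → S)))
      (μ.prod (μ.prod (iidLaw μ n))) (μ.prod (iidLaw μ (n + 1))) :=
    (MeasurePreserving.id μ).prod (measurePreserving_cons μ n)
  have h2 := (measurePreserving_cons μ (n + 1)).comp
    (h1.comp (measurePreserving_prodAssoc μ μ (iidLaw μ n)))
  have h3 := h2.integrable_comp_of_integrable hF2
  exact h3.prod_left_ae

/-- The Efron-Stein inequality for symmetric functions. -/
theorem variance_le_of_symmetric {n : ℕ} {F : (Fin (n + 1) → S) → ℝ} (hF : Measurable F)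
    (hF2 : MemLp F 2 (iidLaw μ (n + 1)))
    (hsymm : ∀ (σ : Equiv.Perm (Fin (n + 1))) z, F (z ∘ σ) = F z) :
    Var[F; iidLaw μ (n + 1)]
      ≤ ((n + 1 : ℕ) : ℝ) * ∫ z, (F z - avgFirst μ F (Fin.tail z)) ^ 2 ∂(iidLaw μ (n + 1)) := by
  induction n with
  | zero =>
    rw [variance_eq_add_variance_avgFirst hF hF2]
    have : avgFirst μ F = fun _ => avgFirst μ F Fin.elim0 := by
      ext z
      rw [Subsingleton.elim z Fin.elim0]
    rw [this]
    simp [variance_eq_integral]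
  | succ n ih =>
    -- The first term is E K². The induction hypothesis bounds the variance of the averaged function
    -- by n + 1 copies of its own increment, and each is shown to be at most E K².
    rw [variance_eq_add_variance_avgFirst hF hF2]
    have hg := measurable_avgFirst (μ := μ) hF
    have hg2 := memLp_avgFirst hF hF2
    have h1 := ih hg hg2 (avgFirst_comp_perm hsymm)
    set K : (Fin (n + 2) → S) → ℝ := fun z => F z - avgFirst μ F (Fin.tail z) with hK
    have hKm : Measurable K := hF.sub (hg.comp measurable_fin_tail)
    have hK2 : MemLp K 2 (iidLaw μ (n + 2)) :=
      hF2.sub (hg2.comp_measurePreserving (measurePreserving_tail (n + 1)))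
    set σ : Equiv.Perm (Fin (n + 2)) := Equiv.swap 0 1 with hσ
    have hσm := measurePreserving_comp_perm μ σ
    have hswap : ∀ (x y : S) (w : Fin n → S), (Fin.cons x (Fin.cons y w : Fin (n + 1) → S) :
        Fin (n + 2) → S) ∘ σ = Fin.cons y (Fin.cons x w : Fin (n + 1) → S) := by
      intro x y w
      ext i
      refine Fin.cases ?_ (fun j => Fin.cases ?_ (fun k => ?_) j) i
      · simp [hσ]
      · simp [hσ]
      · rw [Function.comp_apply, hσ, Equiv.swap_apply_of_ne_of_ne (Fin.succ_ne_zero _)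
          (by rw [← Fin.succ_zero_eq_one]; exact fun h => Fin.succ_ne_zero _ (Fin.succ_injective _ h))]
        simp
    -- By symmetry, K with its first two coordinates swapped is F minus its average over the second
    -- one. Averaging over the first gives the increment of the averaged function, so Jensen
    -- compares their second moments.
    have hae : ∀ᵐ z ∂(iidLaw μ (n + 1)), avgFirst μ (fun z => K (z ∘ σ)) z
        = avgFirst μ F z - avgFirst μ (avgFirst μ F) (Fin.tail z) := by
      have hw := (measurePreserving_tail (μ := μ) n).quasiMeasurePreserving.ae
        (ae_avgFirst_comm (hF2.integrable one_le_two))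
      have hI : ∀ᵐ z ∂(iidLaw μ (n + 1)), Integrable (fun y => F (Fin.cons y z)) μ :=
        ((memLp_comp_cons hF2).integrable one_le_two).prod_left_ae
      filter_upwards [hw, hI] with z hz hIz
      obtain ⟨y, w, rfl⟩ : ∃ y w, z = (Fin.cons y w : Fin (n + 1) → S) :=
        ⟨z 0, Fin.tail z, (Fin.cons_self_tail z).symm⟩
      simp only [Fin.tail_cons] at hz ⊢
      have e1 : ∀ x, K ((Fin.cons x (Fin.cons y w : Fin (n + 1) → S) : Fin (n + 2) → S) ∘ σ)
          = F (Fin.cons x (Fin.cons y w : Fin (n + 1) → S))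
            - ∫ y', F (Fin.cons x (Fin.cons y' w : Fin (n + 1) → S)) ∂μ := by
        intro x
        rw [hswap, hK]
        simp only [Fin.tail_cons, avgFirst]
        rw [← hswap x y w, hsymm]
        congr 1
        refine integral_congr_ae (Eventually.of_forall fun y' => ?_)
        simp only
        rw [← hswap x y' w, hsymm]
      simp only [avgFirst, e1]
      rw [integral_sub hIz hz.integral_prod_left, integral_integral_swap hz]
    have h2 := integral_sq_avgFirst_le (μ := μ) (hKm.comp hσm.measurable)
      (hK2.comp_measurePreserving hσm)
    have h3 : ∫ z, (K ∘ fun z => z ∘ σ) z ^ 2 ∂(iidLaw μ (n + 2)) = ∫ z, K z ^ 2 ∂(iidLaw μ (n + 2)) := by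
      conv_rhs => rw [← hσm.map_eq]
      rw [integral_map hσm.measurable.aemeasurable (hKm.pow_const 2).aestronglyMeasurable]
      rfl
    have h4 : ∫ z, (avgFirst μ F z - avgFirst μ (avgFirst μ F) (Fin.tail z)) ^ 2 ∂(iidLaw μ (n + 1))
        ≤ ∫ z, K z ^ 2 ∂(iidLaw μ (n + 2)) := by
      rw [← h3]
      refine le_trans (le_of_eq (integral_congr_ae ?_)) h2
      filter_upwards [hae] with z hz
      rw [← hz]
      rfl
    have h5 := mul_le_mul_of_nonneg_left h4 (Nat.cast_nonneg (α := ℝ) (n + 1))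
    push_cast at h1 h5 ⊢
    linarith

/-- For symmetric functions all coordinates have the same covariance. -/
lemma covariance_eval_eq {n : ℕ} {F : (Fin (n + 1) → S) → ℝ} (hF : Measurable F)
    (hsymm : ∀ (σ : Equiv.Perm (Fin (n + 1))) z, F (z ∘ σ) = F z) {φ : S → ℝ} (hφ : Measurable φ)
    (i : Fin (n + 1)) :
    covariance (fun z => φ (z i)) F (iidLaw μ (n + 1))
      = covariance (fun z => φ (z 0)) F (iidLaw μ (n + 1)) := by
  have hσm := measurePreserving_comp_perm μ (Equiv.swap 0 i)
  rw [← covariance_comp_measurePreserving hσm (f := fun z => φ (z 0))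
    (hφ.comp (measurable_pi_apply 0)) hF]
  simp [hsymm]

/-- The subtracted average depends only on the tail, which is independent of coordinate 0. -/
lemma covariance_eval_sub_avgFirst {n : ℕ} {F : (Fin (n + 1) → S) → ℝ} (hF : Measurable F)
    (hF2 : MemLp F 2 (iidLaw μ (n + 1))) {φ : S → ℝ} (hφ : Measurable φ) (hφ2 : MemLp φ 2 μ) :
    covariance (fun z => φ (z 0)) (fun z => F z - avgFirst μ F (Fin.tail z)) (iidLaw μ (n + 1))
      = covariance (fun z => φ (z 0)) F (iidLaw μ (n + 1)) := by
  have hg := measurable_avgFirst (μ := μ) hF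
  have hg2 := memLp_avgFirst hF hF2
  have hφ0 : MemLp (fun z : Fin (n + 1) → S => φ (z 0)) 2 (iidLaw μ (n + 1)) :=
    hφ2.comp_measurePreserving (measurePreserving_eval (fun _ : Fin (n + 1) => μ) 0)
  have ht : MemLp (fun z => avgFirst μ F (Fin.tail z)) 2 (iidLaw μ (n + 1)) :=
    hg2.comp_measurePreserving (measurePreserving_tail n)
  rw [covariance_fun_sub_right hφ0 hF2 ht]
  have h : covariance (fun z => φ (z 0)) (fun z => avgFirst μ F (Fin.tail z)) (iidLaw μ (n + 1))
      = 0 := by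
    rw [← covariance_comp_measurePreserving (measurePreserving_cons μ n)
      (f := fun z => φ (z 0)) (g := fun z => avgFirst μ F (Fin.tail z))
      (hφ.comp (measurable_pi_apply 0)) (hg.comp measurable_fin_tail)]
    simpa using covariance_fst_snd_prod hφ2 hg2
  rw [h, sub_zero]

end SymmetricFunctions

/-! ### Joint laws of observations, replacements and test point -/

section Sampling

variable {Ω S : Type*} [mΩ : MeasurableSpace Ω] [MeasurableSpace S] {P : Measure Ω}
  [IsProbabilityMeasure P] {X X' : ℕ → Ω → S} {Xt : Ω → S}

omit [IsProbabilityMeasure P] in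
lemma IsIIDWithCopies.identDistrib_left (hX : IsIIDWithCopies P X X' Xt) (i : ℕ) :
    IdentDistrib (X i) (X 0) P P :=
  hX.identDistrib (Sum.inl i)

omit [IsProbabilityMeasure P] in
lemma IsIIDWithCopies.indep_left (hX : IsIIDWithCopies P X X' Xt) : iIndepFun X P :=
  hX.indep.precomp (g := Sum.inl) Sum.inl_injective

/-- Any finitely many distinct samples form an i.i.d. sample. -/
lemma IsIIDWithCopies.measurePreserving_of_injective (hX : IsIIDWithCopies P X X' Xt) {n : ℕ}
    {e : Fin n → ℕ ⊕ ℕ ⊕ Unit} (he : Function.Injective e) :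
    MeasurePreserving (fun ω i => allSamples X X' Xt (e i) ω) P (iidLaw (P.map (X 0)) n) := by
  refine ⟨measurable_pi_iff.2 fun i => hX.measurable _, ?_⟩
  have h := (iIndepFun_iff_map_fun_eq_pi_map (μ := P)
    (f := fun i => allSamples X X' Xt (e i)) fun i => (hX.measurable _).aemeasurable).1
    (hX.indep.precomp he)
  rw [h]
  simp only [iidLaw, (hX.identDistrib _).map_eq]

lemma IsIIDWithCopies.measurePreserving_sample (hX : IsIIDWithCopies P X X' Xt) (n : ℕ) :
    MeasurePreserving (fun ω (i : Fin n) => X i ω) P (iidLaw (P.map (X 0)) n) :=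
  hX.measurePreserving_of_injective (e := fun i => Sum.inl (i : ℕ))
    (Sum.inl_injective.comp Fin.val_injective)

lemma IsIIDWithCopies.measurePreserving_cons_test (hX : IsIIDWithCopies P X X' Xt) {n : ℕ}
    {e : Fin n → ℕ ⊕ ℕ ⊕ Unit} (he : Function.Injective e)
    (hne : ∀ i, e i ≠ Sum.inr (Sum.inr ())) :
    MeasurePreserving (fun ω => (Xt ω, fun i => allSamples X X' Xt (e i) ω)) P
      ((P.map (X 0)).prod (iidLaw (P.map (X 0)) n)) := by
  have : IsProbabilityMeasure (P.map (X 0)) :=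
    Measure.isProbabilityMeasure_map (hX.measurable (Sum.inl 0)).aemeasurable
  have h1 := hX.measurePreserving_of_injective
    (e := (Fin.cons (Sum.inr (Sum.inr ())) e : Fin (n + 1) → ℕ ⊕ ℕ ⊕ Unit))
    (Fin.cons_injective_iff.2 ⟨by rintro ⟨i, hi⟩; exact hne i hi, he⟩)
  have h2 := (measurePreserving_piFinSuccAbove (fun _ : Fin (n + 1) => P.map (X 0)) 0).comp h1
  convert! h2 using 1

lemma IsIIDWithCopies.measurePreserving_test_sample (hX : IsIIDWithCopies P X X' Xt) (n : ℕ) :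
    MeasurePreserving (fun ω => (Xt ω, fun i : Fin n => X i ω)) P
      ((P.map (X 0)).prod (iidLaw (P.map (X 0)) n)) :=
  hX.measurePreserving_cons_test (e := fun i => Sum.inl (i : ℕ))
    (Sum.inl_injective.comp Fin.val_injective) (by simp)

/-- The replaced sample still consists of distinct members of the i.i.d. family, so the loss after
replacement inherits the moments of the original loss. -/
lemma IsIIDWithCopies.measurePreserving_test_update (hX : IsIIDWithCopies P X X' Xt) (n : ℕ) :
    MeasurePreserving (fun ω => (Xt ω, fun i : Fin n =>
      Function.update (fun j => X j ω) 0 (X' 0 ω) (i : ℕ))) P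
      ((P.map (X 0)).prod (iidLaw (P.map (X 0)) n)) := by
  have h := hX.measurePreserving_cons_test
    (e := fun i : Fin n => if (i : ℕ) = 0 then Sum.inr (Sum.inl 0) else Sum.inl (i : ℕ)) ?_ ?_
  · convert! h using 1
    ext1 ω
    congr 1
    ext i
    by_cases hi : (i : ℕ) = 0
    · simp [hi, allSamples]
    · simp [hi, allSamples]
  · intro i j hij
    by_cases hi : (i : ℕ) = 0 <;> by_cases hj : (j : ℕ) = 0 <;> simp [hi, hj] at hij
    · exact Fin.ext (hi.trans hj.symm)
    · exact Fin.ext hij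
  · intro i
    by_cases hi : (i : ℕ) = 0 <;> simp [hi]

omit [IsProbabilityMeasure P] in
lemma IsIIDWithCopies.indepFun_process (hX : IsIIDWithCopies P X X' Xt) :
    IndepFun (fun ω i => X i ω) (fun ω => (X' 0 ω, Xt ω)) P := by
  have hm : ∀ s, MeasurableSpace.comap (allSamples X X' Xt s) inferInstance ≤ mΩ := fun s =>
    (hX.measurable s).comap_le
  have h := indep_iSup_of_disjoint (μ := P) hm hX.indep.iIndep
    (S := Set.range Sum.inl) (T := Set.range Sum.inr) Set.isCompl_range_inl_range_inr.disjoint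
  rw [IndepFun_iff_Indep]
  refine indep_of_indep_of_le_left (indep_of_indep_of_le_right h ?_) ?_
  · have hm1 : ∀ s, Measurable[⨆ n ∈ Set.range (Sum.inr : ℕ ⊕ Unit → ℕ ⊕ ℕ ⊕ Unit),
        MeasurableSpace.comap (allSamples X X' Xt n) inferInstance] (allSamples X X' Xt (Sum.inr s)) :=
      fun s => measurable_iff_comap_le.2 (le_iSup₂_of_le (Sum.inr s) ⟨s, rfl⟩ le_rfl)
    exact measurable_iff_comap_le.1 ((hm1 (Sum.inl 0)).prodMk (hm1 (Sum.inr ())))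
  · have hm1 : ∀ s, Measurable[⨆ n ∈ Set.range (Sum.inl : ℕ → ℕ ⊕ ℕ ⊕ Unit),
        MeasurableSpace.comap (allSamples X X' Xt n) inferInstance] (allSamples X X' Xt (Sum.inl s)) :=
      fun s => measurable_iff_comap_le.2 (le_iSup₂_of_le (Sum.inl s) ⟨s, rfl⟩ le_rfl)
    exact measurable_iff_comap_le.1 (@measurable_pi_lambda Ω ℕ (fun _ => S) (_) _ _ hm1)

lemma IsIIDWithCopies.map_replacement_test (hX : IsIIDWithCopies P X X' Xt) :
    P.map (fun ω => (X' 0 ω, Xt ω)) = (P.map (X 0)).prod (P.map (X 0)) := by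
  have hind : IndepFun (X' 0) Xt P :=
    hX.indep.indepFun (i := Sum.inr (Sum.inl 0)) (j := Sum.inr (Sum.inr ())) (by simp)
  have hm' : Measurable (X' 0) := hX.measurable (Sum.inr (Sum.inl 0))
  have hmt : Measurable Xt := hX.measurable (Sum.inr (Sum.inr ()))
  rw [(indepFun_iff_map_prod_eq_prod_map_map hm'.aemeasurable hmt.aemeasurable).1 hind]
  congr 1
  · exact (hX.identDistrib (Sum.inr (Sum.inl 0))).map_eq
  · exact (hX.identDistrib (Sum.inr (Sum.inr ()))).map_eq

end Sampling

/-! ### The stability term expressed through the trained risk -/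

section StabilityCovariance

variable {Ω S Y : Type*} [mΩ : MeasurableSpace Ω] [MeasurableSpace S] [MeasurableSpace Y]
  {P : Measure Ω} [IsProbabilityMeasure P] {X X' : ℕ → Ω → S} {Xt : Ω → S}
  {L : S → Y → ℝ} {f : (l : ℕ) → (Fin l → S) → Y}

/-- The risk of the estimator trained on the sample `z`. -/
noncomputable def trainedRisk (μ : Measure S) (L : S → Y → ℝ) (f : (l : ℕ) → (Fin l → S) → Y)
    (l : ℕ) (z : Fin l → S) : ℝ :=
  ∫ y, L y (f l z) ∂μ

lemma measurable_loss_estimator (hL : Measurable (Function.uncurry L)) {l : ℕ}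
    (hf : Measurable (f l)) : Measurable fun p : S × (Fin l → S) => L p.1 (f l p.2) :=
  hL.comp (measurable_fst.prodMk (hf.comp measurable_snd))

lemma measurable_trainedRisk {μ : Measure S} [SFinite μ] (hL : Measurable (Function.uncurry L))
    {l : ℕ} (hf : Measurable (f l)) : Measurable (trainedRisk μ L f l) :=
  (measurable_loss_estimator hL hf).stronglyMeasurable.integral_prod_left'.measurable

lemma memLp_loss_estimator (hX : IsIIDWithCopies P X X' Xt) (hL : Measurable (Function.uncurry L))
    {l : ℕ} (hf : Measurable (f l)) {p : ℝ≥0∞}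
    (h : MemLp (fun ω => testLoss L f l (Xt ω) fun i => X i ω) p P) :
    MemLp (fun p : S × (Fin l → S) => L p.1 (f l p.2)) p
      ((P.map (X 0)).prod (iidLaw (P.map (X 0)) l)) := by
  rw [← (hX.measurePreserving_test_sample l).map_eq]
  exact (memLp_map_measure_iff (measurable_loss_estimator hL hf).aestronglyMeasurable
    (hX.measurePreserving_test_sample l).measurable.aemeasurable).2 h

lemma memLp_trainedRisk (hX : IsIIDWithCopies P X X' Xt) (hL : Measurable (Function.uncurry L))
    {l : ℕ} (hf : Measurable (f l))
    (h : MemLp (fun ω => testLoss L f l (Xt ω) fun i => X i ω) 2 P) :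
    MemLp (trainedRisk (P.map (X 0)) L f l) 2 (iidLaw (P.map (X 0)) l) := by
  have : IsProbabilityMeasure (P.map (X 0)) :=
    Measure.isProbabilityMeasure_map (hX.measurable (Sum.inl 0)).aemeasurable
  exact memLp_integral_fst (measurable_loss_estimator hL hf) (memLp_loss_estimator hX hL hf h)

lemma memLp_testLoss_update (hX : IsIIDWithCopies P X X' Xt) (hL : Measurable (Function.uncurry L))
    {l : ℕ} (hf : Measurable (f l)) {p : ℝ≥0∞}
    (h : MemLp (fun ω => testLoss L f l (Xt ω) fun i => X i ω) p P) :
    MemLp (fun ω => testLoss L f l (Xt ω) (Function.update (fun i => X i ω) 0 (X' 0 ω))) p P :=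
  (memLp_loss_estimator hX hL hf h).comp_measurePreserving (hX.measurePreserving_test_update l)

lemma memLp_beta₁ (hX : IsIIDWithCopies P X X' Xt) (hL : Measurable (Function.uncurry L))
    {l : ℕ} (hf : Measurable (f l)) {p : ℝ≥0∞}
    (h : MemLp (fun ω => testLoss L f l (Xt ω) fun i => X i ω) p P) :
    MemLp (beta₁ X X' Xt L f l) p P :=
  h.sub (memLp_testLoss_update hX hL hf h)

/-- Integrating out the test point turns the loss into the trained risk; integrating out the
replacement too averages that risk over its first entry. The result is exactly the increment in the
Efron-Stein inequality. -/
lemma condExp_beta₁ (hX : IsIIDWithCopies P X X' Xt) (hL : Measurable (Function.uncurry L))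
    {k : ℕ} (hf : Measurable (f (k + 1)))
    (h : MemLp (fun ω => testLoss L f (k + 1) (Xt ω) fun i => X i ω) 2 P) :
    P[beta₁ X X' Xt L f (k + 1) | sigmaProcess X] =ᵐ[P] fun ω =>
      trainedRisk (P.map (X 0)) L f (k + 1) (fun i => X i ω)
        - avgFirst (P.map (X 0)) (trainedRisk (P.map (X 0)) L f (k + 1))
          (Fin.tail fun i => X i ω) := by
  set μ := P.map (X 0) with hμ
  have : IsProbabilityMeasure μ :=
    Measure.isProbabilityMeasure_map (hX.measurable (Sum.inl 0)).aemeasurable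
  have hproc : Measurable fun ω i => X i ω := measurable_pi_iff.2 fun i => hX.measurable (Sum.inl i)
  have hXt : Measurable Xt := hX.measurable (Sum.inr (Sum.inr ()))
  have hX' : Measurable (X' 0) := hX.measurable (Sum.inr (Sum.inl 0))
  have hmt : P.map Xt = μ := (hX.identDistrib (Sum.inr (Sum.inr ()))).map_eq
  have hT := measurable_loss_estimator hL hf
  have h1 := h.integrable one_le_two
  have h2 := (memLp_testLoss_update hX hL hf h).integrable one_le_two
  have hr : Measurable fun (x : ℕ → S) (i : Fin (k + 1)) => x i :=
    measurable_pi_iff.2 fun i => measurable_pi_apply (i : ℕ)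
  have hupd : ∀ (x : ℕ → S) (y : S), (fun i : Fin (k + 1) => Function.update x 0 y (i : ℕ))
      = Fin.cons y (Fin.tail fun i : Fin (k + 1) => x i) := by
    intro x y
    ext i
    refine Fin.cases ?_ (fun j => ?_) i
    · simp
    · simp [Fin.tail]
  have e1 : P[fun ω => testLoss L f (k + 1) (Xt ω) fun i => X i ω | sigmaProcess X] =ᵐ[P]
      fun ω => trainedRisk μ L f (k + 1) fun i => X i ω := by
    have hind : IndepFun (fun ω i => X i ω) Xt P :=
      hX.indepFun_process.comp measurable_id measurable_snd
    have h3 := condExp_comap_of_indepFun hproc hXt hind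
      (f := fun p : (ℕ → S) × S => L p.2 (f (k + 1) fun i => p.1 i))
      (hT.comp (measurable_snd.prodMk (hr.comp measurable_fst))) h1
    rw [hmt] at h3
    exact h3
  have e2 : P[fun ω => testLoss L f (k + 1) (Xt ω) (Function.update (fun i => X i ω) 0 (X' 0 ω))
      | sigmaProcess X] =ᵐ[P]
      fun ω => avgFirst μ (trainedRisk μ L f (k + 1)) (Fin.tail fun i => X i ω) := by
    have hm2 : Measurable fun p : (ℕ → S) × (S × S) =>
        L p.2.2 (f (k + 1) (Fin.cons p.2.1 (Fin.tail fun i : Fin (k + 1) => p.1 i))) :=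
      hT.comp (measurable_snd.snd.prodMk (measurable_cons.comp
        (measurable_snd.fst.prodMk (measurable_fin_tail.comp (hr.comp measurable_fst)))))
    have h2' : Integrable (fun ω => L (Xt ω) (f (k + 1) (Fin.cons (X' 0 ω)
        (Fin.tail fun i : Fin (k + 1) => X i ω)))) P := by
      simpa only [testLoss, hupd] using h2
    have h3 := condExp_comap_of_indepFun hproc (hX'.prodMk hXt) hX.indepFun_process hm2 h2'
    rw [hX.map_replacement_test] at h3
    -- Fubini over replacement and test point needs integrability for almost every fixed sample.
    have hI : ∀ᵐ ω ∂P, Integrable (fun p : S × S => L p.2 (f (k + 1) (Fin.cons p.1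
        (Fin.tail fun i : Fin (k + 1) => X i ω)))) (μ.prod μ) := by
      have hlaw := (indepFun_iff_map_prod_eq_prod_map_map hproc.aemeasurable
        (hX'.prodMk hXt).aemeasurable).1 hX.indepFun_process
      rw [hX.map_replacement_test] at hlaw
      have h4 := (integrable_map_measure hm2.aestronglyMeasurable
        (hproc.prodMk (hX'.prodMk hXt)).aemeasurable).2 h2'
      rw [hlaw] at h4
      have : IsProbabilityMeasure (P.map fun ω i => X i ω) :=
        Measure.isProbabilityMeasure_map hproc.aemeasurable
      exact ae_of_ae_map hproc.aemeasurable h4.prod_right_ae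
    simp only [testLoss, hupd]
    filter_upwards [h3, hI] with ω hω hIω
    rw [hω, integral_prod _ hIω]
    rfl
  have e3 := condExp_sub (μ := P) h1 h2 (sigmaProcess X)
  refine e3.trans ?_
  filter_upwards [e1, e2] with ω h1 h2
  rw [Pi.sub_apply, h1, h2]

/-- The variance of the risk of a stable symmetric estimator. -/
lemma variance_trainedRisk_le (hX : IsIIDWithCopies P X X' Xt)
    (hL : Measurable (Function.uncurry L)) {l : ℕ} (hl : 1 ≤ l) (hf : Measurable (f l))
    (hsymm : ∀ (σ : Equiv.Perm (Fin l)) z, f l (z ∘ σ) = f l z)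
    (h : MemLp (fun ω => testLoss L f l (Xt ω) fun i => X i ω) 2 P) :
    Var[fun ω => trainedRisk (P.map (X 0)) L f l fun i => X i ω; P]
      ≤ l * ∫ ω, (P[beta₁ X X' Xt L f l | sigmaProcess X]) ω ^ 2 ∂P := by
  obtain ⟨k, rfl⟩ : ∃ k, l = k + 1 := ⟨l - 1, by omega⟩
  set μ := P.map (X 0) with hμ
  have : IsProbabilityMeasure μ :=
    Measure.isProbabilityMeasure_map (hX.measurable (Sum.inl 0)).aemeasurable
  have hF := measurable_trainedRisk (μ := μ) hL hf
  have hF2 := memLp_trainedRisk hX hL hf h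
  have hmp := hX.measurePreserving_sample (k + 1)
  have h1 := variance_le_of_symmetric hF hF2 fun σ z => by simp only [trainedRisk, hsymm σ z]
  have e1 : Var[fun ω => trainedRisk μ L f (k + 1) fun i => X i ω; P]
      = Var[trainedRisk μ L f (k + 1); iidLaw μ (k + 1)] := by
    rw [← covariance_self hF.aemeasurable, ← covariance_comp_measurePreserving hmp hF hF]
    exact (covariance_self (hF.comp hmp.measurable).aemeasurable).symm
  have e2 : ∫ ω, (P[beta₁ X X' Xt L f (k + 1) | sigmaProcess X]) ω ^ 2 ∂P
      = ∫ z, (trainedRisk μ L f (k + 1) z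
        - avgFirst μ (trainedRisk μ L f (k + 1)) (Fin.tail z)) ^ 2 ∂(iidLaw μ (k + 1)) := by
    have hKm : Measurable fun z => (trainedRisk μ L f (k + 1) z
        - avgFirst μ (trainedRisk μ L f (k + 1)) (Fin.tail z)) ^ 2 :=
      (hF.sub ((measurable_avgFirst hF).comp measurable_fin_tail)).pow_const 2
    rw [← hmp.map_eq, integral_map hmp.measurable.aemeasurable hKm.aestronglyMeasurable]
    refine integral_congr_ae ?_
    filter_upwards [condExp_beta₁ hX hL hf h] with ω hω
    rw [hω]
  rw [e1, e2]
  exact h1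

/-- The covariance with the first order stability term, in terms of the risk of the estimator. -/
lemma mul_covariance_condExp_beta₁ (hX : IsIIDWithCopies P X X' Xt)
    (hL : Measurable (Function.uncurry L)) {l : ℕ} (hl : 1 ≤ l) (hf : Measurable (f l))
    (hsymm : ∀ (σ : Equiv.Perm (Fin l)) z, f l (z ∘ σ) = f l z)
    (h : MemLp (fun ω => testLoss L f l (Xt ω) fun i => X i ω) 2 P) {φ : S → ℝ}
    (hφ : Measurable φ) (hφ2 : MemLp (fun ω => φ (X 0 ω)) 2 P) :
    (l : ℝ) * covariance (fun ω => φ (X 0 ω)) (P[beta₁ X X' Xt L f l | sigmaFirst X]) P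
      = covariance (fun ω => ∑ i ∈ Finset.range l, φ (X i ω))
          (fun ω => trainedRisk (P.map (X 0)) L f l fun i => X i ω) P := by
  obtain ⟨k, rfl⟩ : ∃ k, l = k + 1 := ⟨l - 1, by omega⟩
  set μ := P.map (X 0) with hμ
  have : IsProbabilityMeasure μ :=
    Measure.isProbabilityMeasure_map (hX.measurable (Sum.inl 0)).aemeasurable
  have hF := measurable_trainedRisk (μ := μ) hL hf
  have hF2 := memLp_trainedRisk hX hL hf h
  have hmp := hX.measurePreserving_sample (k + 1)
  have hX0 : Measurable (X 0) := hX.measurable (Sum.inl 0)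
  have hφμ : MemLp φ 2 μ :=
    (memLp_map_measure_iff hφ.aestronglyMeasurable hX0.aemeasurable).2 hφ2
  have hproc : Measurable fun ω i => X i ω := measurable_pi_iff.2 fun i => hX.measurable (Sum.inl i)
  have hβ := memLp_beta₁ hX hL hf h
  have hsF : ∀ (σ : Equiv.Perm (Fin (k + 1))) z,
      trainedRisk μ L f (k + 1) (z ∘ σ) = trainedRisk μ L f (k + 1) z := fun σ z => by
    simp only [trainedRisk, hsymm σ z]
  have hsm1 : StronglyMeasurable[sigmaFirst X] fun ω => φ (X 0 ω) :=
    (hφ.comp (comap_measurable (X 0))).stronglyMeasurable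
  have hsm2 : StronglyMeasurable[sigmaProcess X] fun ω => φ (X 0 ω) :=
    (hφ.comp ((measurable_pi_apply 0).comp
      (comap_measurable fun ω i => X i ω))).stronglyMeasurable
  -- φ(X 0) is measurable for both σ-algebras, so conditioning on the first observation may be
  -- exchanged for conditioning on the whole process, where the conditional expectation is explicit.
  have e1 : covariance (fun ω => φ (X 0 ω)) (P[beta₁ X X' Xt L f (k + 1) | sigmaFirst X]) P
      = covariance (fun z => φ (z 0)) (trainedRisk μ L f (k + 1)) (iidLaw μ (k + 1)) := by
    rw [covariance_condExp_right hX0.comap_le hsm1 hφ2 hβ,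
      ← covariance_condExp_right hproc.comap_le hsm2 hφ2 hβ,
      covariance_congr_right (condExp_beta₁ hX hL hf h), ← covariance_eval_sub_avgFirst hF hF2 hφ hφμ,
      ← covariance_comp_measurePreserving hmp (f := fun z => φ (z 0))
      (g := fun z => trainedRisk μ L f (k + 1) z
        - avgFirst μ (trainedRisk μ L f (k + 1)) (Fin.tail z)) (hφ.comp (measurable_pi_apply 0))
      (hF.sub ((measurable_avgFirst hF).comp measurable_fin_tail))]
    rfl
  have hφi := memLp_comp_of_identDistrib hX.identDistrib_left hφ.stronglyMeasurable hφ2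
  have e2 : ∀ i : Fin (k + 1), covariance (fun ω => φ (X i ω))
      (fun ω => trainedRisk μ L f (k + 1) fun i => X i ω) P
      = covariance (fun z => φ (z 0)) (trainedRisk μ L f (k + 1)) (iidLaw μ (k + 1)) := by
    intro i
    rw [← covariance_eval_eq hF hsF hφ i, ← covariance_comp_measurePreserving hmp
      (f := fun z => φ (z i)) (hφ.comp (measurable_pi_apply i)) hF]
  have hFX : MemLp (fun ω => trainedRisk μ L f (k + 1) fun i => X i ω) 2 P :=
    hF2.comp_measurePreserving hmp
  rw [covariance_fun_sum_left' (fun i _ => hφi i) hFX, Finset.sum_range]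
  simp only [e2]
  rw [e1]
  simp

end StabilityCovariance

/-! ### From convergence in probability to convergence of integrals -/

section UniformIntegrability

variable {Ω : Type*} [MeasurableSpace Ω] {P : Measure Ω} [IsProbabilityMeasure P]

omit [IsProbabilityMeasure P] in
lemma integrable_pow_four_of_memLp {f : Ω → ℝ} (hf : MemLp f 4 P) :
    Integrable (fun ω => f ω ^ 4) P := by
  have h := hf.integrable_norm_pow (p := 4) (by norm_num)
  refine h.congr (Eventually.of_forall fun ω => ?_)
  simp only [Real.norm_eq_abs]
  exact (show Even 4 by decide).pow_abs _

/-- Pairing a sequence bounded in `L⁴` with one bounded in `L²` and vanishing in probability. -/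
lemma tendsto_integral_mul_of_tendstoInMeasure {T r : ℕ → Ω → ℝ} {C : ℝ}
    (hT : ∀ᶠ n in atTop, MemLp (T n) 4 P ∧ ∫ ω, T n ω ^ 4 ∂P ≤ C)
    (hr : ∀ᶠ n in atTop, MemLp (r n) 2 P ∧ ∫ ω, r n ω ^ 2 ∂P ≤ C)
    (h : TendstoInMeasure P r atTop fun _ => 0) :
    Tendsto (fun n => ∫ ω, T n ω * r n ω ∂P) atTop (𝓝 0) := by
  have hC : 0 ≤ C := by
    obtain ⟨n, hn⟩ := hr.exists
    exact (integral_nonneg fun ω => sq_nonneg _).trans hn.2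
  rw [Metric.tendsto_atTop']
  intro e he
  -- The constants make each of the four error terms in `k1`, `k2`, `k3` at most e/5. The
  -- probability threshold 16εη(e/5) cancels the factor 1/(4ε) · 1/(4η) below.
  set ε := e / (5 * (1 + C)) with hε
  set η := 4 * ε * e / (5 * (1 + C)) with hη
  have hε0 : 0 < ε := by positivity
  have hη0 : 0 < η := by positivity
  have hA := (ENNReal.tendsto_nhds_zero.1 (tendstoInMeasure_iff_norm.1 h ε hε0))
    (ENNReal.ofReal (16 * ε * η * (e / 5))) (by simp; positivity)
  obtain ⟨N, hN⟩ := eventually_atTop.1 (hT.and (hr.and hA))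
  refine ⟨N, fun n hn => ?_⟩
  obtain ⟨⟨hT4, hTC⟩, ⟨hr2, hrC⟩, hAn⟩ := hN n hn.le
  simp only [sub_zero] at hAn
  set A := {ω | ε ≤ ‖r n ω‖} with hAdef
  have hAm : NullMeasurableSet A P :=
    nullMeasurableSet_le aemeasurable_const hr2.1.norm.aemeasurable
  have hAr : P.real A ≤ 16 * ε * η * (e / 5) := by
    rw [measureReal_def]
    exact ENNReal.toReal_le_of_le_ofReal (by positivity) hAn
  have hT4i := integrable_pow_four_of_memLp hT4
  have hr2i : Integrable (fun ω => r n ω ^ 2) P := hr2.integrable_sq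
  have hind : Integrable (A.indicator fun _ => (1 : ℝ)) P :=
    (integrable_const _).indicator₀ hAm
  -- Off A, |r| < ε and |T| ≤ 1 + T⁴. On A, Young's inequality twice: |T r| ≤ ε r² + T²/(4ε), then
  -- T² ≤ η T⁴ + 1/(4η).
  have hpt : ∀ ω, |T n ω * r n ω| ≤ ε * (1 + T n ω ^ 4) + ε * r n ω ^ 2
      + 1 / (4 * ε) * (η * T n ω ^ 4 + 1 / (4 * η) * A.indicator (fun _ => (1 : ℝ)) ω) := by
    intro ω
    rw [abs_mul]
    set t := |T n ω| with ht
    set u := |r n ω| with hu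
    have ht0 : 0 ≤ t := abs_nonneg _
    have hu0 : 0 ≤ u := abs_nonneg _
    have ht4 : T n ω ^ 4 = t ^ 4 := ((show Even 4 by decide).pow_abs _).symm
    have hu2 : r n ω ^ 2 = u ^ 2 := (sq_abs _).symm
    rw [ht4, hu2]
    by_cases hω : ω ∈ A
    · rw [Set.indicator_of_mem hω]
      have h1 : t * u ≤ ε * u ^ 2 + 1 / (4 * ε) * t ^ 2 := by
        have : ε * u ^ 2 + 1 / (4 * ε) * t ^ 2 - t * u = (2 * ε * u - t) ^ 2 / (4 * ε) := by
          field_simp; ring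
        have : 0 ≤ (2 * ε * u - t) ^ 2 / (4 * ε) := by positivity
        linarith
      have h2 : t ^ 2 ≤ η * t ^ 4 + 1 / (4 * η) * 1 := by
        have : η * t ^ 4 + 1 / (4 * η) * 1 - t ^ 2 = (2 * η * t ^ 2 - 1) ^ 2 / (4 * η) := by
          field_simp; ring
        have : 0 ≤ (2 * η * t ^ 2 - 1) ^ 2 / (4 * η) := by positivity
        linarith
      have h3 := mul_le_mul_of_nonneg_left h2 (show 0 ≤ 1 / (4 * ε) by positivity)
      have h4 : 0 ≤ ε * (1 + t ^ 4) := by positivity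
      linarith
    · rw [Set.indicator_of_notMem hω]
      have hlt : u ≤ ε := by
        have : ¬ ε ≤ ‖r n ω‖ := hω
        rw [Real.norm_eq_abs] at this
        exact (not_le.1 this).le
      have h1 : t ≤ 1 + t ^ 4 := by nlinarith [sq_nonneg (t - 1), sq_nonneg (t ^ 2 - 1)]
      have h2 : t * u ≤ (1 + t ^ 4) * ε := mul_le_mul h1 hlt hu0 (by positivity)
      have h3 : 0 ≤ ε * u ^ 2 := by positivity
      have h4 : 0 ≤ 1 / (4 * ε) * (η * t ^ 4 + 1 / (4 * η) * 0) := by positivity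
      linarith
  have hb1 : Integrable (fun ω => ε * (1 + T n ω ^ 4)) P :=
    ((integrable_const _).add hT4i).const_mul _
  have hb2 : Integrable (fun ω => ε * r n ω ^ 2) P := hr2i.const_mul _
  have hb3 : Integrable (fun ω => 1 / (4 * ε) * (η * T n ω ^ 4
      + 1 / (4 * η) * A.indicator (fun _ => (1 : ℝ)) ω)) P :=
    ((hT4i.const_mul _).add (hind.const_mul _)).const_mul _
  have hb12 : Integrable (fun ω => ε * (1 + T n ω ^ 4) + ε * r n ω ^ 2) P := hb1.add hb2
  have hle : ‖∫ ω, T n ω * r n ω ∂P‖ ≤ ∫ ω, (ε * (1 + T n ω ^ 4) + ε * r n ω ^ 2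
      + 1 / (4 * ε) * (η * T n ω ^ 4 + 1 / (4 * η) * A.indicator (fun _ => (1 : ℝ)) ω)) ∂P :=
    norm_integral_le_of_norm_le (hb12.add hb3) (Eventually.of_forall hpt)
  have hval : ∫ ω, (ε * (1 + T n ω ^ 4) + ε * r n ω ^ 2
      + 1 / (4 * ε) * (η * T n ω ^ 4 + 1 / (4 * η) * A.indicator (fun _ => (1 : ℝ)) ω)) ∂P
      = ε * (1 + ∫ ω, T n ω ^ 4 ∂P) + ε * ∫ ω, r n ω ^ 2 ∂P
        + 1 / (4 * ε) * (η * ∫ ω, T n ω ^ 4 ∂P + 1 / (4 * η) * P.real A) := by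
    rw [integral_add hb12 hb3, integral_add hb1 hb2, integral_const_mul, integral_const_mul,
      integral_const_mul, integral_add (integrable_const _) hT4i,
      integral_add (hT4i.const_mul _) (hind.const_mul _), integral_const_mul, integral_const_mul,
      integral_indicator₀ hAm]
    simp
  rw [hval] at hle
  rw [dist_zero_right]
  refine hle.trans_lt ?_
  have k1 : ε * (1 + ∫ ω, T n ω ^ 4 ∂P) ≤ e / 5 := by
    calc ε * (1 + ∫ ω, T n ω ^ 4 ∂P) ≤ ε * (1 + C) := by gcongr
      _ = e / 5 := by rw [hε]; field_simp
  have k2 : ε * ∫ ω, r n ω ^ 2 ∂P ≤ e / 5 := by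
    calc ε * ∫ ω, r n ω ^ 2 ∂P ≤ ε * (1 + C) := by gcongr; linarith
      _ = e / 5 := by rw [hε]; field_simp
  have k3 : 1 / (4 * ε) * (η * ∫ ω, T n ω ^ 4 ∂P + 1 / (4 * η) * P.real A) ≤ e / 5 + e / 5 := by
    calc 1 / (4 * ε) * (η * ∫ ω, T n ω ^ 4 ∂P + 1 / (4 * η) * P.real A)
        ≤ 1 / (4 * ε) * (η * (1 + C) + 1 / (4 * η) * (16 * ε * η * (e / 5))) := by
          gcongr; linarith
      _ = e / 5 + e / 5 := by
          have : η * (1 + C) = 4 * ε * (e / 5) := by rw [hη]; field_simp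
          rw [this]
          field_simp
          ring
  linarith

omit [IsProbabilityMeasure P] in
lemma integral_sq_add_le {f g : Ω → ℝ} (hf : MemLp f 2 P) (hg : MemLp g 2 P) :
    ∫ ω, (f ω + g ω) ^ 2 ∂P ≤ 2 * ∫ ω, f ω ^ 2 ∂P + 2 * ∫ ω, g ω ^ 2 ∂P := by
  rw [← integral_const_mul, ← integral_const_mul,
    ← integral_add (hf.integrable_sq.const_mul 2) (hg.integrable_sq.const_mul 2)]
  refine integral_mono_of_nonneg (Eventually.of_forall fun ω => sq_nonneg _)
    ((hf.integrable_sq.const_mul 2).add (hg.integrable_sq.const_mul 2))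
    (Eventually.of_forall fun ω => ?_)
  simp only
  nlinarith [sq_nonneg (f ω - g ω)]

/-- A deterministic shift that makes an `L²`-bounded sequence vanish in probability is bounded. -/
lemma exists_integral_sq_add_const_le {Z : ℕ → Ω → ℝ} {c : ℕ → ℝ} {C : ℝ}
    (hZ : ∀ᶠ n in atTop, MemLp (Z n) 2 P ∧ ∫ ω, Z n ω ^ 2 ∂P ≤ C)
    (h : TendstoInMeasure P (fun n ω => Z n ω + c n) atTop fun _ => 0) :
    ∃ C', ∀ᶠ n in atTop, MemLp (fun ω => Z n ω + c n) 2 P ∧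
      ∫ ω, (Z n ω + c n) ^ 2 ∂P ≤ C' := by
  have hC : 0 ≤ C := by
    obtain ⟨n, hn⟩ := hZ.exists
    exact (integral_nonneg fun ω => sq_nonneg _).trans hn.2
  -- Chebyshev makes ‖Z‖ ≥ B an event of probability at most 1/4.
  set B := √(4 * (C + 1)) with hB
  have hB0 : 0 < B := Real.sqrt_pos.2 (by positivity)
  have hB2 : B ^ 2 = 4 * (C + 1) := Real.sq_sqrt (by positivity)
  refine ⟨2 * C + 2 * (1 + B) ^ 2, ?_⟩
  have h1 := (ENNReal.tendsto_nhds_zero.1 (tendstoInMeasure_iff_norm.1 h 1 one_pos))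
    (ENNReal.ofReal (1 / 4)) (by simp)
  filter_upwards [hZ, h1] with n hn h1n
  refine ⟨hn.1.add (memLp_const _), ?_⟩
  have hP : P ({ω | 1 ≤ ‖Z n ω + c n - 0‖} ∪ {ω | B ≤ ‖Z n ω‖}) < 1 := by
    have h2 : P {ω | B ≤ ‖Z n ω‖} ≤ ENNReal.ofReal (1 / 4) := by
      refine (prob_norm_ge_le hn.1 hB0).trans (ENNReal.ofReal_le_ofReal ?_)
      rw [hB2, div_le_div_iff₀ (by positivity) (by norm_num)]
      simp only [Real.norm_eq_abs, sq_abs]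
      linarith [hn.2]
    refine ((measure_union_le _ _).trans (add_le_add h1n h2)).trans_lt ?_
    rw [← ENNReal.ofReal_add (by norm_num) (by norm_num), ENNReal.ofReal_lt_one]
    norm_num
  -- Two events of probability at most 1/4 cannot cover Ω. At a point outside both, Z and Z + c are
  -- bounded, and hence so is the deterministic c.
  obtain ⟨ω, hω⟩ : ∃ ω, ω ∉ {ω | 1 ≤ ‖Z n ω + c n - 0‖} ∪ {ω | B ≤ ‖Z n ω‖} := by
    by_contra hcon
    push Not at hcon
    rw [Set.eq_univ_of_forall hcon, measure_univ] at hP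
    exact lt_irrefl _ hP
  simp only [Set.mem_union, Set.mem_ofPred_eq, not_or, not_le, sub_zero, Real.norm_eq_abs] at hω
  have hc : |c n| ≤ 1 + B := by
    have : c n = (Z n ω + c n) - Z n ω := by ring
    rw [this]
    exact (abs_sub _ _).trans (add_le_add hω.1.le hω.2.le)
  have hc2 : c n ^ 2 ≤ (1 + B) ^ 2 := by
    rw [← sq_abs (c n)]
    exact pow_le_pow_left₀ (abs_nonneg _) hc 2
  refine (integral_sq_add_le hn.1 (memLp_const _)).trans ?_
  simp only [integral_const, probReal_univ, one_smul]
  linarith [hn.2]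

end UniformIntegrability

/-! ### Fourth moments of sums -/

section FourthMoments

variable {Ω S : Type*} [MeasurableSpace Ω] [MeasurableSpace S] {P : Measure Ω}
  [IsProbabilityMeasure P] {X : ℕ → Ω → S}

/-- In the binomial expansion the terms A³u and Au³ contain a centred independent factor and vanish.
-/
lemma integral_add_pow_four_of_indepFun {A u : Ω → ℝ} (hA : MemLp A 4 P) (hu : MemLp u 4 P)
    (hind : IndepFun A u P) (hA0 : ∫ ω, A ω ∂P = 0) (hu0 : ∫ ω, u ω ∂P = 0) :
    ∫ ω, (A ω + u ω) ^ 4 ∂P = ∫ ω, A ω ^ 4 ∂P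
      + 6 * ((∫ ω, A ω ^ 2 ∂P) * ∫ ω, u ω ^ 2 ∂P) + ∫ ω, u ω ^ 4 ∂P := by
  have hpow : ∀ {f : Ω → ℝ}, MemLp f 4 P → ∀ k : ℕ, k ≤ 4 → Integrable (fun ω => f ω ^ k) P := by
    intro f hf k hk
    rcases Nat.eq_zero_or_pos k with h0 | h0
    · subst h0; simp
    · have h1 : MemLp f (k : ℝ≥0∞) P := hf.mono_exponent (by exact_mod_cast hk)
      have h2 := h1.integrable_norm_pow h0.ne'
      refine h2.mono (hf.1.pow k) (Eventually.of_forall fun ω => ?_)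
      simp
  have hprod : ∀ j k : ℕ, IndepFun (fun ω => A ω ^ j) (fun ω => u ω ^ k) P := fun j k =>
    hind.comp (measurable_id.pow_const j) (measurable_id.pow_const k)
  have hmul : ∀ j k : ℕ, j ≤ 4 → k ≤ 4 → ∫ ω, A ω ^ j * u ω ^ k ∂P
      = (∫ ω, A ω ^ j ∂P) * ∫ ω, u ω ^ k ∂P := fun j k hj hk =>
    (hprod j k).integral_fun_mul_eq_mul_integral (hpow hA j hj).1 (hpow hu k hk).1
  have hmi : ∀ j k : ℕ, j ≤ 4 → k ≤ 4 → Integrable (fun ω => A ω ^ j * u ω ^ k) P :=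
    fun j k hj hk => (hprod j k).integrable_mul (hpow hA j hj) (hpow hu k hk)
  have hexp : ∀ ω, (A ω + u ω) ^ 4 = A ω ^ 4 + (4 * (A ω ^ 3 * u ω ^ 1) + (6 * (A ω ^ 2 * u ω ^ 2)
      + (4 * (A ω ^ 1 * u ω ^ 3) + u ω ^ 4))) := fun ω => by ring
  simp only [hexp]
  have i1 := (hmi 3 1 (by norm_num) (by norm_num)).const_mul 4
  have i2 := (hmi 2 2 (by norm_num) (by norm_num)).const_mul 6
  have i3 := (hmi 1 3 (by norm_num) (by norm_num)).const_mul 4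
  have i4 := hpow hu 4 le_rfl
  have i34 : Integrable (fun ω => 4 * (A ω ^ 1 * u ω ^ 3) + u ω ^ 4) P := i3.add i4
  have i234 : Integrable (fun ω => 6 * (A ω ^ 2 * u ω ^ 2) + (4 * (A ω ^ 1 * u ω ^ 3) + u ω ^ 4)) P :=
    i2.add i34
  have i1234 : Integrable (fun ω => 4 * (A ω ^ 3 * u ω ^ 1) + (6 * (A ω ^ 2 * u ω ^ 2)
      + (4 * (A ω ^ 1 * u ω ^ 3) + u ω ^ 4))) P := i1.add i234
  rw [integral_add (hpow hA 4 le_rfl) i1234, integral_add i1 i234, integral_add i2 i34,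
    integral_add i3 i4, integral_const_mul, integral_const_mul, integral_const_mul,
    hmul 3 1 (by norm_num) (by norm_num), hmul 2 2 (by norm_num) (by norm_num),
    hmul 1 3 (by norm_num) (by norm_num)]
  simp only [pow_one, hA0, hu0]
  ring

/-- Fourth moment bound for sums of centred i.i.d. variables. -/
lemma integral_sum_pow_four_le (hid : ∀ i, IdentDistrib (X i) (X 0) P P) (hind : iIndepFun X P)
    {φ : S → ℝ} (hφm : Measurable φ) (hφ : MemLp (fun ω => φ (X 0 ω)) 4 P)
    (hφ0 : ∫ ω, φ (X 0 ω) ∂P = 0) (n : ℕ) :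
    ∫ ω, (∑ i ∈ Finset.range n, φ (X i ω)) ^ 4 ∂P
      ≤ 3 * n ^ 2 * ∫ ω, φ (X 0 ω) ^ 4 ∂P := by
  have hφi := memLp_comp_of_identDistrib hid hφm.stronglyMeasurable hφ
  have h24 : (2 : ℝ≥0∞) ≤ 4 := by norm_num
  have hφ2 := hφ.mono_exponent h24
  set m4 := ∫ ω, φ (X 0 ω) ^ 4 ∂P with hm4
  set s2 := ∫ ω, φ (X 0 ω) ^ 2 ∂P with hs2
  have hm40 : 0 ≤ m4 := integral_nonneg fun ω => by positivity
  -- The square of the second moment is at most the fourth. The induction then closes through 3n² +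
  -- 6n + 1 ≤ 3(n + 1)².
  have hjen : s2 * s2 ≤ m4 := by
    have h := variance_nonneg (fun ω => φ (X 0 ω) ^ 2) P
    have hL : MemLp (fun ω => φ (X 0 ω) ^ 2) 2 P := by
      refine (memLp_two_iff_integrable_sq (f := fun ω => φ (X 0 ω) ^ 2) (hφ2.1.pow 2)).2 ?_
      refine (integrable_pow_four_of_memLp hφ).congr (Eventually.of_forall fun ω => ?_)
      simp only; ring
    rw [variance_eq_sub hL] at h
    have h2 : ∫ ω, ((fun ω => φ (X 0 ω) ^ 2) ^ 2) ω ∂P = m4 := by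
      refine integral_congr_ae (Eventually.of_forall fun ω => ?_)
      simp only [Pi.pow_apply]; ring
    rw [h2] at h
    nlinarith
  have hsum0 : ∀ n, ∫ ω, ∑ i ∈ Finset.range n, φ (X i ω) ∂P = 0 := fun n => by
    rw [integral_finsetSum _ fun i _ => (hφi i).integrable (by norm_num)]
    simp [integral_comp_of_identDistrib hid hφm.stronglyMeasurable, hφ0]
  have hsum4 : ∀ n, MemLp (fun ω => ∑ i ∈ Finset.range n, φ (X i ω)) 4 P := fun n =>
    memLp_finsetSum _ fun i _ => hφi i
  have hsq : ∀ n : ℕ, ∫ ω, (∑ i ∈ Finset.range n, φ (X i ω)) ^ 2 ∂P = n * s2 := by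
    intro n
    rcases Nat.eq_zero_or_pos n with h0 | h0
    · simp [h0]
    · have hn : (0 : ℝ) < n := by exact_mod_cast h0
      have h := integral_normSum_mul_normSum hid hind hφm hφm hφ2 hφ2 hφ0 h0
      rw [covariance_eq_sub hφ2 hφ2, hφ0] at h
      have e1 : ∀ ω, (∑ i ∈ Finset.range n, φ (X i ω)) ^ 2
          = n * (normSum X φ n ω * normSum X φ n ω) := by
        intro ω
        simp only [normSum, smul_eq_mul]
        rw [mul_mul_mul_comm, ← mul_inv, Real.mul_self_sqrt hn.le, ← mul_assoc,
          mul_inv_cancel₀ hn.ne', one_mul, pow_two]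
      simp only [e1]
      rw [integral_const_mul, h]
      simp [hs2, pow_two]
  induction n with
  | zero => simp
  | succ n ih =>
    have hin : IndepFun (fun ω => ∑ i ∈ Finset.range n, φ (X i ω)) (fun ω => φ (X n ω)) P := by
      have h1 : iIndepFun (fun i ω => φ (X i ω)) P := hind.comp (fun _ => φ) fun _ => hφm
      have h2 := h1.indepFun_finsetSum_of_notMem₀ (fun i => (hφi i).1.aemeasurable)
        (s := Finset.range n) (i := n) (by simp)
      convert! h2 using 1
      ext ω
      simp
    have h := integral_add_pow_four_of_indepFun (hsum4 n) (hφi n) hin (hsum0 n)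
      (by rw [integral_comp_of_identDistrib hid hφm.stronglyMeasurable, hφ0])
    simp only [Finset.sum_range_succ]
    rw [h, hsq n, integral_comp_of_identDistrib hid (φ := fun x => φ x ^ 2)
      (hφm.pow_const 2).stronglyMeasurable, integral_comp_of_identDistrib hid
      (φ := fun x => φ x ^ 4) (hφm.pow_const 4).stronglyMeasurable, ← hs2, ← hm4]
    push_cast
    have hn0 : (0 : ℝ) ≤ n := n.cast_nonneg
    nlinarith [mul_le_mul_of_nonneg_left hjen hn0]

lemma integral_normSum_pow_four_le (hid : ∀ i, IdentDistrib (X i) (X 0) P P)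
    (hind : iIndepFun X P) {φ : S → ℝ} (hφm : Measurable φ)
    (hφ : MemLp (fun ω => φ (X 0 ω)) 4 P) (hφ0 : ∫ ω, φ (X 0 ω) ∂P = 0) {n : ℕ} (hn : 1 ≤ n) :
    ∫ ω, normSum X φ n ω ^ 4 ∂P ≤ 3 * ∫ ω, φ (X 0 ω) ^ 4 ∂P := by
  have hn0 : (0 : ℝ) < n := by exact_mod_cast hn
  have e1 : ∀ ω, normSum X φ n ω ^ 4
      = ((n : ℝ) ^ 2)⁻¹ * (∑ i ∈ Finset.range n, φ (X i ω)) ^ 4 := by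
    intro ω
    simp only [normSum, smul_eq_mul]
    rw [mul_pow, inv_pow, show (√(n : ℝ)) ^ 4 = (√(n : ℝ) ^ 2) ^ 2 by ring, Real.sq_sqrt hn0.le]
  simp only [e1]
  rw [integral_const_mul, inv_mul_le_iff₀ (by positivity)]
  have := integral_sum_pow_four_le hid hind hφm hφ hφ0 n
  linarith

end FourthMoments

/-! ### Tightness, consistency and the delta method -/

section DeltaMethod

variable {Ω : Type*} [MeasurableSpace Ω] {P : Measure Ω}
  {E : Type*} [NormedAddCommGroup E] [NormedSpace ℝ E] {D V : ℕ → Ω → E}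

/-- √l D differs from −V by a term vanishing in probability, so it inherits the tightness of V. -/
lemma exists_prob_scaled_le
    (h : TendstoInMeasure P (fun (l : ℕ) ω => √(l : ℝ) • D l ω + V l ω) atTop fun _ => 0)
    (hV : ∀ η : ℝ, 0 < η → ∃ B : ℝ, 0 < B ∧ ∀ n, 1 ≤ n → P {ω | B ≤ ‖V n ω‖} ≤ ENNReal.ofReal η)
    {η : ℝ} (hη : 0 < η) :
    ∃ B : ℝ, 0 < B ∧ ∀ᶠ l : ℕ in atTop, P {ω | B ≤ ‖√(l : ℝ) • D l ω‖} ≤ ENNReal.ofReal η := by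
  obtain ⟨B, hB, hVB⟩ := hV (η / 2) (half_pos hη)
  refine ⟨2 * B, by positivity, ?_⟩
  have h1 := (ENNReal.tendsto_nhds_zero.1 (tendstoInMeasure_iff_norm.1 h B hB))
    (ENNReal.ofReal (η / 2)) (by simpa using hη)
  filter_upwards [h1, eventually_ge_atTop 1] with l hl hl1
  have hsub : {ω | 2 * B ≤ ‖√(l : ℝ) • D l ω‖}
      ⊆ {ω | B ≤ ‖√(l : ℝ) • D l ω + V l ω - 0‖} ∪ {ω | B ≤ ‖V l ω‖} := by
    intro ω hω
    by_contra hcon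
    simp only [Set.mem_union, Set.mem_ofPred_eq, not_or, not_le, sub_zero] at hcon hω
    have : ‖√(l : ℝ) • D l ω‖ ≤ ‖√(l : ℝ) • D l ω + V l ω‖ + ‖V l ω‖ := by
      simpa using norm_sub_le (√(l : ℝ) • D l ω + V l ω) (V l ω)
    linarith [hcon.1, hcon.2]
  calc P {ω | 2 * B ≤ ‖√(l : ℝ) • D l ω‖}
      ≤ ENNReal.ofReal (η / 2) + ENNReal.ofReal (η / 2) :=
        (measure_mono hsub).trans ((measure_union_le _ _).trans (add_le_add hl (hVB l hl1)))
    _ = ENNReal.ofReal η := by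
        rw [← ENNReal.ofReal_add (by positivity) (by positivity), add_halves]

lemma exists_ofReal_le {η : ℝ≥0∞} (hη : 0 < η) : ∃ η' : ℝ, 0 < η' ∧ ENNReal.ofReal η' ≤ η := by
  rcases eq_or_ne η ⊤ with h | h
  · exact ⟨1, one_pos, by simp [h]⟩
  · exact ⟨η.toReal, ENNReal.toReal_pos hη.ne' h, ENNReal.ofReal_toReal_le⟩

/-- An estimator whose rescaled error is bounded in probability is consistent. -/
lemma tendstoInMeasure_error
    (h : TendstoInMeasure P (fun (l : ℕ) ω => √(l : ℝ) • D l ω + V l ω) atTop fun _ => 0)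
    (hV : ∀ η : ℝ, 0 < η → ∃ B : ℝ, 0 < B ∧ ∀ n, 1 ≤ n → P {ω | B ≤ ‖V n ω‖} ≤ ENNReal.ofReal η) :
    TendstoInMeasure P D atTop fun _ => 0 := by
  rw [tendstoInMeasure_iff_norm]
  intro ε hε
  rw [ENNReal.tendsto_nhds_zero]
  intro η hη
  obtain ⟨η', hη', hle⟩ := exists_ofReal_le hη
  obtain ⟨B, hB, hDB⟩ := exists_prob_scaled_le h hV hη'
  have hs : Tendsto (fun l : ℕ => √(l : ℝ)) atTop atTop :=
    Real.tendsto_sqrt_atTop.comp tendsto_natCast_atTop_atTop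
  filter_upwards [hDB, hs.eventually_ge_atTop (B / ε)] with l hl hls
  refine (measure_mono fun ω hω => ?_).trans (hl.trans hle)
  simp only [Set.mem_ofPred_eq, sub_zero] at hω ⊢
  rw [norm_smul, Real.norm_of_nonneg (Real.sqrt_nonneg _)]
  calc B = B / ε * ε := by field_simp
    _ ≤ √(l : ℝ) * ‖D l ω‖ := by gcongr

/-- The delta method. -/
lemma tendstoInMeasure_delta
    (h : TendstoInMeasure P (fun (l : ℕ) ω => √(l : ℝ) • D l ω + V l ω) atTop fun _ => 0)
    (hV : ∀ η : ℝ, 0 < η → ∃ B : ℝ, 0 < B ∧ ∀ n, 1 ≤ n → P {ω | B ≤ ‖V n ω‖} ≤ ENNReal.ofReal η)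
    {R : E → ℝ} {R' : E →L[ℝ] ℝ} {θ : E} (hR : HasFDerivAt R R' θ) :
    TendstoInMeasure P (fun (l : ℕ) ω => √(l : ℝ) * (R (θ + D l ω) - R θ) + R' (V l ω)) atTop
      fun _ => 0 := by
  rw [tendstoInMeasure_iff_norm]
  intro ε hε
  rw [ENNReal.tendsto_nhds_zero]
  intro η hη
  obtain ⟨η', hη', hle⟩ := exists_ofReal_le hη
  obtain ⟨B, hB, hDB⟩ := exists_prob_scaled_le h hV (half_pos hη')
  have hs : Tendsto (fun l : ℕ => √(l : ℝ)) atTop atTop :=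
    Real.tendsto_sqrt_atTop.comp tendsto_natCast_atTop_atTop
  -- With ‖√l D‖ < B the differentiability remainder, multiplied by √l, is at most ε/2. Requiring √l
  -- > B/δ puts D in the ball where this estimate holds.
  have hκ : 0 < ε / (2 * B) := by positivity
  have hlit := (hasFDerivAt_iff_isLittleO_nhds_zero.1 hR).def hκ
  obtain ⟨δ, hδ, hball⟩ := Metric.eventually_nhds_iff.1 hlit
  set ε' := ε / (2 * (‖R'‖ + 1)) with hε'
  have hε'0 : 0 < ε' := by positivity
  have h1 := (ENNReal.tendsto_nhds_zero.1 (tendstoInMeasure_iff_norm.1 h ε' hε'0))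
    (ENNReal.ofReal (η' / 2)) (by simpa using hη')
  filter_upwards [hDB, hs.eventually_gt_atTop (B / δ), h1] with l hl hls hl1
  have hs0 : 0 < √(l : ℝ) := lt_trans (by positivity) hls
  have hsub : {ω | ε ≤ ‖√(l : ℝ) * (R (θ + D l ω) - R θ) + R' (V l ω) - 0‖}
      ⊆ {ω | B ≤ ‖√(l : ℝ) • D l ω‖} ∪ {ω | ε' ≤ ‖√(l : ℝ) • D l ω + V l ω - 0‖} := by
    intro ω hω
    by_contra hcon
    simp only [Set.mem_union, Set.mem_ofPred_eq, not_or, not_le, sub_zero] at hcon hω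
    obtain ⟨hc1, hc2⟩ := hcon
    have hn : ‖√(l : ℝ) • D l ω‖ = √(l : ℝ) * ‖D l ω‖ := by
      rw [norm_smul, Real.norm_of_nonneg hs0.le]
    have hD : ‖D l ω‖ < δ := by
      rw [hn] at hc1
      rw [div_lt_iff₀ hδ] at hls
      by_contra hge
      push Not at hge
      nlinarith
    have hrem := hball (y := D l ω) (by simpa using hD)
    have h2 : √(l : ℝ) * (R (θ + D l ω) - R θ) + R' (V l ω)
        = √(l : ℝ) * (R (θ + D l ω) - R θ - R' (D l ω)) + R' (√(l : ℝ) • D l ω + V l ω) := by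
      rw [map_add, map_smul, smul_eq_mul]; ring
    have h3 : ‖√(l : ℝ) * (R (θ + D l ω) - R θ - R' (D l ω))‖ ≤ ε / 2 := by
      rw [norm_mul, Real.norm_of_nonneg hs0.le]
      calc √(l : ℝ) * ‖R (θ + D l ω) - R θ - R' (D l ω)‖
          ≤ √(l : ℝ) * (ε / (2 * B) * ‖D l ω‖) := by gcongr
        _ = ε / (2 * B) * ‖√(l : ℝ) • D l ω‖ := by rw [hn]; ring
        _ ≤ ε / (2 * B) * B := by gcongr
        _ = ε / 2 := by field_simp
    have h4 : ‖R' (√(l : ℝ) • D l ω + V l ω)‖ < ε / 2 := by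
      calc ‖R' (√(l : ℝ) • D l ω + V l ω)‖ ≤ ‖R'‖ * ‖√(l : ℝ) • D l ω + V l ω‖ := R'.le_opNorm _
        _ ≤ (‖R'‖ + 1) * ‖√(l : ℝ) • D l ω + V l ω‖ := by gcongr; linarith
        _ < (‖R'‖ + 1) * ε' := by gcongr
        _ = ε / 2 := by rw [hε']; field_simp
    rw [h2] at hω
    linarith [norm_add_le (√(l : ℝ) * (R (θ + D l ω) - R θ - R' (D l ω)))
      (R' (√(l : ℝ) • D l ω + V l ω))]
  calc _ ≤ ENNReal.ofReal (η' / 2) + ENNReal.ofReal (η' / 2) :=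
        (measure_mono hsub).trans ((measure_union_le _ _).trans (add_le_add hl hl1))
    _ = ENNReal.ofReal η' := by
        rw [← ENNReal.ofReal_add (by positivity) (by positivity), add_halves]
    _ ≤ η := hle

end DeltaMethod

/-! ### Moment bounds from norms, and Cauchy-Schwarz -/

section MomentsFromNorms

variable {Ω : Type*} [MeasurableSpace Ω] {P : Measure Ω}

lemma integral_norm_pow_le_of_eLpNorm_le {f : Ω → ℝ} {k : ℕ} (hk : k ≠ 0) {C : ℝ≥0}
    (hf : MemLp f k P) (h : eLpNorm f k P ≤ C) : ∫ ω, ‖f ω‖ ^ k ∂P ≤ C ^ k := by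
  have hk0 : (k : ℝ≥0∞) ≠ 0 := by exact_mod_cast hk
  rw [hf.eLpNorm_eq_integral_rpow_norm hk0 (ENNReal.natCast_ne_top k)] at h
  have hI : 0 ≤ ∫ ω, ‖f ω‖ ^ k ∂P := integral_nonneg fun ω => by positivity
  simp only [ENNReal.toReal_natCast, Real.rpow_natCast] at h
  have h2 : (∫ ω, ‖f ω‖ ^ k ∂P) ^ ((k : ℝ)⁻¹) ≤ C := by
    have := ENNReal.toReal_mono ENNReal.coe_ne_top h
    rwa [ENNReal.toReal_ofReal (Real.rpow_nonneg hI _), ENNReal.coe_toReal] at this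
  calc ∫ ω, ‖f ω‖ ^ k ∂P = ((∫ ω, ‖f ω‖ ^ k ∂P) ^ ((k : ℝ)⁻¹)) ^ k :=
        (Real.rpow_inv_natCast_pow hI hk).symm
    _ ≤ C ^ k := by gcongr

lemma integral_sq_le_of_eLpNorm_le [IsProbabilityMeasure P] {f : Ω → ℝ} {C : ℝ≥0}
    (hf : MemLp f 4 P) (h : eLpNorm f 4 P ≤ C) : ∫ ω, f ω ^ 2 ∂P ≤ C ^ 2 := by
  have h24 : (2 : ℝ≥0∞) ≤ 4 := by norm_num
  have h2 := integral_norm_pow_le_of_eLpNorm_le (k := 2) two_ne_zero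
    (by exact_mod_cast hf.mono_exponent h24)
    (by exact_mod_cast (eLpNorm_le_eLpNorm_of_exponent_le h24 hf.1).trans h)
  simpa using h2

lemma integral_pow_four_le_of_eLpNorm_le {f : Ω → ℝ} {C : ℝ≥0}
    (hf : MemLp f 4 P) (h : eLpNorm f 4 P ≤ C) : ∫ ω, f ω ^ 4 ∂P ≤ C ^ 4 := by
  have h2 := integral_norm_pow_le_of_eLpNorm_le (k := 4) four_ne_zero
    (by exact_mod_cast hf) (by exact_mod_cast h)
  simp only [Real.norm_eq_abs, (show Even 4 by decide).pow_abs] at h2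
  exact h2

/-- The variance of f + t g is a nonnegative quadratic in t, so its discriminant is nonpositive. -/
lemma covariance_sq_le [IsProbabilityMeasure P] {f g : Ω → ℝ} (hf : MemLp f 2 P)
    (hg : MemLp g 2 P) : covariance f g P ^ 2 ≤ Var[f; P] * Var[g; P] := by
  have h : ∀ t : ℝ, 0 ≤ Var[g; P] * (t * t) + 2 * covariance f g P * t + Var[f; P] := by
    intro t
    have h1 := variance_nonneg (f + fun ω => t * g ω) P
    rw [variance_add hf (hg.const_mul t), variance_const_mul, covariance_const_mul_right] at h1
    linarith
  have := discrim_le_zero h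
  rw [discrim] at this
  nlinarith

end MomentsFromNorms

/-! ### Covariance of an asymptotically linear statistic with a sum -/

section CovarianceLimit

variable {Ω S : Type*} [MeasurableSpace Ω] [MeasurableSpace S] {P : Measure Ω}
  [IsProbabilityMeasure P] {X : ℕ → Ω → S}

/-- The covariance of an asymptotically linear statistic with a sum over the sample. -/
lemma tendsto_covariance_sum (hid : ∀ i, IdentDistrib (X i) (X 0) P P) (hind : iIndepFun X P)
    {φ g : S → ℝ} (hφm : Measurable φ) (hφ : MemLp (fun ω => φ (X 0 ω)) 4 P) (hgm : Measurable g)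
    (hg : MemLp (fun ω => g (X 0 ω)) 2 P) (hg0 : ∫ ω, g (X 0 ω) ∂P = 0) {F : ℕ → Ω → ℝ} {a C : ℝ}
    (hF : TendstoInMeasure P (fun (l : ℕ) ω => √(l : ℝ) * (F l ω - a) + normSum X g l ω) atTop
      fun _ => 0)
    {l : ℕ → ℕ} (hl : Tendsto l atTop atTop)
    (hvar : ∀ᶠ n in atTop, MemLp (F (l n)) 2 P ∧ (l n : ℝ) * Var[F (l n); P] ≤ C) :
    Tendsto (fun n => covariance (fun ω => ∑ i ∈ Finset.range (l n), φ (X i ω)) (F (l n)) P) atTop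
      (𝓝 (-covariance (fun ω => g (X 0 ω)) (fun ω => φ (X 0 ω)) P)) := by
  have h24 : (2 : ℝ≥0∞) ≤ 4 := by norm_num
  have hφ2 := hφ.mono_exponent h24
  set b := ∫ ω, φ (X 0 ω) ∂P with hb
  set ψ : S → ℝ := fun x => φ x - b with hψ
  have hψm : Measurable ψ := hφm.sub_const b
  have hψ4 : MemLp (fun ω => ψ (X 0 ω)) 4 P := hφ.sub (memLp_const b)
  have hψ2 := hψ4.mono_exponent h24
  have hψ0 : ∫ ω, ψ (X 0 ω) ∂P = 0 := by
    simp only [hψ]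
    rw [integral_sub (hφ2.integrable one_le_two) (integrable_const _)]
    simp [hb]
  set T : ℕ → Ω → ℝ := fun n => normSum X ψ (l n) with hT
  -- The variance bound controls F only around its own mean, whereas the expansion is around a. The
  -- rescaled bias c is bounded by `exists_integral_sq_add_const_le`.
  set Z : ℕ → Ω → ℝ := fun n ω => √(l n : ℝ) * (F (l n) ω - ∫ ω, F (l n) ω ∂P)
    + normSum X g (l n) ω with hZ
  set c : ℕ → ℝ := fun n => √(l n : ℝ) * (∫ ω, F (l n) ω ∂P - a) with hc
  have hl1 : ∀ᶠ n in atTop, 1 ≤ l n := hl.eventually_ge_atTop 1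
  have hYm : ∀ n, MemLp (F (l n)) 2 P →
      MemLp (fun ω => √(l n : ℝ) * (F (l n) ω - ∫ ω, F (l n) ω ∂P)) 2 P := fun n h =>
    (h.sub (memLp_const _)).const_mul _
  have hVm : ∀ n, MemLp (normSum X g n) 2 P := memLp_normSum hid hgm.stronglyMeasurable hg
  have hTm : ∀ n, MemLp (T n) 4 P := fun n => memLp_normSum hid hψm.stronglyMeasurable hψ4 _
  have hZb : ∀ᶠ n in atTop, MemLp (Z n) 2 P ∧ ∫ ω, Z n ω ^ 2 ∂P
      ≤ 2 * C + 2 * Var[fun ω => g (X 0 ω); P] := by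
    filter_upwards [hvar, hl1] with n ⟨hn, hCn⟩ hln
    refine ⟨(hYm n hn).add (hVm _), (integral_sq_add_le (hYm n hn) (hVm _)).trans ?_⟩
    have e1 : ∫ ω, (√(l n : ℝ) * (F (l n) ω - ∫ ω, F (l n) ω ∂P)) ^ 2 ∂P
        = l n * Var[F (l n); P] := by
      rw [variance_eq_integral hn.1.aemeasurable, ← integral_const_mul]
      refine integral_congr_ae (Eventually.of_forall fun ω => ?_)
      simp only
      rw [mul_pow, Real.sq_sqrt (Nat.cast_nonneg _)]
    have e2 : ∫ ω, normSum X g (l n) ω ^ 2 ∂P = Var[fun ω => g (X 0 ω); P] := by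
      rw [← covariance_self hg.1.aemeasurable,
        ← integral_normSum_mul_normSum hid hind hgm hgm hg hg hg0 hln]
      simp only [pow_two]
    rw [e1, e2]
    linarith
  have hZc : TendstoInMeasure P (fun n ω => Z n ω + c n) atTop fun _ => 0 := by
    intro ε hε
    refine ((hF ε hε).comp hl).congr fun n => ?_
    simp only [Function.comp, hZ, hc]
    congr 1
    ext ω
    simp only [Set.mem_ofPred_eq]
    rw [show √(l n : ℝ) * (F (l n) ω - ∫ ω, F (l n) ω ∂P) + normSum X g (l n) ω
      + √(l n : ℝ) * (∫ ω, F (l n) ω ∂P - a)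
      = √(l n : ℝ) * (F (l n) ω - a) + normSum X g (l n) ω by ring]
  obtain ⟨C', hC'⟩ := exists_integral_sq_add_const_le hZb hZc
  have hTb : ∀ᶠ n in atTop, MemLp (T n) 4 P ∧ ∫ ω, T n ω ^ 4 ∂P
      ≤ max C' (3 * ∫ ω, ψ (X 0 ω) ^ 4 ∂P) := by
    filter_upwards [hl1] with n hn
    exact ⟨hTm n, (integral_normSum_pow_four_le hid hind hψm hψ4 hψ0 hn).trans (le_max_right _ _)⟩
  have hlim := tendsto_integral_mul_of_tendstoInMeasure hTb
    (hC'.mono fun n hn => ⟨hn.1, hn.2.trans (le_max_left _ _)⟩) hZc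
  -- As T is centred, the constant c drops out: the integral is the covariance sought plus the exact
  -- covariance of g and φ.
  have hfin : ∀ᶠ n in atTop, ∫ ω, T n ω * (Z n ω + c n) ∂P
      - covariance (fun ω => g (X 0 ω)) (fun ω => φ (X 0 ω)) P
      = covariance (fun ω => ∑ i ∈ Finset.range (l n), φ (X i ω)) (F (l n)) P := by
    filter_upwards [hvar, hl1] with n ⟨hn, _⟩ hln
    have hTm2 := (hTm n).mono_exponent h24
    have hln0 : (0 : ℝ) < l n := by exact_mod_cast hln
    have hs0 : √(l n : ℝ) ≠ 0 := (Real.sqrt_pos.2 hln0).ne'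
    have i1 : Integrable (fun ω => T n ω * (√(l n : ℝ) * (F (l n) ω - ∫ ω, F (l n) ω ∂P))) P :=
      hTm2.integrable_mul (hYm n hn)
    have i2 : Integrable (fun ω => T n ω * normSum X g (l n) ω) P := hTm2.integrable_mul (hVm _)
    have i3 : Integrable (fun ω => T n ω * c n) P := (hTm2.integrable one_le_two).mul_const _
    have i23 : Integrable (fun ω => T n ω * normSum X g (l n) ω + T n ω * c n) P := i2.add i3
    have e1 : ∫ ω, T n ω * (Z n ω + c n) ∂P
        = ∫ ω, T n ω * (√(l n : ℝ) * (F (l n) ω - ∫ ω, F (l n) ω ∂P)) ∂P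
          + (∫ ω, T n ω * normSum X g (l n) ω ∂P + ∫ ω, T n ω * c n ∂P) := by
      rw [← integral_add i2 i3, ← integral_add i1 i23]
      refine integral_congr_ae (Eventually.of_forall fun ω => ?_)
      simp only [hZ]
      ring
    have e2 : ∫ ω, T n ω * normSum X g (l n) ω ∂P
        = covariance (fun ω => g (X 0 ω)) (fun ω => φ (X 0 ω)) P := by
      rw [integral_normSum_mul_normSum hid hind hψm hgm hψ2 hg hψ0 hln, covariance_comm,
        covariance_sub_const_right (hφ2.integrable one_le_two)]
    have e3 : ∫ ω, T n ω * c n ∂P = 0 := by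
      rw [integral_mul_const, integral_normSum hid hψm.stronglyMeasurable
        (hψ2.integrable one_le_two) hψ0, zero_mul]
    have e4 : covariance (fun ω => ∑ i ∈ Finset.range (l n), φ (X i ω)) (F (l n)) P
        = ∫ ω, T n ω * (√(l n : ℝ) * (F (l n) ω - ∫ ω, F (l n) ω ∂P)) ∂P := by
      have hφi := memLp_comp_of_identDistrib hid hφm.stronglyMeasurable hφ2
      have hmean : ∫ ω, ∑ i ∈ Finset.range (l n), φ (X i ω) ∂P = l n * b := by
        rw [integral_finsetSum _ fun i _ => (hφi i).integrable one_le_two]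
        simp [integral_comp_of_identDistrib hid hφm.stronglyMeasurable, hb]
      rw [covariance, hmean]
      refine integral_congr_ae (Eventually.of_forall fun ω => ?_)
      simp only [hT, normSum, hψ, Finset.sum_sub_distrib, smul_eq_mul, Finset.sum_const,
        Finset.card_range, nsmul_eq_mul]
      field_simp
    rw [e1, e2, e3, e4]
    ring
  have := hlim.sub_const (covariance (fun ω => g (X 0 ω)) (fun ω => φ (X 0 ω)) P)
  rw [zero_sub] at this
  exact this.congr' hfin

end CovarianceLimit

/-! ### Convergence of the average loss -/

section AverageLoss

variable {Ω S E : Type*} [MeasurableSpace Ω] [MeasurableSpace S] [NormedAddCommGroup E]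
  [MeasurableSpace E] {P : Measure Ω}
  [IsProbabilityMeasure P] {X X' : ℕ → Ω → S} {Xt : Ω → S} {L : S → E → ℝ}
  {θhat : (l : ℕ) → (Fin l → S) → E} {θ : E}

/-- Here X 0 serves as test point and the following n observations as training sample, so that the
average loss at X 0 can be compared with an actual loss on Ω. -/
lemma IsIIDWithCopies.measurePreserving_first_shift (hX : IsIIDWithCopies P X X' Xt) (n : ℕ) :
    MeasurePreserving (fun ω => (X 0 ω, fun i : Fin n => X (i + 1) ω)) P
      ((P.map (X 0)).prod (iidLaw (P.map (X 0)) n)) := by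
  have : IsProbabilityMeasure (P.map (X 0)) :=
    Measure.isProbabilityMeasure_map (hX.measurable (Sum.inl 0)).aemeasurable
  have h2 := (measurePreserving_piFinSuccAbove (fun _ : Fin (n + 1) => P.map (X 0)) 0).comp
    (hX.measurePreserving_sample (n + 1))
  convert! h2 using 1

omit [NormedAddCommGroup E] in
lemma avgLoss_eq_integral (hX : IsIIDWithCopies P X X' Xt) (hL : Measurable (Function.uncurry L))
    {l : ℕ} (hf : Measurable (θhat l)) (x : S) :
    avgLoss P X L θhat l x = ∫ z, L x (θhat l z) ∂(iidLaw (P.map (X 0)) l) := by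
  have hmp := hX.measurePreserving_sample l
  rw [← hmp.map_eq, integral_map hmp.measurable.aemeasurable]
  · rfl
  · exact ((measurable_loss_estimator hL hf).comp
      (measurable_const.prodMk measurable_id)).aestronglyMeasurable

omit [NormedAddCommGroup E] in
lemma measurable_avgLoss (hX : IsIIDWithCopies P X X' Xt) (hL : Measurable (Function.uncurry L))
    {l : ℕ} (hf : Measurable (θhat l)) : Measurable (avgLoss P X L θhat l) := by
  have : IsProbabilityMeasure (P.map (X 0)) :=
    Measure.isProbabilityMeasure_map (hX.measurable (Sum.inl 0)).aemeasurable
  have : avgLoss P X L θhat l = fun x => ∫ z, L x (θhat l z) ∂(iidLaw (P.map (X 0)) l) :=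
    funext fun x => avgLoss_eq_integral hX hL hf x
  rw [this]
  exact ((measurable_loss_estimator hL hf).stronglyMeasurable.integral_prod_right').measurable

omit [NormedAddCommGroup E] in
/-- The distance between the average loss and the loss at a fixed parameter. -/
lemma integral_sq_avgLoss_sub_le (hX : IsIIDWithCopies P X X' Xt)
    (hL : Measurable (Function.uncurry L)) {l : ℕ} (hf : Measurable (θhat l))
    (h : MemLp (fun ω => testLoss L θhat l (Xt ω) fun i => X i ω) 2 P)
    (hθ : MemLp (fun ω => L (X 0 ω) θ) 2 P) :
    MemLp (fun ω => avgLoss P X L θhat l (X 0 ω)) 2 P ∧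
    ∫ ω, (avgLoss P X L θhat l (X 0 ω) - L (X 0 ω) θ) ^ 2 ∂P
      ≤ ∫ ω, (L (X 0 ω) (θhat l fun i => X (i + 1) ω) - L (X 0 ω) θ) ^ 2 ∂P := by
  have hX0 : Measurable (X 0) := hX.measurable (Sum.inl 0)
  set μ := P.map (X 0) with hμ
  have : IsProbabilityMeasure μ := Measure.isProbabilityMeasure_map hX0.aemeasurable
  have hLθ : Measurable fun x => L x θ := hL.comp (measurable_id.prodMk measurable_const)
  have hT := measurable_loss_estimator hL hf
  have hT2 := memLp_loss_estimator hX hL hf h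
  have hθμ : MemLp (fun x => L x θ) 2 μ :=
    (memLp_map_measure_iff hLθ.aestronglyMeasurable hX0.aemeasurable).2 hθ
  set G : (Fin l → S) × S → ℝ := fun p => L p.2 (θhat l p.1) - L p.2 θ with hG
  have hswap : MeasurePreserving (Prod.swap : (Fin l → S) × S → S × (Fin l → S))
      ((iidLaw μ l).prod μ) (μ.prod (iidLaw μ l)) := Measure.measurePreserving_swap
  have hTm : Measurable fun p : (Fin l → S) × S => L p.2 (θhat l p.1) := hT.comp measurable_swap
  have hTm2 : MemLp (fun p : (Fin l → S) × S => L p.2 (θhat l p.1)) 2 ((iidLaw μ l).prod μ) :=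
    hT2.comp_measurePreserving hswap
  have hGm : Measurable G := hTm.sub (hLθ.comp measurable_snd)
  have hG2 : MemLp G 2 ((iidLaw μ l).prod μ) := hTm2.sub (hθμ.comp_snd _)
  have havg : (fun x => ∫ z, L x (θhat l z) ∂(iidLaw μ l)) = avgLoss P X L θhat l :=
    funext fun x => (avgLoss_eq_integral hX hL hf x).symm
  have hA2 : MemLp (avgLoss P X L θhat l) 2 μ := by
    rw [← havg]
    exact memLp_integral_fst hTm hTm2
  have hAm := measurable_avgLoss (P := P) hX hL hf
  refine ⟨hA2.comp_measurePreserving ⟨hX0, rfl⟩, ?_⟩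
  have e1 : ∫ ω, (avgLoss P X L θhat l (X 0 ω) - L (X 0 ω) θ) ^ 2 ∂P
      = ∫ x, (∫ z, G (z, x) ∂(iidLaw μ l)) ^ 2 ∂μ := by
    have hm : Measurable fun x => (avgLoss P X L θhat l x - L x θ) ^ 2 :=
      (hAm.sub hLθ).pow_const 2
    rw [← integral_map (f := fun x => (avgLoss P X L θhat l x - L x θ) ^ 2) hX0.aemeasurable
      hm.aestronglyMeasurable]
    refine integral_congr_ae ?_
    filter_upwards [(hTm2.integrable one_le_two).prod_left_ae] with x hx
    simp only [hG]
    rw [integral_sub hx (integrable_const _), avgLoss_eq_integral hX hL hf]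
    simp [hμ]
  have e2 : ∫ ω, (L (X 0 ω) (θhat l fun i => X (i + 1) ω) - L (X 0 ω) θ) ^ 2 ∂P
      = ∫ p, G p ^ 2 ∂((iidLaw μ l).prod μ) := by
    have hmp := (Measure.measurePreserving_swap (μ := μ) (ν := iidLaw μ l)).comp
      (hX.measurePreserving_first_shift l)
    rw [← hmp.map_eq, integral_map hmp.measurable.aemeasurable
      (hGm.pow_const 2).aestronglyMeasurable]
    rfl
  rw [e1, e2]
  exact integral_sq_integral_fst_le hGm hG2

variable [BorelSpace E] [SecondCountableTopology E]

/-- Convergence of the average loss to the loss at the limit of the estimators. -/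
lemma tendsto_avgLoss (hX : IsIIDWithCopies P X X' Xt) (hL : Measurable (Function.uncurry L))
    (hf : ∀ l, Measurable (θhat l))
    (hcons : TendstoInMeasure P (fun l ω => (θhat l fun i => X i ω) - θ) atTop fun _ => 0)
    (hLc : ∀ᵐ ω ∂P, ContinuousAt (L (X 0 ω)) θ) {m : ℕ → ℕ} (hm : Tendsto m atTop atTop) {C : ℝ≥0}
    (hC : ∀ᶠ n in atTop, eLpNorm (fun ω => testLoss L θhat (m n) (Xt ω) fun i => X i ω) 4 P ≤ C) :
    MemLp (fun ω => L (X 0 ω) θ) 4 P ∧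
      Tendsto (fun n => ∫ ω, (avgLoss P X L θhat (m n) (X 0 ω) - L (X 0 ω) θ) ^ 2 ∂P) atTop
        (𝓝 0) := by
  have hX0 : Measurable (X 0) := hX.measurable (Sum.inl 0)
  have hLθ : Measurable fun x => L x θ := hL.comp (measurable_id.prodMk measurable_const)
  have h24 : (2 : ℝ≥0∞) ≤ 4 := by norm_num
  have hsh : ∀ l, Measurable fun ω (i : Fin l) => X (i + 1) ω := fun l =>
    measurable_pi_iff.2 fun i => hX.measurable (Sum.inl (i + 1))
  set A : ℕ → Ω → ℝ := fun n ω => L (X 0 ω) (θhat (m n) fun i => X (i + 1) ω) with hA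
  have hAm : ∀ n, Measurable (A n) := fun n =>
    (measurable_loss_estimator hL (hf _)).comp (hX0.prodMk (hsh _))
  have hcons' : TendstoInMeasure P (fun n ω => (θhat (m n) fun i => X (i + 1) ω) - θ) atTop
      fun _ => 0 := by
    rw [tendstoInMeasure_iff_norm] at hcons ⊢
    intro ε hε
    refine ((hcons ε hε).comp hm).congr fun n => ?_
    have hset : MeasurableSet {z : Fin (m n) → S | ε ≤ ‖θhat (m n) z - θ - 0‖} :=
      measurableSet_le measurable_const (((hf _).sub_const θ).sub_const 0).norm
    have hmp1 := hX.measurePreserving_sample (m n)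
    have hmp2 : MeasurePreserving (fun ω (i : Fin (m n)) => X (i + 1) ω) P
        (iidLaw (P.map (X 0)) (m n)) :=
      hX.measurePreserving_of_injective (e := fun i : Fin (m n) => Sum.inl ((i : ℕ) + 1))
        fun i j hij => by simpa [Fin.ext_iff] using hij
    exact (hmp1.measure_preimage hset.nullMeasurableSet).trans
      (hmp2.measure_preimage hset.nullMeasurableSet).symm
  -- Continuity of the loss at θ holds only almost surely, with no uniformity, so it is applied
  -- along almost surely convergent subsequences.
  have hAsub : ∀ ns : ℕ → ℕ, StrictMono ns → ∃ ns' : ℕ → ℕ, StrictMono ns' ∧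
      ∀ᵐ ω ∂P, Tendsto (fun i => A (ns (ns' i)) ω) atTop (𝓝 (L (X 0 ω) θ)) := by
    intro ns hns
    obtain ⟨ns', hns', hae⟩ := (exists_seq_tendstoInMeasure_atTop_iff (fun n =>
      (((hf _).comp (hsh _)).sub_const θ).aestronglyMeasurable)).1 hcons' ns hns
    refine ⟨ns', hns', ?_⟩
    filter_upwards [hae, hLc] with ω hω hLω
    have h1 : Tendsto (fun i => θhat (m (ns (ns' i))) fun j => X (j + 1) ω) atTop (𝓝 θ) := by
      simpa using hω.add_const θ
    exact hLω.tendsto.comp h1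
  have hAnorm : ∀ n, eLpNorm (A n) 4 P
      = eLpNorm (fun ω => testLoss L θhat (m n) (Xt ω) fun i => X i ω) 4 P := by
    intro n
    have hT := (measurable_loss_estimator hL (hf (m n))).aestronglyMeasurable
      (μ := (P.map (X 0)).prod (iidLaw (P.map (X 0)) (m n)))
    rw [show A n = (fun p : S × (Fin (m n) → S) => L p.1 (θhat (m n) p.2)) ∘
      (fun ω => (X 0 ω, fun i : Fin (m n) => X (i + 1) ω)) from rfl,
      eLpNorm_comp_measurePreserving hT (hX.measurePreserving_first_shift (m n)),
      ← eLpNorm_comp_measurePreserving hT (hX.measurePreserving_test_sample (m n))]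
    rfl
  have hAC : ∀ᶠ n in atTop, eLpNorm (A n) 4 P ≤ C := by
    filter_upwards [hC] with n hn
    rwa [hAnorm n]
  -- Fatou along such a subsequence passes the L⁴ bound to the limiting loss.
  have hθC : eLpNorm (fun ω => L (X 0 ω) θ) 4 P ≤ C := by
    obtain ⟨ns', hns', hae⟩ := hAsub id strictMono_id
    refine (Lp.eLpNorm_lim_le_liminf_eLpNorm (fun i => (hAm (ns' i)).aestronglyMeasurable) _
      hae).trans ?_
    refine liminf_le_of_frequently_le' (Eventually.frequently ?_)
    exact hns'.tendsto_atTop.eventually hAC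
  have hθ4 : MemLp (fun ω => L (X 0 ω) θ) 4 P :=
    ⟨(hLθ.comp hX0).aestronglyMeasurable, hθC.trans_lt ENNReal.coe_lt_top⟩
  refine ⟨hθ4, ?_⟩
  set D : ℕ → Ω → ℝ := fun n ω => A n ω - L (X 0 ω) θ with hD
  have hDP : TendstoInMeasure P D atTop fun _ => 0 := by
    refine (exists_seq_tendstoInMeasure_atTop_iff (fun n =>
      ((hAm n).sub (hLθ.comp hX0)).aestronglyMeasurable)).2 fun ns hns => ?_
    obtain ⟨ns', hns', hae⟩ := hAsub ns hns
    refine ⟨ns', hns', ?_⟩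
    filter_upwards [hae] with ω hω
    simpa using hω.sub_const (L (X 0 ω) θ)
  have hD4 : ∀ᶠ n in atTop, MemLp (D n) 4 P ∧ eLpNorm (D n) 4 P ≤ (C + C : ℝ≥0) := by
    filter_upwards [hAC] with n hn
    have hA4 : MemLp (A n) 4 P := ⟨(hAm n).aestronglyMeasurable, hn.trans_lt ENNReal.coe_lt_top⟩
    refine ⟨hA4.sub hθ4, (eLpNorm_sub_le hA4.1 hθ4.1 (by norm_num)).trans ?_⟩
    rw [ENNReal.coe_add]
    exact add_le_add hn hθC
  -- D is paired with itself: bounded in L⁴ and vanishing in probability, it tends to 0 in L².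
  have hlim := tendsto_integral_mul_of_tendstoInMeasure
    (C := max (((C + C : ℝ≥0) : ℝ) ^ 4) (((C + C : ℝ≥0) : ℝ) ^ 2))
    (hD4.mono fun n hn => ⟨hn.1, (integral_pow_four_le_of_eLpNorm_le hn.1 hn.2).trans
      (le_max_left _ _)⟩)
    (hD4.mono fun n hn => ⟨hn.1.mono_exponent h24, (integral_sq_le_of_eLpNorm_le hn.1 hn.2).trans
      (le_max_right _ _)⟩) hDP
  refine tendsto_of_tendsto_of_tendsto_of_le_of_le' tendsto_const_nhds hlim
    (Eventually.of_forall fun n => integral_nonneg fun ω => sq_nonneg _) ?_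
  filter_upwards [hC] with n hn
  have hm4 : MemLp (fun ω => testLoss L θhat (m n) (Xt ω) fun i => X i ω) 4 P :=
    ⟨((measurable_loss_estimator hL (hf _)).comp
      (hX.measurePreserving_test_sample _).measurable).aestronglyMeasurable,
      hn.trans_lt ENNReal.coe_lt_top⟩
  refine (integral_sq_avgLoss_sub_le hX hL (hf _) (hm4.mono_exponent h24)
    (hθ4.mono_exponent h24)).2.trans (le_of_eq ?_)
  simp only [hD, hA, pow_two]

end AverageLoss

lemma trainedRisk_eq_risk {Ω S E : Type*} [MeasurableSpace Ω] [MeasurableSpace S]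
    [MeasurableSpace E] {P : Measure Ω} {X : ℕ → Ω → S} (hX0 : AEMeasurable (X 0) P) {L : S → E → ℝ}
    (hL : Measurable (Function.uncurry L)) (f : (l : ℕ) → (Fin l → S) → E) (l : ℕ)
    (z : Fin l → S) : trainedRisk (P.map (X 0)) L f l z = risk P X L (f l z) :=
  integral_map hX0 (hL.comp (measurable_id.prodMk measurable_const)).aestronglyMeasurable

/-! ### The limit along one choice of training sizes -/

section CovarianceTerm

variable {Ω S : Type*} [MeasurableSpace Ω] [MeasurableSpace S] {P : Measure Ω}
  [IsProbabilityMeasure P] {X X' : ℕ → Ω → S} {Xt : Ω → S}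
  {E : Type*} [NormedAddCommGroup E] [InnerProductSpace ℝ E] [FiniteDimensional ℝ E]
  [MeasurableSpace E] [BorelSpace E]

/-- The limit of the covariance with the stability term, for asymptotically linear estimators. -/
theorem tendsto_mul_covariance_beta₁ (hX : IsIIDWithCopies P X X' Xt) {L : S → E → ℝ}
    (hL : Measurable (Function.uncurry L)) {θhat : (l : ℕ) → (Fin l → S) → E}
    (hf : ∀ l, Measurable (θhat l))
    (hsymm : ∀ (l : ℕ) (σ : Equiv.Perm (Fin l)) z, θhat l (z ∘ σ) = θhat l z) {θ : E} {ψ : S → E}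
    (hψm : Measurable ψ) (hψ : MemLp (fun ω => ψ (X 0 ω)) 2 P) (hψ0 : ∫ ω, ψ (X 0 ω) ∂P = 0)
    (hlin : TendstoInMeasure P (fun (l : ℕ) ω => √(l : ℝ) • ((θhat l fun i => X i ω) - θ)
      + normSum X ψ l ω) atTop fun _ => 0)
    (hLc : ∀ᵐ ω ∂P, ContinuousAt (L (X 0 ω)) θ) {R' : E →L[ℝ] ℝ}
    (hR : HasFDerivAt (risk P X L) R' θ) {l m : ℕ → ℕ} (hl : Tendsto l atTop atTop)
    (hm : Tendsto m atTop atTop) {C : ℝ≥0}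
    (hlC : ∀ᶠ n in atTop, eLpNorm (fun ω => testLoss L θhat (l n) (Xt ω) fun i => X i ω) 4 P ≤ C)
    (hmC : ∀ᶠ n in atTop, eLpNorm (fun ω => testLoss L θhat (m n) (Xt ω) fun i => X i ω) 4 P ≤ C)
    (hβC : ∀ᶠ n in atTop, (l n : ℝ≥0∞) *
      eLpNorm (P[beta₁ X X' Xt L θhat (l n) | sigmaProcess X]) 4 P ≤ C) :
    Tendsto (fun n => (l n : ℝ) * covariance (fun ω => avgLoss P X L θhat (m n) (X 0 ω))
      (P[beta₁ X X' Xt L θhat (l n) | sigmaFirst X]) P) atTop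
      (𝓝 (-covariance (fun ω => R' (ψ (X 0 ω))) (fun ω => L (X 0 ω) θ) P)) := by
  have hX0 : Measurable (X 0) := hX.measurable (Sum.inl 0)
  have hid := hX.identDistrib_left
  have hind := hX.indep_left
  have h24 : (2 : ℝ≥0∞) ≤ 4 := by norm_num
  have hLθ : Measurable fun x => L x θ := hL.comp (measurable_id.prodMk measurable_const)
  have htight : ∀ η : ℝ, 0 < η → ∃ B : ℝ, 0 < B ∧ ∀ n, 1 ≤ n →
      P {ω | B ≤ ‖normSum X ψ n ω‖} ≤ ENNReal.ofReal η := fun η hη =>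
    exists_prob_normSum_le hid hind hψm.stronglyMeasurable hψ hψ0 hη
  have hcons := tendstoInMeasure_error hlin htight
  obtain ⟨hθ4, hAm⟩ := tendsto_avgLoss hX hL hf hcons hLc hm hmC
  have hθ2 := hθ4.mono_exponent h24
  have hT4 : ∀ l : ℕ, eLpNorm (fun ω => testLoss L θhat l (Xt ω) fun i => X i ω) 4 P ≤ C →
      MemLp (fun ω => testLoss L θhat l (Xt ω) fun i => X i ω) 4 P := fun l h =>
    ⟨((measurable_loss_estimator hL (hf _)).comp
      (hX.measurePreserving_test_sample _).measurable).aestronglyMeasurable,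
      h.trans_lt ENNReal.coe_lt_top⟩
  set F : ℕ → Ω → ℝ := fun l ω => trainedRisk (P.map (X 0)) L θhat l fun i => X i ω with hF
  have hl1 : ∀ᶠ n in atTop, 1 ≤ l n := hl.eventually_ge_atTop 1
  -- Efron-Stein bounds l Var F by the second moment of l · E[β₁ | X], which H₃ controls.
  have hvar : ∀ᶠ n in atTop, MemLp (F (l n)) 2 P ∧ (l n : ℝ) * Var[F (l n); P] ≤ C ^ 2 := by
    filter_upwards [hlC, hβC, hl1] with n h1 h2 h3
    have hT2 := (hT4 _ h1).mono_exponent h24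
    refine ⟨(memLp_trainedRisk hX hL (hf _) hT2).comp_measurePreserving
      (hX.measurePreserving_sample _), ?_⟩
    have hv := variance_trainedRisk_le hX hL h3 (hf _) (hsymm _) hT2
    have hb4 : MemLp (P[beta₁ X X' Xt L θhat (l n) | sigmaProcess X]) 4 P :=
      (memLp_beta₁ hX hL (hf _) (hT4 _ h1)).condExp (by norm_num)
    have h4 := integral_sq_le_of_eLpNorm_le (C := C) (hb4.const_smul (l n : ℝ)) (by
      rw [eLpNorm_const_smul]
      simpa [enorm] using h2)
    have h5 : ∫ ω, ((l n : ℝ) • P[beta₁ X X' Xt L θhat (l n) | sigmaProcess X]) ω ^ 2 ∂P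
        = l n * (l n * ∫ ω, (P[beta₁ X X' Xt L θhat (l n) | sigmaProcess X]) ω ^ 2 ∂P) := by
      rw [← mul_assoc, ← integral_const_mul]
      refine integral_congr_ae (Eventually.of_forall fun ω => ?_)
      simp only [Pi.smul_apply, smul_eq_mul]
      ring
    rw [h5] at h4
    exact (mul_le_mul_of_nonneg_left hv (Nat.cast_nonneg _)).trans h4
  have hdelta : TendstoInMeasure P (fun (l : ℕ) ω => √(l : ℝ) * (F l ω - risk P X L θ)
      + normSum X (fun x => R' (ψ x)) l ω) atTop fun _ => 0 := by
    refine (tendstoInMeasure_delta hlin htight hR).congr (fun l => ?_) (ae_eq_refl _)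
    refine Eventually.of_forall fun ω => ?_
    simp only [hF, trainedRisk_eq_risk hX0.aemeasurable hL, normSum, map_smul, map_sum,
      add_sub_cancel]
  have hg0 : ∫ ω, R' (ψ (X 0 ω)) ∂P = 0 := by
    rw [R'.integral_comp_comm (hψ.integrable one_le_two), hψ0, map_zero]
  have hmain := tendsto_covariance_sum hid hind hLθ hθ4 (R'.continuous.measurable.comp hψm)
    (R'.comp_memLp' hψ) hg0 hdelta hl hvar
  -- The error of replacing the average loss by the loss at θ: its normalised sum has variance at
  -- most the squared L² distance, which tends to 0, while l Var F stays bounded.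
  have hsmall : Tendsto (fun n => (l n : ℝ) *
      covariance (fun ω => avgLoss P X L θhat (m n) (X 0 ω) - L (X 0 ω) θ)
      (P[beta₁ X X' Xt L θhat (l n) | sigmaFirst X]) P) atTop (𝓝 0) := by
    have hsq : Tendsto (fun n => ((l n : ℝ) *
        covariance (fun ω => avgLoss P X L θhat (m n) (X 0 ω) - L (X 0 ω) θ)
        (P[beta₁ X X' Xt L θhat (l n) | sigmaFirst X]) P) ^ 2) atTop (𝓝 0) := by
      have hub : Tendsto (fun n => (∫ ω, (avgLoss P X L θhat (m n) (X 0 ω) - L (X 0 ω) θ) ^ 2 ∂P)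
          * (C : ℝ) ^ 2) atTop (𝓝 0) := by simpa using hAm.mul_const ((C : ℝ) ^ 2)
      refine tendsto_of_tendsto_of_tendsto_of_le_of_le' tendsto_const_nhds hub
        (Eventually.of_forall fun n => sq_nonneg _) ?_
      filter_upwards [hlC, hmC, hl1, hvar] with n h1 h2 h3 h4
      have hd2 : MemLp (fun ω => avgLoss P X L θhat (m n) (X 0 ω) - L (X 0 ω) θ) 2 P :=
        (integral_sq_avgLoss_sub_le hX hL (hf _) ((hT4 _ h2).mono_exponent h24) hθ2).1.sub hθ2
      have hdm : Measurable fun x => avgLoss P X L θhat (m n) x - L x θ :=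
        (measurable_avgLoss hX hL (hf _)).sub hLθ
      rw [mul_covariance_condExp_beta₁ (φ := fun x => avgLoss P X L θhat (m n) x - L x θ) hX hL h3
        (hf _) (hsymm _) ((hT4 _ h1).mono_exponent h24) hdm hd2]
      have hl0 : (0 : ℝ) < l n := by exact_mod_cast h3
      have hs0 : √(l n : ℝ) ≠ 0 := (Real.sqrt_pos.2 hl0).ne'
      have e1 : covariance (fun ω => ∑ i ∈ Finset.range (l n),
          (avgLoss P X L θhat (m n) (X i ω) - L (X i ω) θ)) (F (l n)) P
          = √(l n : ℝ) * covariance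
            (normSum X (fun x => avgLoss P X L θhat (m n) x - L x θ) (l n)) (F (l n)) P := by
        rw [← covariance_const_mul_left]
        congr 1
        ext ω
        simp only [normSum, smul_eq_mul]
        rw [← mul_assoc, mul_inv_cancel₀ hs0, one_mul]
      have hns := memLp_normSum hid hdm.stronglyMeasurable hd2 (l n)
      have e2 : Var[normSum X (fun x => avgLoss P X L θhat (m n) x - L x θ) (l n); P]
          ≤ ∫ ω, (avgLoss P X L θhat (m n) (X 0 ω) - L (X 0 ω) θ) ^ 2 ∂P := by
        rw [← covariance_self hns.1.aemeasurable, covariance_normSum hid hind hdm hdm hd2 hd2 h3,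
          covariance_self hd2.1.aemeasurable]
        exact variance_le_expectation_sq hd2.1
      have hsum_eq : (fun ω => ∑ i ∈ Finset.range (l n),
          (fun x => avgLoss P X L θhat (m n) x - L x θ) (X i ω)) = fun ω =>
          ∑ i ∈ Finset.range (l n), (avgLoss P X L θhat (m n) (X i ω) - L (X i ω) θ) := rfl
      rw [hsum_eq, e1, mul_pow, Real.sq_sqrt hl0.le]
      calc (l n : ℝ) * covariance (normSum X (fun x => avgLoss P X L θhat (m n) x - L x θ) (l n))
            (F (l n)) P ^ 2
          ≤ l n * (Var[normSum X (fun x => avgLoss P X L θhat (m n) x - L x θ) (l n); P]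
            * Var[F (l n); P]) := by
            gcongr
            exact covariance_sq_le hns h4.1
        _ = Var[normSum X (fun x => avgLoss P X L θhat (m n) x - L x θ) (l n); P]
            * (l n * Var[F (l n); P]) := by ring
        _ ≤ _ := mul_le_mul e2 h4.2 (mul_nonneg hl0.le (variance_nonneg _ _))
            (integral_nonneg fun ω => sq_nonneg _)
    have := (Real.continuous_sqrt.tendsto 0).comp hsq
    rw [Real.sqrt_zero] at this
    rw [tendsto_zero_iff_abs_tendsto_zero]
    exact this.congr fun n => by simp [Function.comp, Real.sqrt_sq_eq_abs]
  have hsum := hsmall.add hmain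
  rw [zero_add] at hsum
  refine hsum.congr' ?_
  filter_upwards [hlC, hmC, hl1] with n h1 h2 h3
  have hT2 := (hT4 _ h1).mono_exponent h24
  have hm2 := (integral_sq_avgLoss_sub_le hX hL (hf _) ((hT4 _ h2).mono_exponent h24) hθ2).1
  have hb2 : MemLp (P[beta₁ X X' Xt L θhat (l n) | sigmaFirst X]) 2 P :=
    (memLp_beta₁ hX hL (hf _) hT2).condExp one_le_two
  rw [← mul_covariance_condExp_beta₁ hX hL h3 (hf _) (hsymm _) hT2 hLθ hθ2,
    covariance_fun_sub_left hm2 hθ2 hb2]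
  ring

end CovarianceTerm

/-! ### Uniformity over the training sizes -/

section TrainSizes

lemma tendsto_sub_div_atTop {K : ℕ → ℕ} (hK : ∀ᶠ n in atTop, 2 ≤ K n) :
    Tendsto (fun n => n - n / K n) atTop atTop := by
  rw [tendsto_atTop]
  intro b
  filter_upwards [hK, eventually_ge_atTop (2 * b)] with n hn hb
  have : n / K n ≤ n / 2 := Nat.div_le_div_left hn two_pos
  omega

lemma tendsto_sub_ceilDiv_atTop {K : ℕ → ℕ} (hK : ∀ᶠ n in atTop, 2 ≤ K n) :
    Tendsto (fun n => n - n ⌈/⌉ K n) atTop atTop := by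
  rw [tendsto_atTop]
  intro b
  filter_upwards [hK, eventually_ge_atTop (2 * b + 1)] with n hn hb
  have h1 : n ⌈/⌉ K n ≤ (n + 1) / 2 := by
    rw [ceilDiv_le_iff_le_mul (by omega)]
    calc n ≤ 2 * ((n + 1) / 2) := by omega
      _ ≤ K n * ((n + 1) / 2) := Nat.mul_le_mul_right _ hn
  omega

variable {Ω S Y : Type*} [MeasurableSpace Ω] [MeasurableSpace S] {P : Measure Ω}
  {X X' : ℕ → Ω → S} {Xt : Ω → S} {L : S → Y → ℝ} {f : (l : ℕ) → (Fin l → S) → Y} {K : ℕ → ℕ}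

/-- The covariance term is the common limit along all selections of training sizes. -/
lemma isCovarianceTerm_iff_of_tendsto {c : ℝ}
    (h : ∀ l m : ℕ → ℕ, (∀ n, l n ∈ trainSizes K n) → (∀ n, m n ∈ trainSizes K n) →
      Tendsto (fun n => (l n : ℝ) * covariance (fun ω => avgLoss P X L f (m n) (X 0 ω))
        (P[beta₁ X X' Xt L f (l n) | sigmaFirst X]) P) atTop (𝓝 c)) (ρ : ℝ) :
    IsCovarianceTerm P X X' Xt L f K ρ ↔ ρ = c := by
  set v : ℕ → ℕ → ℝ := fun l m => (l : ℝ) * covariance (fun ω => avgLoss P X L f m (X 0 ω))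
        (P[beta₁ X X' Xt L f l | sigmaFirst X]) P with hv
  set a : ℕ → ℕ := fun n => n - n / K n with ha
  set b : ℕ → ℕ := fun n => n - n ⌈/⌉ K n with hb
  have hmem : ∀ n l, l ∈ trainSizes K n ↔ l = a n ∨ l = b n := fun n l => by
    simp [trainSizes, ha, hb]
  have haK : ∀ n, a n ∈ trainSizes K n := fun n => (hmem n _).2 (Or.inl rfl)
  have hbK : ∀ n, b n ∈ trainSizes K n := fun n => (hmem n _).2 (Or.inr rfl)
  constructor
  · rintro ⟨ε, hε, hbound⟩
    have h1 : Tendsto (fun n => v (a n) (a n) - ρ) atTop (𝓝 0) :=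
      squeeze_zero_norm (fun n => hbound n _ (haK n) _ (haK n)) hε
    have h2 := (h a a haK haK).sub_const ρ
    have := tendsto_nhds_unique h1 h2
    linarith
  · rintro rfl
    have habs : ∀ l m : ℕ → ℕ, (∀ n, l n ∈ trainSizes K n) → (∀ n, m n ∈ trainSizes K n) →
        Tendsto (fun n => |v (l n) (m n) - ρ|) atTop (𝓝 0) := fun l m hl hm => by
      simpa using ((h l m hl hm).sub_const ρ).abs
    -- Only four pairs of sizes occur for each n, so the sum of their four errors bounds them all.
    refine ⟨fun n => |v (a n) (a n) - ρ| + |v (a n) (b n) - ρ| + |v (b n) (a n) - ρ|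
      + |v (b n) (b n) - ρ|, ?_, fun n l₁ h₁ l₂ h₂ => ?_⟩
    · simpa using (((habs a a haK haK).add (habs a b haK hbK)).add (habs b a hbK haK)).add
        (habs b b hbK hbK)
    · change |v l₁ l₂ - ρ| ≤ _
      have k1 := abs_nonneg (v (a n) (a n) - ρ)
      have k2 := abs_nonneg (v (a n) (b n) - ρ)
      have k3 := abs_nonneg (v (b n) (a n) - ρ)
      have k4 := abs_nonneg (v (b n) (b n) - ρ)
      rcases (hmem n l₁).1 h₁ with rfl | rfl <;> rcases (hmem n l₂).1 h₂ with rfl | rfl <;> linarith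

end TrainSizes

end CrossVal

/-! ### The proposition -/

theorem mainTheorem6 {Ω S : Type*} [MeasurableSpace Ω] [MeasurableSpace S]
    (P : Measure Ω) [IsProbabilityMeasure P] {d : ℕ}
    (X X' : ℕ → Ω → S) (Xt : Ω → S)
    (hX : CrossVal.IsIIDWithCopies P X X' Xt)
    (K : ℕ → ℕ) (hK : Monotone K) (hK2 : ∀ᶠ n in atTop, 2 ≤ K n ∧ K n ≤ n)
    -- the training loss, its estimators and the population minimiser
    (Ψ : S → EuclideanSpace ℝ (Fin d) → ℝ)
    (hΨm : Measurable (Function.uncurry Ψ))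
    (hΨconv : ∀ x, StrictConvexOn ℝ Set.univ (Ψ x))
    (hΨdiff : ∀ x, Differentiable ℝ (Ψ x) ∧ Differentiable ℝ (gradient (Ψ x)))
    (hΨint : ∀ θ, Integrable (fun ω => Ψ (X 0 ω) θ) P)
    (θhat : (l : ℕ) → (Fin l → S) → EuclideanSpace ℝ (Fin d))
    (hθm : ∀ l, Measurable (θhat l))
    (hθhat : CrossVal.IsMEstimator P X Ψ θhat)
    (θs : EuclideanSpace ℝ (Fin d))
    (hθs : IsMinOn (CrossVal.risk P X Ψ) Set.univ θs)
    -- the score is square integrable, and the Hessian at `θs` of the population objective exists,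
    -- is the expected Hessian, and is invertible
    (hscore : MemLp (fun ω => gradient (Ψ (X 0 ω)) θs) 2 P)
    (hHint : Integrable (fun ω => CrossVal.hessian (Ψ (X 0 ω)) θs) P)
    (hH : HasFDerivAt (gradient (CrossVal.risk P X Ψ)) (CrossVal.expectedHessian P X Ψ θs) θs)
    (hHinv : (CrossVal.expectedHessian P X Ψ θs).IsInvertible)
    -- the evaluation loss and its risk
    (L : S → EuclideanSpace ℝ (Fin d) → ℝ)
    (hLm : Measurable (Function.uncurry L))
    (hL2 : ∀ θ, MemLp (fun ω => L (X 0 ω) θ) 2 P)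
    (hLcont : ∀ᵐ ω ∂P, ContinuousAt (L (X 0 ω)) θs)
    (hR : Differentiable ℝ (CrossVal.risk P X L))
    -- the conditions `H₀`-`H₃`
    (hstab : CrossVal.StabilityConditions P X X' Xt L θhat K) :
    (∀ ρ : ℝ, CrossVal.IsCovarianceTerm P X X' Xt L θhat K ρ ↔
      ρ = - covariance
        (fun ω => inner ℝ (gradient (CrossVal.risk P X L) θs)
          ((CrossVal.expectedHessian P X Ψ θs).inverse (gradient (Ψ (X 0 ω)) θs)))
        (fun ω => L (X 0 ω) θs) P) ∧
    (Ψ = L → ∀ ρ : ℝ, CrossVal.IsCovarianceTerm P X X' Xt L θhat K ρ ↔ ρ = 0) := by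
  have hX0 : Measurable (X 0) := hX.measurable (Sum.inl 0)
  set H := CrossVal.expectedHessian P X Ψ θs with hHdef
  -- `ContinuousLinearMap.inverse` is zero on non-invertible maps; invertibility makes it a
  -- two-sided inverse.
  have hHi : (∀ u, H (H.inverse u) = u) ∧ ∀ u, H.inverse (H u) = u := by
    obtain ⟨e, he⟩ := hHinv
    rw [← he, ContinuousLinearMap.inverse_equiv]
    simp
  obtain ⟨hgrad0, hE0, hlin⟩ := CrossVal.tendstoInMeasure_mEstimator (H := H) (Hi := H.inverse)
    hX.identDistrib_left hX.indep_left hΨm (fun x => (hΨconv x).convexOn) (fun x => (hΨdiff x).1)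
    (fun x => (hΨdiff x).2) hΨint hθhat hθs hscore hHint rfl hH hHi.1 hHi.2 hX0.aemeasurable
  have hgm : Measurable fun x => gradient (Ψ x) θs :=
    CrossVal.measurable_gradient_section hΨm (fun x => (hΨdiff x).1) θs
  have hψ0 : ∫ ω, H.inverse (gradient (Ψ (X 0 ω)) θs) ∂P = 0 := by
    rw [H.inverse.integral_comp_comm (hscore.integrable one_le_two), hE0, map_zero]
  have hlin' : TendstoInMeasure P (fun (l : ℕ) ω => √(l : ℝ) • ((θhat l fun i => X i ω) - θs)
      + CrossVal.normSum X (fun x => H.inverse (gradient (Ψ x) θs)) l ω) atTop fun _ => 0 := by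
    refine hlin.congr (fun l => Eventually.of_forall fun ω => ?_) (ae_eq_refl _)
    simp only [CrossVal.normSum, map_smul, map_sum]
  obtain ⟨C₁, hC₁⟩ := hstab.H₁
  obtain ⟨C₃, hC₃⟩ := hstab.H₃_first
  have hsel : ∀ l : ℕ → ℕ, (∀ n, l n ∈ CrossVal.trainSizes K n) → Tendsto l atTop atTop ∧
      (∀ᶠ n in atTop, eLpNorm (fun ω => CrossVal.testLoss L θhat (l n) (Xt ω) fun i => X i ω) 4 P
        ≤ (max C₁ C₃ : ℝ≥0)) ∧
      ∀ᶠ n in atTop, (l n : ℝ≥0∞) * eLpNorm (P[CrossVal.beta₁ X X' Xt L θhat (l n) |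
        CrossVal.sigmaProcess X]) 4 P ≤ (max C₁ C₃ : ℝ≥0) := by
    intro l hl
    have hmem : ∀ n, l n = n - n / K n ∨ l n = n - n ⌈/⌉ K n := fun n => by
      simpa [CrossVal.trainSizes] using hl n
    -- H₃ is normalised by n, and l ≤ n transfers its bound to the factor l.
    have hle : ∀ n, l n ≤ n := fun n => by
      rcases hmem n with h | h <;> (rw [h]; exact Nat.sub_le _ _)
    refine ⟨?_, ?_, ?_⟩
    · have h2 := hK2.mono fun n hn => hn.1
      have ha := CrossVal.tendsto_sub_div_atTop h2
      have hb := CrossVal.tendsto_sub_ceilDiv_atTop h2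
      rw [tendsto_atTop] at ha hb ⊢
      intro B
      filter_upwards [ha B, hb B] with n h1 h2
      rcases hmem n with h | h <;> rwa [h]
    · filter_upwards [hC₁] with n hn
      refine le_trans (le_trans ?_ hn) (by exact_mod_cast le_max_left C₁ C₃)
      exact Finset.le_sup (f := fun l =>
        eLpNorm (fun ω => CrossVal.testLoss L θhat l (Xt ω) fun i => X i ω) 4 P) (hl n)
    · filter_upwards [hC₃] with n hn
      refine le_trans (le_trans ?_ hn) (by exact_mod_cast le_max_right C₁ C₃)
      refine mul_le_mul' (by exact_mod_cast hle n) ?_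
      exact Finset.le_sup (f := fun l => eLpNorm (P[CrossVal.beta₁ X X' Xt L θhat l |
        CrossVal.sigmaProcess X]) 4 P) (hl n)
  have hmain : ∀ ρ : ℝ, CrossVal.IsCovarianceTerm P X X' Xt L θhat K ρ ↔
      ρ = - covariance
        (fun ω => inner ℝ (gradient (CrossVal.risk P X L) θs)
          (H.inverse (gradient (Ψ (X 0 ω)) θs))) (fun ω => L (X 0 ω) θs) P := by
    refine CrossVal.isCovarianceTerm_iff_of_tendsto fun l m hl hm => ?_
    obtain ⟨hl1, hl2, hl3⟩ := hsel l hl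
    obtain ⟨hm1, hm2, -⟩ := hsel m hm
    exact CrossVal.tendsto_mul_covariance_beta₁ hX hLm hθm hstab.H₀
      (H.inverse.continuous.measurable.comp hgm) (H.inverse.comp_memLp' hscore) hψ0 hlin' hLcont
      (hR θs).hasGradientAt.hasFDerivAt hl1 hm1 hl2 hm2 hl3
  refine ⟨hmain, ?_⟩
  rintro rfl ρ
  -- The evaluation risk is now the training objective, whose gradient vanishes at its minimiser.
  have hg : gradient (CrossVal.risk P X Ψ) θs = 0 := hgrad0
  rw [hmain ρ, hg]
  simp
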